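/- Let $d\ge 3$, let $\mathbf T^d=[-\tfrac12,\tfrac12]^d$ be the torus (opposite faces identified), and put $$e(p)=\sum_{i=1}^d\bigl(1-\cos(2\pi p^{(i)})\bigr),\qquad \Theta(a)=\lim_{\varepsilon\to0+}\int_{\mathbf T^d}\frac{dq}{a-e(q)+i\varepsilon}\quad(a\in\mathbf R),\qquad \omega(p)=e(p)+\lambda^2\,\Theta(e(p)),$$ where $\lambda>0$ (the limit defining $\Theta$ exists for every real $a$). For $h:\mathbf T^d\to\mathbf C$ and $a\in\mathbf R$ write $$\int h(p)\,\delta(e(p)-a)\,dp:=\int_{\Sigma_a}h(q)\,\frac{d\nu(q)}{|\nabla e(q)|},\qquad \Sigma_a=\{q\in\mathbf T^d: e(q)=a\},$$ with $\nu$ the $(d-1)$-dimensional surface measure on $\Sigma_a$. Let $0<\kappa<\tfrac1{16}$ and let $f:\mathbf T^d\to\mathbf C$ be a $C^1$ function. Then there are constants $C$ and $\lambda_0>0$, depending only on $d,\kappa,f$, such that for all $0<\lambda<\lambda_0$, all $\eta$ with $\lambda^{2+4\kappa}\le\eta\le\lambda^{2+\kappa}$, all $r\in\mathbf R^d$ with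 $|r|\le\lambda^{2+\kappa/4}$ and all $\alpha,\beta\in\mathbf R$, with $\gamma=(\alpha+\beta)/2$, both integrals below converge absolutely and $$\left|\int_{\mathbf T^d}\frac{\lambda^2 f(p)}{\bigl(\alpha-\overline{\omega(p-r)}-i\eta\bigr)\bigl(\beta-\omega(p+r)+i\eta\bigr)}\,dp +2\pi i\,\lambda^2\int\frac{f(p)\,\delta(e(p)-\gamma)}{(\alpha-\beta)+2\,\nabla e(p)\cdot r-2i\,\bigl[\eta-\lambda^2\,\mathrm{Im}\,\Theta(\gamma)\bigr]}\,dp\right| \le C\,\lambda^{1/2-8\kappa}\,|\log\lambda| .$$ -/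

import Mathlib

open MeasureTheory Filter Topology

namespace Ladder

noncomputable section

/-- Momentum space `ℝ^d` with the Euclidean norm. -/
abbrev Mom (d : ℕ) : Type := EuclideanSpace ℝ (Fin d)

/-- The fundamental cell `[-1/2, 1/2)^d` of the torus `𝕋^d = ℝ^d / ℤ^d`
(each point of the torus has exactly one representative in it). -/
def cell (d : ℕ) : Set (Mom d) :=
  {p | ∀ i, p i ∈ Set.Ico (-(1 / 2) : ℝ) (1 / 2)}

/-- A function on the torus, seen as a `ℤ^d`-periodic function on `ℝ^d`. -/
def IsPeriodic {d : ℕ} (f : Mom d → ℂ) : Prop :=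
  ∀ (p : Mom d) (i : Fin d), f (p + EuclideanSpace.single i (1 : ℝ)) = f p

/-- The lattice dispersion relation `e(p) = ∑ᵢ (1 - cos (2π pᵢ))`. -/
def disp {d : ℕ} (p : Mom d) : ℝ :=
  ∑ i, (1 - Real.cos (2 * Real.pi * p i))

/-- The level surface `Σ_a = {q ∈ 𝕋^d : e(q) = a}`. -/
def shell (d : ℕ) (a : ℝ) : Set (Mom d) :=
  {q | q ∈ cell d ∧ disp q = a}

/-- The integrand `h / |∇e|` of the energy shell integral. -/
def shellDensity {d : ℕ} (h : Mom d → ℂ) (q : Mom d) : ℂ :=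
  h q / ((‖gradient (disp (d := d)) q‖ : ℝ) : ℂ)

/-- The surface measure on `Σ_a`: the `(d-1)`-dimensional Hausdorff measure, in the Euclidean
normalization, restricted to `Σ_a`. -/
def shellMeasure (d : ℕ) (a : ℝ) : Measure (Mom d) :=
  (Measure.euclideanHausdorffMeasure (d - 1) : Measure (Mom d)).restrict (shell d a)

/-- The energy shell integral
`∫ h(p) δ(e(p) - a) dp = ∫_{Σ_a} h(q) dν(q) / |∇e(q)|`. -/
def deltaIntegral {d : ℕ} (h : Mom d → ℂ) (a : ℝ) : ℂ :=
  ∫ q, shellDensity h q ∂(shellMeasure d a)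

/-- `Θ_ε(a) = ∫_{𝕋^d} 1 / (a - e(q) + iε) dq`. -/
def ThetaReg (d : ℕ) (ε a : ℝ) : ℂ :=
  ∫ q in cell d, 1 / ((a : ℂ) - (disp q : ℂ) + Complex.I * (ε : ℂ))

/-- `Θ(a) = lim_{ε → 0+} Θ_ε(a)`. -/
def Theta (d : ℕ) (a : ℝ) : ℂ :=
  limUnder (𝓝[>] (0 : ℝ)) (fun ε : ℝ => ThetaReg d ε a)

/-- The renormalized dispersion relation `ω(p) = e(p) + λ² Θ(e(p))`. -/
def omega {d : ℕ} (lam : ℝ) (p : Mom d) : ℂ :=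
  (disp p : ℂ) + (lam : ℂ) ^ 2 * Theta d (disp p)

/-- The integrand of the ladder integral,
`λ² f(p) / ((α - conj ω(p-r) - iη) (β - ω(p+r) + iη))`. -/
def ladderIntegrand {d : ℕ} (f : Mom d → ℂ) (lam η α β : ℝ) (r p : Mom d) : ℂ :=
  (lam : ℂ) ^ 2 * f p /
    (((α : ℂ) - (starRingEnd ℂ) (omega lam (p - r)) - Complex.I * (η : ℂ)) *
      ((β : ℂ) - omega lam (p + r) + Complex.I * (η : ℂ)))

/-- The function integrated over the energy shell of energy `γ = (α + β) / 2`,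
`f(p) / ((α - β) + 2 ∇e(p)·r - 2i (η - λ² Im Θ(γ)))`. -/
def shellIntegrand {d : ℕ} (f : Mom d → ℂ) (lam η α β : ℝ) (r p : Mom d) : ℂ :=
  f p /
    (((α - β + 2 * inner ℝ (gradient (disp (d := d)) p) r : ℝ) : ℂ) -
      2 * Complex.I * ((η - lam ^ 2 * (Theta d ((α + β) / 2)).im : ℝ) : ℂ))

end

end Ladder

open MeasureTheory Filter Topology

namespace Ladder

noncomputable section

/-! ### Splitting off the first coordinate -/

/-! Up to sign, the two denominators are close to e(p) - z(p) and e(p) - w(p). The poles z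
(`advPole`, below the real axis) and w (`retPole`, above it) arise by Taylor expanding e(p ± r) and
freezing Θ at γ. If the energy a = e(p) were a variable independent of p, integrating over it would
give ∫ da / ((a - z)(a - w)) = -2πi / (z - w), and z - w is exactly the denominator on the energy
shell. The task is thus to decouple energy from momentum: write ∫ F(p, e(p)) dp as the integral over
a of the shell integrals of F(·, a) at energy a, and move every shell to the energy γ. This costs ∫
N(a) |a - γ|^(3/8) da, where N(a) bounds both the size and the Lipschitz constant of F(·, a)
(`integral_disp_sub_shellInt_le`).

The exponent 3/8 is the Hölder regularity of shell integrals in the energy (`shellInt_holder`), and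
this is where d ≥ 3 enters. With p = (x, y) and y fixed, the energy of x follows an arcsine law,
whose density g has inverse square root singularities. It is 3/8-Hölder at the price of a weight
g^(7/4), and averaging over at least two further coordinates bounds the integral of this weight
uniformly in the energy (`lintegral_arcDensity_disp_le`). Critical energies therefore need no
separate treatment.

The same decoupling shows that Θ exists and is 3/8-Hölder: the difference of two regularizations is
an integral of a resolvent product with both poles on one side, whose main term vanishes
(`ThetaReg_sub_le`). The area formula for graphs identifies the surface integral with its coordinate
form (`deltaIntegral_eq_shellInt`).

Sizes: put ℓ = λ² and ρ = λ^(4κ). The denominators are at least a constant times ρ(|a - α| + ℓ) and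
ρ(|a - β| + ℓ). Each replacement involves at most three reciprocals, hence ρ^(-3); the remaining
energy integral is of order ℓ^(-5/8), uniformly in α and β. With the prefactor λ² the error is
ρ^(-3) ℓ^(3/8) = λ^(3/4 - 12κ), which is at most λ^(1/2 - 8κ) because κ < 1/16. -/

/-- The point `(x, y₁, …, yₙ)`. -/
def glue {n : ℕ} (x : ℝ) (y : Mom n) : Mom (n + 1) :=
  WithLp.toLp 2 (Fin.cons x (fun i => y i))

@[simp] lemma glue_zero {n : ℕ} (x : ℝ) (y : Mom n) : glue x y 0 = x := rfl

@[simp] lemma glue_succ {n : ℕ} (x : ℝ) (y : Mom n) (i : Fin n) : glue x y i.succ = y i := rfl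

lemma glue_sub {n : ℕ} (x x' : ℝ) (y y' : Mom n) :
    glue x y - glue x' y' = glue (x - x') (y - y') := by
  ext i; refine Fin.cases ?_ (fun j => ?_) i <;> simp

lemma norm_glue_sq {n : ℕ} (x : ℝ) (y : Mom n) : ‖glue x y‖ ^ 2 = x ^ 2 + ‖y‖ ^ 2 := by
  simp [EuclideanSpace.norm_sq_eq, Fin.sum_univ_succ]

lemma norm_glue {n : ℕ} (x : ℝ) (y : Mom n) : ‖glue x y‖ = Real.sqrt (x ^ 2 + ‖y‖ ^ 2) := by
  rw [← norm_glue_sq, Real.sqrt_sq (norm_nonneg _)]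

lemma norm_glue_sub_glue {n : ℕ} (x x' : ℝ) (y : Mom n) :
    ‖glue x y - glue x' y‖ = |x - x'| := by
  rw [glue_sub, norm_glue]; simp [Real.sqrt_sq_eq_abs]

lemma disp_glue {n : ℕ} (x : ℝ) (y : Mom n) :
    disp (glue x y) = (1 - Real.cos (2 * Real.pi * x)) + disp y := by
  simp only [disp, Fin.sum_univ_succ, glue_zero, glue_succ]

lemma glue_mem_cell {n : ℕ} {x : ℝ} {y : Mom n} :
    glue x y ∈ cell (n + 1) ↔ x ∈ Set.Ico (-(1 / 2) : ℝ) (1 / 2) ∧ y ∈ cell n := by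
  simp only [cell, Set.mem_ofPred_eq, Fin.forall_fin_succ, glue_zero, glue_succ]

lemma continuous_glue {n : ℕ} : Continuous (fun z : ℝ × Mom n => glue z.1 z.2) := by
  unfold glue
  refine (PiLp.continuous_toLp 2 _).comp (continuous_pi fun i => ?_)
  refine Fin.cases ?_ (fun j => ?_) i
  · simpa using continuous_fst
  · simp only [Fin.cons_succ]; fun_prop

/-- Splitting off the first coordinate, as a measurable equivalence. -/
def glueEquiv (n : ℕ) : ℝ × Mom n ≃ᵐ Mom (n + 1) where
  toFun z := glue z.1 z.2
  invFun p := (p 0, WithLp.toLp 2 (fun i => p i.succ))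
  left_inv z := by ext <;> simp
  right_inv p := by ext i; refine Fin.cases ?_ (fun j => ?_) i <;> simp
  measurable_toFun := continuous_glue.measurable
  measurable_invFun := by
    refine Continuous.measurable ?_
    refine Continuous.prodMk (by fun_prop) ((PiLp.continuous_toLp 2 _).comp ?_)
    fun_prop

@[simp] lemma glueEquiv_apply {n : ℕ} (z : ℝ × Mom n) : glueEquiv n z = glue z.1 z.2 := rfl

lemma measurePreserving_glueEquiv (n : ℕ) :
    MeasurePreserving (glueEquiv n) (volume.prod volume) volume := by
  have h1 : MeasurePreserving (fun z : ℝ × Mom n => (z.1, (WithLp.ofLp z.2 : Fin n → ℝ)))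
      (volume.prod volume) (volume.prod volume) :=
    (MeasurePreserving.id volume).prod (PiLp.volume_preserving_ofLp (Fin n))
  have h2 := (volume_preserving_piFinSuccAbove (fun _ : Fin (n + 1) => ℝ) 0).symm
  have h3 := PiLp.volume_preserving_toLp (Fin (n + 1))
  have h := h3.comp (h2.comp h1)
  have heq : ⇑(glueEquiv n) = WithLp.toLp 2 ∘
      ⇑(MeasurableEquiv.piFinSuccAbove (fun _ : Fin (n + 1) => ℝ) 0).symm ∘
        fun z : ℝ × Mom n => (z.1, (WithLp.ofLp z.2 : Fin n → ℝ)) := by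
    funext z
    ext i
    refine Fin.cases ?_ (fun j => ?_) i <;>
      simp [glue, MeasurableEquiv.piFinSuccAbove_symm_apply, Fin.insertNthEquiv]
  rw [heq]
  exact h

lemma measurableSet_cell (d : ℕ) : MeasurableSet (cell d) := by
  have : cell d = ⋂ i : Fin d, (fun p : Mom d => p i) ⁻¹' Set.Ico (-(1 / 2) : ℝ) (1 / 2) := by
    ext p; simp [cell]
  rw [this]
  exact MeasurableSet.iInter fun i =>
    (EuclideanSpace.proj (𝕜 := ℝ) i).continuous.measurable measurableSet_Ico

lemma preimage_cell (n : ℕ) :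
    glueEquiv n ⁻¹' cell (n + 1) = Set.Ico (-(1 / 2) : ℝ) (1 / 2) ×ˢ cell n := by
  ext z; simp only [Set.mem_preimage, glueEquiv_apply, glue_mem_cell, Set.mem_prod]

lemma measurePreserving_glueEquiv_cell (n : ℕ) :
    MeasurePreserving (glueEquiv n)
      ((volume.restrict (Set.Ico (-(1 / 2) : ℝ) (1 / 2))).prod (volume.restrict (cell n)))
      (volume.restrict (cell (n + 1))) := by
  have := (measurePreserving_glueEquiv n).restrict_preimage (measurableSet_cell (n + 1))
  rwa [preimage_cell, ← Measure.prod_restrict] at this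

lemma volume_cell (d : ℕ) : volume (cell d) = 1 := by
  induction d with
  | zero =>
    have : cell 0 = Set.univ := by ext p; simp [cell]
    have h2 : (Set.univ : Set (Mom 0)) = {0} := by ext p; simp [Subsingleton.elim p 0]
    -- In dimension zero the volume is the zero-dimensional Hausdorff measure, which counts the
    -- single point.
    rw [this, ← EuclideanSpace.euclideanHausdorffMeasure_eq_volume,
      Measure.euclideanHausdorffMeasure_zero, h2, Measure.hausdorffMeasure_zero_singleton]
  | succ n ih =>
    rw [← (measurePreserving_glueEquiv n).measure_preimage
      (measurableSet_cell _).nullMeasurableSet, preimage_cell, Measure.prod_prod, ih]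
    norm_num

lemma continuous_disp {d : ℕ} : Continuous (disp (d := d)) := by
  unfold disp; fun_prop

/-! ### The arcsine law -/

/-- Half the density of `1 - cos (2π x)`, `x` uniform on the circle; zero outside `(0, 2)`. -/
def arcDensity (t : ℝ) : ℝ := (2 * Real.pi * Real.sqrt (t * (2 - t)))⁻¹

/-- The solution `x ∈ [0, 1/2]` of `1 - cos (2π x) = t`. -/
def arcAngle (t : ℝ) : ℝ := Real.arccos (1 - t) / (2 * Real.pi)

lemma arcDensity_nonneg (t : ℝ) : 0 ≤ arcDensity t := by unfold arcDensity; positivity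

/-- Square roots of nonpositive numbers and the inverse of zero are zero by convention. This lets
integrals over (0, 2) run over the whole line. -/
lemma arcDensity_of_notMem {t : ℝ} (ht : t ∉ Set.Ioo (0 : ℝ) 2) : arcDensity t = 0 := by
  have : t * (2 - t) ≤ 0 := by
    rw [Set.mem_Ioo, not_and_or, not_lt, not_lt] at ht
    rcases ht with h | h <;> nlinarith
  simp [arcDensity, Real.sqrt_eq_zero_of_nonpos this]

lemma measurable_arcDensity : Measurable arcDensity := by unfold arcDensity; fun_prop

lemma continuous_arcAngle : Continuous arcAngle := by
  unfold arcAngle; exact (Real.continuous_arccos.comp (by fun_prop)).div_const _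

lemma arcAngle_mem (t : ℝ) : arcAngle t ∈ Set.Icc (0 : ℝ) (1 / 2) := by
  unfold arcAngle
  refine ⟨by positivity [Real.arccos_nonneg (1 - t)], ?_⟩
  rw [div_le_iff₀ (by positivity)]
  linarith [Real.arccos_le_pi (1 - t)]

lemma arcAngle_mem_Ioo {t : ℝ} (ht : t ∈ Set.Ioo (0 : ℝ) 2) :
    arcAngle t ∈ Set.Ioo (0 : ℝ) (1 / 2) := by
  unfold arcAngle
  have h1 : 0 < Real.arccos (1 - t) := Real.arccos_pos.2 (by linarith [ht.1])
  have h2 : Real.arccos (1 - t) < Real.pi := by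
    refine lt_of_le_of_ne (Real.arccos_le_pi _) fun h => ?_
    rw [Real.arccos_eq_pi] at h; linarith [ht.2]
  refine ⟨by positivity, ?_⟩
  rw [div_lt_iff₀ (by positivity)]
  linarith

lemma two_pi_mul_arcAngle (t : ℝ) : 2 * Real.pi * arcAngle t = Real.arccos (1 - t) := by
  unfold arcAngle; field_simp

lemma one_sub_cos_arcAngle {t : ℝ} (ht : t ∈ Set.Icc (0 : ℝ) 2) :
    1 - Real.cos (2 * Real.pi * arcAngle t) = t := by
  rw [two_pi_mul_arcAngle, Real.cos_arccos] <;> linarith [ht.1, ht.2]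

lemma sin_arcAngle (t : ℝ) :
    Real.sin (2 * Real.pi * arcAngle t) = Real.sqrt (t * (2 - t)) := by
  rw [two_pi_mul_arcAngle, Real.sin_arccos]; congr 1; ring

lemma arcAngle_one_sub_cos {x : ℝ} (hx : x ∈ Set.Icc (0 : ℝ) (1 / 2)) :
    arcAngle (1 - Real.cos (2 * Real.pi * x)) = x := by
  unfold arcAngle
  have hpi := Real.pi_pos
  rw [sub_sub_cancel, Real.arccos_cos (by have := hx.1; positivity) (by nlinarith [hx.2])]
  field_simp

lemma hasDerivAt_arcAngle {t : ℝ} (ht : t ∈ Set.Ioo (0 : ℝ) 2) :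
    HasDerivAt arcAngle (arcDensity t) t := by
  have h := (Real.hasDerivAt_arccos (x := 1 - t) (by linarith [ht.2]) (by linarith [ht.1])).comp t
    ((hasDerivAt_id t).const_sub 1)
  have h' := h.div_const (2 * Real.pi)
  refine h'.congr_deriv ?_
  have : 1 - (1 - t) ^ 2 = t * (2 - t) := by ring
  rw [arcDensity, this, mul_inv]; field_simp

lemma injOn_arcAngle : Set.InjOn arcAngle (Set.Ioo 0 2) := fun t ht t' ht' h => by
  rw [← one_sub_cos_arcAngle ⟨ht.1.le, ht.2.le⟩, h, one_sub_cos_arcAngle ⟨ht'.1.le, ht'.2.le⟩]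

lemma image_arcAngle : arcAngle '' Set.Ioo 0 2 = Set.Ioo 0 (1 / 2) := by
  ext x
  constructor
  · rintro ⟨t, ht, rfl⟩; exact arcAngle_mem_Ioo ht
  · intro hx
    refine ⟨1 - Real.cos (2 * Real.pi * x), ⟨?_, ?_⟩, arcAngle_one_sub_cos ⟨hx.1.le, hx.2.le⟩⟩
    · have := Real.cos_lt_cos_of_nonneg_of_le_pi le_rfl
        (y := 2 * Real.pi * x) (by nlinarith [Real.pi_pos, hx.2]) (by have := hx.1; positivity)
      rw [Real.cos_zero] at this; linarith
    · have := Real.cos_lt_cos_of_nonneg_of_le_pi (x := 2 * Real.pi * x)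
        (by have := hx.1; positivity) le_rfl (by nlinarith [Real.pi_pos, hx.2])
      rw [Real.cos_pi] at this; linarith

lemma lintegral_Ioo_half (Φ : ℝ → ENNReal) :
    ∫⁻ x in Set.Ioo (0 : ℝ) (1 / 2), Φ x = ∫⁻ t, ENNReal.ofReal (arcDensity t) * Φ (arcAngle t) := by
  rw [← image_arcAngle, lintegral_image_eq_lintegral_abs_deriv_mul measurableSet_Ioo
    (fun t ht => (hasDerivAt_arcAngle ht).hasDerivWithinAt) injOn_arcAngle]
  simp_rw [abs_of_nonneg (arcDensity_nonneg _)]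
  rw [← lintegral_indicator measurableSet_Ioo]
  congr 1; ext t
  by_cases ht : t ∈ Set.Ioo (0 : ℝ) 2
  · simp [ht]
  · simp [ht, arcDensity_of_notMem ht]

/-- Change of variables `t = 1 - cos (2π x)` on the circle. -/
lemma lintegral_circle {Φ : ℝ → ENNReal} (hΦ : Measurable Φ) :
    ∫⁻ x in Set.Ico (-(1 / 2) : ℝ) (1 / 2), Φ x =
      ∫⁻ t, ENNReal.ofReal (arcDensity t) * (Φ (arcAngle t) + Φ (-arcAngle t)) := by
  have h1 : Set.Ico (-(1 / 2) : ℝ) (1 / 2) = Set.Ico (-(1 / 2)) 0 ∪ Set.Ico 0 (1 / 2) := by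
    rw [Set.Ico_union_Ico_eq_Ico] <;> norm_num
  have hd : Disjoint (Set.Ico (-(1 / 2) : ℝ) 0) (Set.Ico 0 (1 / 2)) := by
    rw [Set.disjoint_left]; intro x hx hx'; linarith [hx.2, hx'.1]
  have h2 : ∫⁻ x in Set.Ico (-(1 / 2) : ℝ) 0, Φ x = ∫⁻ x in Set.Ioo (0 : ℝ) (1 / 2), Φ (-x) := by
    have := (Measure.measurePreserving_neg (volume : Measure ℝ)).setLIntegral_comp_preimage
      (s := Set.Ioo (-(1 / 2) : ℝ) 0) measurableSet_Ioo hΦ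
    rw [setLIntegral_congr Ioo_ae_eq_Ico.symm, ← this]
    congr 2
    ext x; simp only [Set.mem_preimage, Set.mem_Ioo]; constructor <;> rintro ⟨a, b⟩ <;>
      constructor <;> linarith
  rw [h1, lintegral_union measurableSet_Ico hd, h2, setLIntegral_congr Ioo_ae_eq_Ico.symm,
    lintegral_Ioo_half, lintegral_Ioo_half, ← lintegral_add_right]
  · congr 1; ext t; ring
  · exact (measurable_arcDensity.ennreal_ofReal).mul (hΦ.comp continuous_arcAngle.measurable)

/-! ### Hölder estimates for the arcsine law -/

/-- For 0 < y, with a ≥ b the two inverse roots and δ = y' - y, both a - b ≤ a and a - b ≤ δ a³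
hold. Interpolating with exponents 5/8 and 3/8 gives δ^(3/8) a^(7/4). For y ≤ 0 < y' the first root
contributes zero and the same interpolation applies to b alone. The power 7/4 stays below 2, which
keeps the weight integrable. -/
lemma inv_sqrt_sub_le {y y' : ℝ} (h : y ≤ y') :
    |(Real.sqrt y)⁻¹ - (Real.sqrt y')⁻¹| ≤
      (y' - y) ^ (3 / 8 : ℝ) * ((Real.sqrt y)⁻¹ ^ (7 / 4 : ℝ) + (Real.sqrt y')⁻¹ ^ (7 / 4 : ℝ)) := by
  have hp : ∀ a : ℝ, 0 ≤ a → a ^ (5 / 8 : ℝ) * (a ^ 3) ^ (3 / 8 : ℝ) = a ^ (7 / 4 : ℝ) := by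
    intro a ha
    rw [← Real.rpow_natCast, ← Real.rpow_mul ha, ← Real.rpow_add_of_nonneg ha (by norm_num)
      (by norm_num)]
    norm_num
  have key : ∀ a b δ : ℝ, 0 ≤ a → 0 ≤ b → 0 ≤ δ → b ≤ a → b ≤ δ * a ^ 3 →
      b ≤ δ ^ (3 / 8 : ℝ) * a ^ (7 / 4 : ℝ) := by
    intro a b δ ha hb hδ h1 h2
    calc b = b ^ (5 / 8 : ℝ) * b ^ (3 / 8 : ℝ) := by
          rw [← Real.rpow_add_of_nonneg hb (by norm_num) (by norm_num)]; norm_num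
      _ ≤ a ^ (5 / 8 : ℝ) * (δ * a ^ 3) ^ (3 / 8 : ℝ) := by gcongr
      _ = δ ^ (3 / 8 : ℝ) * a ^ (7 / 4 : ℝ) := by
          rw [Real.mul_rpow hδ (by positivity), ← hp a ha]; ring
  rcases le_or_gt y' 0 with h1 | h1
  · simp [Real.sqrt_eq_zero_of_nonpos h1, Real.sqrt_eq_zero_of_nonpos (h.trans h1)]
  set b := (Real.sqrt y')⁻¹ with hb
  have hbpos : 0 < b := by positivity
  have hb2 : b ^ 2 * y' = 1 := by
    rw [hb, inv_pow, Real.sq_sqrt h1.le]; field_simp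
  have hδ : 0 ≤ y' - y := by linarith
  rcases le_or_gt y 0 with h2 | h2
  · rw [Real.sqrt_eq_zero_of_nonpos h2]
    simp only [inv_zero, zero_sub, abs_neg, abs_of_pos hbpos]
    rw [Real.zero_rpow (by norm_num), zero_add]
    refine key b b _ hbpos.le hbpos.le hδ le_rfl ?_
    have h3 : b ^ 3 * y' = b := by rw [pow_succ, mul_right_comm, hb2, one_mul]
    have h4 : b ^ 3 * y ≤ 0 := mul_nonpos_of_nonneg_of_nonpos (by positivity) h2
    linarith
  · set a := (Real.sqrt y)⁻¹ with ha
    have hapos : 0 < a := by positivity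
    have ha2 : a ^ 2 * y = 1 := by
      rw [ha, inv_pow, Real.sq_sqrt h2.le]; field_simp
    have hab : b ≤ a := by
      rw [ha, hb]; gcongr
    rw [abs_of_nonneg (by linarith)]
    refine (key a (a - b) _ hapos.le (by linarith) hδ (by linarith) ?_).trans ?_
    · have h3 : b * y' * b = 1 := by linarith
      have h4 : y * a = 1 / a := by field_simp; linarith
      have h5 : 1 / b = b * y' := by field_simp; linarith
      have h6 : a ^ 3 * y = a := by nlinarith
      have h7 : a * b ≤ a * a := by gcongr
      have h8 : a ^ 2 ≤ a ^ 2 * (a ^ 2 * y') := by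
        have : 1 ≤ a ^ 2 * y' := by nlinarith
        nlinarith
      have h9 : a ≤ a * (b * (a * y')) := by
        have : 1 ≤ b * (a * y') := by nlinarith [mul_pos hbpos h1]
        nlinarith
      nlinarith [mul_nonneg hapos.le (sub_nonneg.2 hab), mul_pos hapos hbpos,
        mul_nonneg (mul_nonneg hapos.le (sub_nonneg.2 hab)) (mul_pos hapos h1).le]
    · gcongr
      have : 0 ≤ b ^ (7 / 4 : ℝ) := by positivity
      linarith

/-- The projection of the line to `[0, 2]`. -/
def clamp (t : ℝ) : ℝ := max 0 (min t 2)

lemma clamp_mem (t : ℝ) : clamp t ∈ Set.Icc (0 : ℝ) 2 :=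
  ⟨le_max_left _ _, max_le (by norm_num) (min_le_right _ _)⟩

lemma abs_clamp_sub_clamp_le (t t' : ℝ) : |clamp t - clamp t'| ≤ |t - t'| := by
  unfold clamp
  rw [max_comm, max_comm 0]
  exact (abs_max_sub_max_le_abs _ _ _).trans (abs_inf_sub_inf_le_abs t t' 2)

lemma clamp_of_mem {t : ℝ} (ht : t ∈ Set.Icc (0 : ℝ) 2) : clamp t = t := by
  simp [clamp, ht.1, ht.2]

lemma clamp_cases (t : ℝ) :
    t ∈ Set.Icc (0 : ℝ) 2 ∨ (t ≤ 0 ∧ clamp t = 0) ∨ (2 ≤ t ∧ clamp t = 2) := by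
  rcases le_or_gt t 0 with h | h
  · right; left; refine ⟨h, ?_⟩
    simp [clamp, min_eq_left (by linarith : t ≤ 2), h]
  · rcases le_or_gt t 2 with h2 | h2
    · exact Or.inl ⟨h.le, h2⟩
    · right; right; exact ⟨h2.le, by simp [clamp, min_eq_right h2.le]⟩

lemma arcDensity_clamp (t : ℝ) : arcDensity (clamp t) = arcDensity t := by
  rcases clamp_cases t with h | ⟨h, h'⟩ | ⟨h, h'⟩
  · rw [clamp_of_mem h]
  · rw [h', arcDensity_of_notMem (by simp), arcDensity_of_notMem (by simp [h.not_gt])]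
  · rw [h', arcDensity_of_notMem (by simp), arcDensity_of_notMem (by simp [h.not_gt])]

lemma arcAngle_clamp (t : ℝ) : arcAngle (clamp t) = arcAngle t := by
  rcases clamp_cases t with h | ⟨h, h'⟩ | ⟨h, h'⟩
  · rw [clamp_of_mem h]
  · rw [h']; simp [arcAngle, Real.arccos_eq_zero.2 (by linarith : 1 ≤ 1 - t)]
  · rw [h', arcAngle, arcAngle, Real.arccos_eq_pi.2 (by norm_num),
      Real.arccos_eq_pi.2 (by linarith)]

/-- The polynomial t(2 - t) is 2-Lipschitz only on [0, 2]; clamping changes neither density and does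
not increase the distance. -/
lemma arcDensity_holder : ∃ C : ℝ, 0 ≤ C ∧ ∀ t t' : ℝ, |arcDensity t - arcDensity t'| ≤
    C * |t - t'| ^ (3 / 8 : ℝ) * (arcDensity t ^ (7 / 4 : ℝ) + arcDensity t' ^ (7 / 4 : ℝ)) := by
  refine ⟨(2 * Real.pi)⁻¹ * 2 ^ (3 / 8 : ℝ) * (2 * Real.pi) ^ (7 / 4 : ℝ), by positivity, ?_⟩
  intro t t'
  rw [← arcDensity_clamp t, ← arcDensity_clamp t']
  have h0 := abs_clamp_sub_clamp_le t t'
  have ht := clamp_mem t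
  have ht' := clamp_mem t'
  set u := clamp t
  set u' := clamp t'
  have hq : ∀ v : ℝ, (Real.sqrt (v * (2 - v)))⁻¹ = 2 * Real.pi * arcDensity v := by
    intro v; unfold arcDensity; rw [mul_inv]; field_simp
  have hP : |u * (2 - u) - u' * (2 - u')| ≤ 2 * |t - t'| := by
    have : u * (2 - u) - u' * (2 - u') = (2 - u - u') * (u - u') := by ring
    rw [this, abs_mul]
    have : |2 - u - u'| ≤ 2 := by rw [abs_le]; constructor <;> linarith [ht.1, ht.2, ht'.1, ht'.2]
    gcongr
  have hsym : ∀ y y' : ℝ, |(Real.sqrt y)⁻¹ - (Real.sqrt y')⁻¹| ≤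
      |y - y'| ^ (3 / 8 : ℝ) *
        ((Real.sqrt y)⁻¹ ^ (7 / 4 : ℝ) + (Real.sqrt y')⁻¹ ^ (7 / 4 : ℝ)) := by
    intro y y'
    rcases le_total y y' with h | h
    · rw [abs_sub_comm y y', abs_of_nonneg (sub_nonneg.2 h)]; exact inv_sqrt_sub_le h
    · rw [abs_of_nonneg (sub_nonneg.2 h), abs_sub_comm, add_comm]; exact inv_sqrt_sub_le h
  have h1 := hsym (u * (2 - u)) (u' * (2 - u'))
  rw [hq, hq, ← mul_sub, abs_mul, abs_of_pos Real.two_pi_pos,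
    Real.mul_rpow Real.two_pi_pos.le (arcDensity_nonneg _),
    Real.mul_rpow Real.two_pi_pos.le (arcDensity_nonneg _), ← mul_add] at h1
  have h2 : |u * (2 - u) - u' * (2 - u')| ^ (3 / 8 : ℝ) ≤
      2 ^ (3 / 8 : ℝ) * |t - t'| ^ (3 / 8 : ℝ) := by
    rw [← Real.mul_rpow (by norm_num) (abs_nonneg _)]; gcongr
  have h3 : 0 ≤ arcDensity u ^ (7 / 4 : ℝ) + arcDensity u' ^ (7 / 4 : ℝ) := by
    have := arcDensity_nonneg u; have := arcDensity_nonneg u'; positivity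
  have h4 : |arcDensity u - arcDensity u'| =
      (2 * Real.pi)⁻¹ * (2 * Real.pi * |arcDensity u - arcDensity u'|) := by field_simp
  rw [h4]
  calc _ ≤ (2 * Real.pi)⁻¹ * (2 ^ (3 / 8 : ℝ) * |t - t'| ^ (3 / 8 : ℝ) * ((2 * Real.pi) ^ (7 / 4 : ℝ)
          * (arcDensity u ^ (7 / 4 : ℝ) + arcDensity u' ^ (7 / 4 : ℝ)))) := by
        refine mul_le_mul_of_nonneg_left (h1.trans ?_) (by positivity)
        gcongr
    _ = _ := by ring

/-- With half difference x and half sum y, the sides are 2 sin² x and 2 sin x sin y, and x ≤ y ≤ π -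
x. So the cosine varies least at the ends of [0, π], where the arccosine has its worst modulus of
continuity. -/
lemma one_sub_cos_sub_le {θ θ' : ℝ} (h0 : 0 ≤ θ) (h : θ ≤ θ') (hpi : θ' ≤ Real.pi) :
    1 - Real.cos (θ' - θ) ≤ Real.cos θ - Real.cos θ' := by
  set x := (θ' - θ) / 2 with hx
  set y := (θ' + θ) / 2 with hy
  have e1 : θ' - θ = 2 * x := by rw [hx]; ring
  have e2 : θ = y - x := by rw [hx, hy]; ring
  have e3 : θ' = y + x := by rw [hx, hy]; ring
  have hx0 : 0 ≤ Real.sin x := Real.sin_nonneg_of_nonneg_of_le_pi (by linarith) (by linarith)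
  have hle : Real.sin x ≤ Real.sin y := by
    rcases le_total y (Real.pi / 2) with h' | h'
    · exact Real.sin_le_sin_of_le_of_le_pi_div_two (by linarith) h' (by linarith)
    · rw [← Real.sin_pi_sub y]
      exact Real.sin_le_sin_of_le_of_le_pi_div_two (by linarith) (by linarith) (by linarith)
  have e4 : Real.cos (θ' - θ) = 1 - 2 * Real.sin x ^ 2 := by
    rw [e1, Real.cos_two_mul, ← Real.sin_sq_add_cos_sq x]; ring
  have e5 : Real.cos θ - Real.cos θ' = 2 * Real.sin y * Real.sin x := by
    rw [e2, e3, Real.cos_sub, Real.cos_add]; ring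
  rw [e4, e5]; nlinarith

/-- The natural exponent is 1/2, from the quadratic behaviour of the cosine at its extrema. It is
lowered to 3/8, which is allowed since angles differ by at most 1, to match `arcDensity_holder`. -/
lemma arcAngle_holder (t t' : ℝ) : |arcAngle t - arcAngle t'| ≤ |t - t'| ^ (3 / 8 : ℝ) := by
  wlog hle : arcAngle t ≤ arcAngle t' generalizing t t'
  · rw [abs_sub_comm, abs_sub_comm t t']; exact this t' t (not_le.1 hle).le
  have h0 := abs_clamp_sub_clamp_le t t'
  rw [← arcAngle_clamp t, ← arcAngle_clamp t'] at hle ⊢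
  have ht := clamp_mem t
  have ht' := clamp_mem t'
  set u := clamp t
  set u' := clamp t'
  have hX := arcAngle_mem u
  have hX' := arcAngle_mem u'
  have hpi := Real.pi_pos
  have h1 := one_sub_cos_sub_le (θ := 2 * Real.pi * arcAngle u) (θ' := 2 * Real.pi * arcAngle u')
    (by have := hX.1; positivity) (by gcongr) (by nlinarith [hX'.2])
  have e1 := one_sub_cos_arcAngle ht
  have e2 := one_sub_cos_arcAngle ht'
  have h2 : Real.cos (2 * Real.pi * arcAngle u') = 1 - u' := by linarith
  have h3 : Real.cos (2 * Real.pi * arcAngle u) = 1 - u := by linarith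
  have h4 := Real.cos_le_one_sub_mul_cos_sq (x := 2 * Real.pi * arcAngle u' - 2 * Real.pi * arcAngle u)
    (by rw [← mul_sub, abs_of_nonneg (by have := sub_nonneg.2 hle; positivity)]
        nlinarith [hX'.2, hX.1])
  set v := arcAngle u' - arcAngle u with hv
  have hv0 : 0 ≤ v := sub_nonneg.2 hle
  have hv1 : v ≤ 1 := by linarith [hX'.2, hX.1]
  have h5 : v ^ 2 ≤ |t - t'| := by
    have e3 : 2 / Real.pi ^ 2 * (2 * Real.pi * arcAngle u' - 2 * Real.pi * arcAngle u) ^ 2 =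
        8 * v ^ 2 := by rw [hv]; field_simp; ring
    rw [e3] at h4
    have : u' - u ≤ |t - t'| := by
      refine le_trans ?_ h0; rw [abs_sub_comm]; exact le_abs_self _
    nlinarith [sq_nonneg v]
  have e4 : |arcAngle u - arcAngle u'| = v := by rw [abs_sub_comm, abs_of_nonneg hv0]
  rw [e4]
  calc v = v ^ (1 : ℝ) := (Real.rpow_one v).symm
    _ ≤ v ^ (3 / 4 : ℝ) := Real.rpow_le_rpow_of_exponent_ge_of_imp hv0 hv1 (by norm_num) (by norm_num)
    _ = (v ^ 2) ^ (3 / 8 : ℝ) := by rw [← Real.rpow_natCast, ← Real.rpow_mul hv0]; norm_num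
    _ ≤ _ := by gcongr

/-- Inside (0, 2) the density is at least 1/(2π), so a higher power controls a lower one. -/
lemma arcDensity_le_rpow (t : ℝ) : arcDensity t ≤ 2 * Real.pi * arcDensity t ^ (7 / 4 : ℝ) := by
  by_cases ht : t ∈ Set.Ioo (0 : ℝ) 2
  · have hP : 0 < t * (2 - t) := mul_pos ht.1 (by linarith [ht.2])
    have h1 : Real.sqrt (t * (2 - t)) ≤ 1 := Real.sqrt_le_one.2 (by nlinarith [sq_nonneg (t - 1)])
    have h0 : 0 < Real.sqrt (t * (2 - t)) := Real.sqrt_pos.2 hP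
    have hg : 1 ≤ 2 * Real.pi * arcDensity t := by
      unfold arcDensity; rw [mul_inv]; field_simp; exact h1
    have hg0 : 0 < arcDensity t := by unfold arcDensity; positivity
    have h2 : (1 : ℝ) ≤ 2 * Real.pi * arcDensity t ^ (3 / 4 : ℝ) := by
      have h3 : 1 ≤ (2 * Real.pi * arcDensity t) ^ (3 / 4 : ℝ) := Real.one_le_rpow hg (by norm_num)
      rw [Real.mul_rpow Real.two_pi_pos.le hg0.le] at h3
      refine h3.trans ?_
      gcongr
      conv_rhs => rw [← Real.rpow_one (2 * Real.pi)]
      exact Real.rpow_le_rpow_of_exponent_le (by linarith [Real.pi_gt_three]) (by norm_num)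
    calc arcDensity t = arcDensity t * 1 := by ring
      _ ≤ arcDensity t * (2 * Real.pi * arcDensity t ^ (3 / 4 : ℝ)) := by gcongr
      _ = 2 * Real.pi * (arcDensity t ^ (1 : ℝ) * arcDensity t ^ (3 / 4 : ℝ)) := by
          rw [Real.rpow_one]; ring
      _ = _ := by rw [← Real.rpow_add hg0]; norm_num
  · rw [arcDensity_of_notMem ht]; simp [Real.zero_rpow]

/-- Near each endpoint the integrand is at most the distance to the power -15/16, and the symmetry t
↦ 2 - t exchanges the endpoints. -/
lemma lintegral_arcDensity_rpow_lt_top :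
    ∫⁻ t, ENNReal.ofReal (arcDensity t ^ (15 / 8 : ℝ)) < ⊤ := by
  have hb : ∀ t : ℝ, ENNReal.ofReal (arcDensity t ^ (15 / 8 : ℝ)) ≤
      (Set.Ioc (0 : ℝ) 1).indicator (fun t => ENNReal.ofReal (t ^ (-(15 / 16) : ℝ))) t +
      (Set.Ioc (0 : ℝ) 1).indicator (fun t => ENNReal.ofReal (t ^ (-(15 / 16) : ℝ))) (2 - t) := by
    intro t
    have key : ∀ t : ℝ, t ∈ Set.Ioc (0 : ℝ) 1 →
        arcDensity t ^ (15 / 8 : ℝ) ≤ t ^ (-(15 / 16) : ℝ) := by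
      intro t ht
      have ht0 := ht.1
      have h1 : arcDensity t ≤ (Real.sqrt t)⁻¹ := by
        unfold arcDensity
        have : t ≤ t * (2 - t) := by nlinarith [ht.2]
        have h2 : Real.sqrt t ≤ Real.sqrt (t * (2 - t)) := Real.sqrt_le_sqrt this
        have h3 : 0 < Real.sqrt t := Real.sqrt_pos.2 ht0
        gcongr
        nlinarith [Real.pi_gt_three]
      calc arcDensity t ^ (15 / 8 : ℝ) ≤ (Real.sqrt t)⁻¹ ^ (15 / 8 : ℝ) := by
            have := arcDensity_nonneg t
            gcongr
        _ = t ^ (-(15 / 16) : ℝ) := by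
            rw [Real.sqrt_eq_rpow, ← Real.rpow_neg ht0.le, ← Real.rpow_mul ht0.le]; norm_num
    by_cases ht : t ∈ Set.Ioo (0 : ℝ) 2
    · rcases le_or_gt t 1 with h | h
      · have hm : t ∈ Set.Ioc (0 : ℝ) 1 := ⟨ht.1, h⟩
        rw [Set.indicator_of_mem hm]
        exact le_add_right (ENNReal.ofReal_le_ofReal (key t hm))
      · have hm : 2 - t ∈ Set.Ioc (0 : ℝ) 1 := ⟨by linarith [ht.2], by linarith⟩
        rw [Set.indicator_of_mem hm]
        have hs : arcDensity t = arcDensity (2 - t) := by unfold arcDensity; ring_nf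
        rw [hs]
        exact le_add_left (ENNReal.ofReal_le_ofReal (key _ hm))
    · rw [arcDensity_of_notMem ht, Real.zero_rpow (by norm_num)]; simp
  refine lt_of_le_of_lt (lintegral_mono hb) ?_
  have hmeas : Measurable ((Set.Ioc (0 : ℝ) 1).indicator
      (fun t : ℝ => ENNReal.ofReal (t ^ (-(15 / 16) : ℝ)))) :=
    Measurable.indicator (by fun_prop) measurableSet_Ioc
  rw [lintegral_add_left hmeas, lintegral_sub_left_eq_self, lintegral_indicator measurableSet_Ioc]
  have hint : IntegrableOn (fun t : ℝ => t ^ (-(15 / 16) : ℝ)) (Set.Ioc 0 1) :=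
    (intervalIntegrable_iff_integrableOn_Ioc_of_le zero_le_one).1
      (intervalIntegral.intervalIntegrable_rpow' (by norm_num))
  have := hint.lintegral_lt_top
  exact ENNReal.add_lt_top.2 ⟨this, this⟩

/-! ### The law of the dispersion relation -/

lemma lintegral_cell_succ {n : ℕ} {Φ : Mom (n + 1) → ENNReal} (hΦ : Measurable Φ) :
    ∫⁻ p in cell (n + 1), Φ p =
      ∫⁻ y in cell n, ∫⁻ x in Set.Ico (-(1 / 2) : ℝ) (1 / 2), Φ (glue x y) := by
  rw [← (measurePreserving_glueEquiv_cell n).lintegral_comp hΦ]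
  exact lintegral_prod_symm' _ (hΦ.comp (glueEquiv n).measurable)

lemma lintegral_circle_cos {φ : ℝ → ENNReal} (hφ : Measurable φ) :
    ∫⁻ x in Set.Ico (-(1 / 2) : ℝ) (1 / 2), φ (1 - Real.cos (2 * Real.pi * x)) =
      2 * ∫⁻ t, ENNReal.ofReal (arcDensity t) * φ t := by
  rw [lintegral_circle (Φ := fun x => φ (1 - Real.cos (2 * Real.pi * x))) (by fun_prop),
    ← lintegral_const_mul _ (by have := measurable_arcDensity; fun_prop)]
  congr 1; ext t
  by_cases ht : t ∈ Set.Ioo (0 : ℝ) 2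
  · rw [mul_neg, Real.cos_neg, one_sub_cos_arcAngle ⟨ht.1.le, ht.2.le⟩]; ring
  · simp [arcDensity_of_notMem ht]

/-- Energies of different coordinates add independently; the factor 2 counts the two half circles.
-/
lemma lintegral_cell_succ_disp {n : ℕ} {φ : ℝ → ENNReal} (hφ : Measurable φ) :
    ∫⁻ p in cell (n + 1), φ (disp p) =
      2 * ∫⁻ t, ENNReal.ofReal (arcDensity t) * ∫⁻ y in cell n, φ (t + disp y) := by
  have hm : Measurable fun z : ℝ × Mom n =>
      ENNReal.ofReal (arcDensity z.1) * φ (z.1 + disp z.2) :=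
    (measurable_arcDensity.comp measurable_fst).ennreal_ofReal.mul
      (hφ.comp (measurable_fst.add (continuous_disp.measurable.comp measurable_snd)))
  rw [lintegral_cell_succ (Φ := fun p => φ (disp p)) (hφ.comp continuous_disp.measurable)]
  simp_rw [disp_glue]
  have : ∀ y : Mom n, ∫⁻ x in Set.Ico (-(1 / 2) : ℝ) (1 / 2),
      φ (1 - Real.cos (2 * Real.pi * x) + disp y) =
      2 * ∫⁻ t, ENNReal.ofReal (arcDensity t) * φ (t + disp y) := fun y =>
    lintegral_circle_cos (φ := fun t => φ (t + disp y)) (by fun_prop)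
  simp_rw [this]
  rw [lintegral_const_mul _ hm.lintegral_prod_left', lintegral_lintegral_swap
    (f := fun y t => ENNReal.ofReal (arcDensity t) * φ (t + disp y))
    (hm.comp measurable_swap).aemeasurable]
  congr 1
  congr 1; ext t
  rw [lintegral_const_mul' _ _ ENNReal.ofReal_ne_top]

/-- Weighted AM-GM with weights 1/15, 7/15, 7/15. Each product on the right omits one of the three
factors, which is what lets the double integral in `lintegral_shift_bound` factor. -/
lemma mul_mul_rpow_le {a b c : ℝ} (ha : 0 ≤ a) (hb : 0 ≤ b) (hc : 0 ≤ c) :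
    a * b * c ^ (7 / 4 : ℝ) ≤ a ^ (15 / 8 : ℝ) * b ^ (15 / 8 : ℝ) +
      a ^ (15 / 8 : ℝ) * c ^ (15 / 8 : ℝ) + b ^ (15 / 8 : ℝ) * c ^ (15 / 8 : ℝ) := by
  have h := Real.geom_mean_le_arith_mean3_weighted (w₁ := 1 / 15) (w₂ := 7 / 15) (w₃ := 7 / 15)
    (p₁ := a ^ (15 / 8 : ℝ) * b ^ (15 / 8 : ℝ)) (p₂ := a ^ (15 / 8 : ℝ) * c ^ (15 / 8 : ℝ))
    (p₃ := b ^ (15 / 8 : ℝ) * c ^ (15 / 8 : ℝ)) (by norm_num) (by norm_num) (by norm_num)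
    (by positivity) (by positivity) (by positivity) (by norm_num)
  have hle : a * b * c ^ (7 / 4 : ℝ) =
      (a ^ (15 / 8 : ℝ) * b ^ (15 / 8 : ℝ)) ^ (1 / 15 : ℝ) *
      (a ^ (15 / 8 : ℝ) * c ^ (15 / 8 : ℝ)) ^ (7 / 15 : ℝ) *
      (b ^ (15 / 8 : ℝ) * c ^ (15 / 8 : ℝ)) ^ (7 / 15 : ℝ) := by
    have e : ∀ x : ℝ, 0 ≤ x →
        x = (x ^ (15 / 8 : ℝ)) ^ (1 / 15 : ℝ) * (x ^ (15 / 8 : ℝ)) ^ (7 / 15 : ℝ) := by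
      intro x hx
      rw [← Real.rpow_mul hx, ← Real.rpow_mul hx,
        ← Real.rpow_add_of_nonneg hx (by norm_num) (by norm_num)]
      norm_num
    have e' : c ^ (7 / 4 : ℝ) =
        (c ^ (15 / 8 : ℝ)) ^ (7 / 15 : ℝ) * (c ^ (15 / 8 : ℝ)) ^ (7 / 15 : ℝ) := by
      rw [← Real.rpow_mul hc, ← Real.rpow_add_of_nonneg hc (by norm_num) (by norm_num)]
      norm_num
    rw [Real.mul_rpow (by positivity) (by positivity), Real.mul_rpow (by positivity) (by positivity),
      Real.mul_rpow (by positivity) (by positivity), e']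
    conv_lhs => rw [e a ha, e b hb]
    ring
  rw [hle]
  have h1 : 0 ≤ a ^ (15 / 8 : ℝ) * b ^ (15 / 8 : ℝ) := by positivity
  have h2 : 0 ≤ a ^ (15 / 8 : ℝ) * c ^ (15 / 8 : ℝ) := by positivity
  have h3 : 0 ≤ b ^ (15 / 8 : ℝ) * c ^ (15 / 8 : ℝ) := by positivity
  linarith

/-- After `mul_mul_rpow_le` each of the three terms involves two of the arguments t, t', a - t - t'.
These are independent variables up to translation and reflection, so each term integrates to the
square of the one-dimensional integral, whatever a is. -/
lemma lintegral_shift_bound (a : ℝ) :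
    ∫⁻ t, ENNReal.ofReal (arcDensity t) * ∫⁻ t', ENNReal.ofReal (arcDensity t') *
      ENNReal.ofReal (arcDensity (a - (t + t')) ^ (7 / 4 : ℝ)) ≤
    3 * (∫⁻ t, ENNReal.ofReal (arcDensity t ^ (15 / 8 : ℝ))) ^ 2 := by
  set k : ℝ → ENNReal := fun t => ENNReal.ofReal (arcDensity t ^ (15 / 8 : ℝ)) with hk
  have hkm : Measurable k := (measurable_arcDensity.pow_const _).ennreal_ofReal
  set J := ∫⁻ t, k t with hJ
  have hpt : ∀ t t', ENNReal.ofReal (arcDensity t) * (ENNReal.ofReal (arcDensity t') *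
      ENNReal.ofReal (arcDensity (a - (t + t')) ^ (7 / 4 : ℝ))) ≤
      k t * k t' + k t * k (a - t - t') + k t' * k (a - t' - t) := by
    intro t t'
    have e1 : a - t' - t = a - (t + t') := by ring
    have e2 : a - t - t' = a - (t + t') := by ring
    simp only [hk, e1, e2]
    have g1 := arcDensity_nonneg t
    have g2 := arcDensity_nonneg t'
    have g3 := arcDensity_nonneg (a - (t + t'))
    rw [← ENNReal.ofReal_mul (by positivity), ← ENNReal.ofReal_mul (by positivity),
      ← ENNReal.ofReal_mul (by positivity), ← ENNReal.ofReal_mul (by positivity),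
      ← ENNReal.ofReal_mul (by positivity), ← ENNReal.ofReal_add (by positivity) (by positivity),
      ← ENNReal.ofReal_add (by positivity) (by positivity)]
    refine ENNReal.ofReal_le_ofReal ?_
    rw [← mul_assoc]
    exact mul_mul_rpow_le g1 g2 g3
  have i1 : ∀ c, ∫⁻ t', k (c - t') = J := fun c => lintegral_sub_left_eq_self k c
  calc _ = ∫⁻ t, ∫⁻ t', ENNReal.ofReal (arcDensity t) * (ENNReal.ofReal (arcDensity t') *
          ENNReal.ofReal (arcDensity (a - (t + t')) ^ (7 / 4 : ℝ))) := by
        congr 1; ext t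
        rw [lintegral_const_mul]
        exact measurable_arcDensity.ennreal_ofReal.mul
          ((measurable_arcDensity.comp (by fun_prop)).pow_const _).ennreal_ofReal
    _ ≤ ∫⁻ t, ∫⁻ t', (k t * k t' + k t * k (a - t - t') + k t' * k (a - t' - t)) :=
        lintegral_mono fun t => lintegral_mono fun t' => hpt t t'
    _ = ∫⁻ t, (k t * J + k t * J + ∫⁻ t', k t' * k (a - t' - t)) := by
        congr 1; ext t
        rw [lintegral_add_left (by fun_prop), lintegral_add_left (by fun_prop),
          lintegral_const_mul _ hkm, lintegral_const_mul _ (by fun_prop), i1]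
    _ = J * J + J * J + ∫⁻ t, ∫⁻ t', k t' * k (a - t' - t) := by
        rw [lintegral_add_left (by fun_prop), lintegral_add_left (by fun_prop),
          lintegral_mul_const _ hkm]
    _ = J * J + J * J + J * J := by
        congr 1
        rw [lintegral_lintegral_swap (by fun_prop)]
        have : ∀ t', ∫⁻ t, k t' * k (a - t' - t) = k t' * J := by
          intro t'; rw [lintegral_const_mul _ (by fun_prop), i1]
        simp_rw [this]
        rw [lintegral_mul_const _ hkm]
    _ = 3 * J ^ 2 := by ring

/-- Two averaged coordinates already give the bound. Any further coordinate only shifts a and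
averages over a circle of length one, so the constant 12 = 2 · 2 · 3 does not grow with n. -/
lemma lintegral_arcDensity_disp_le {n : ℕ} (hn : 2 ≤ n) (a : ℝ) :
    ∫⁻ y in cell n, ENNReal.ofReal (arcDensity (a - disp y) ^ (7 / 4 : ℝ)) ≤
      12 * (∫⁻ t, ENNReal.ofReal (arcDensity t ^ (15 / 8 : ℝ))) ^ 2 := by
  have hm : ∀ a, Measurable fun t => ENNReal.ofReal (arcDensity (a - t) ^ (7 / 4 : ℝ)) := fun a =>
    ((measurable_arcDensity.comp (by fun_prop)).pow_const _).ennreal_ofReal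
  induction n, hn using Nat.le_induction generalizing a with
  | base =>
    rw [lintegral_cell_succ_disp (hm a)]
    have : ∀ t, ∫⁻ y in cell 1, ENNReal.ofReal (arcDensity (a - (t + disp y)) ^ (7 / 4 : ℝ)) =
        2 * ∫⁻ t', ENNReal.ofReal (arcDensity t') *
          ENNReal.ofReal (arcDensity (a - (t + t')) ^ (7 / 4 : ℝ)) := by
      intro t
      rw [lintegral_cell_succ_disp
        (φ := fun u => ENNReal.ofReal (arcDensity (a - (t + u)) ^ (7 / 4 : ℝ)))
        (((measurable_arcDensity.comp (by fun_prop)).pow_const _).ennreal_ofReal)]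
      congr 2; ext t'
      simp [disp, volume_cell]
    simp_rw [this]
    have h2 : ∀ t, ENNReal.ofReal (arcDensity t) * (2 * ∫⁻ t', ENNReal.ofReal (arcDensity t') *
          ENNReal.ofReal (arcDensity (a - (t + t')) ^ (7 / 4 : ℝ))) =
        2 * (ENNReal.ofReal (arcDensity t) * ∫⁻ t', ENNReal.ofReal (arcDensity t') *
          ENNReal.ofReal (arcDensity (a - (t + t')) ^ (7 / 4 : ℝ))) := fun t => by ring
    simp_rw [h2]
    rw [lintegral_const_mul' _ _ (by simp)]
    calc _ ≤ 2 * (2 * (3 * (∫⁻ t, ENNReal.ofReal (arcDensity t ^ (15 / 8 : ℝ))) ^ 2)) := by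
          gcongr; exact lintegral_shift_bound a
      _ = _ := by ring
  | succ n hn ih =>
    rw [lintegral_cell_succ
        (Φ := fun p => ENNReal.ofReal (arcDensity (a - disp p) ^ (7 / 4 : ℝ)))
        ((hm a).comp continuous_disp.measurable),
      lintegral_lintegral_swap (f := fun y x =>
        ENNReal.ofReal (arcDensity (a - disp (glue x y)) ^ (7 / 4 : ℝ)))
        (((hm a).comp (continuous_disp.measurable.comp
          (continuous_glue.measurable.comp measurable_swap))).aemeasurable)]
    calc _ ≤ ∫⁻ _x in Set.Ico (-(1 / 2) : ℝ) (1 / 2),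
          12 * (∫⁻ t, ENNReal.ofReal (arcDensity t ^ (15 / 8 : ℝ))) ^ 2 := by
          refine lintegral_mono fun x => ?_
          refine le_trans (le_of_eq ?_) (ih (a - (1 - Real.cos (2 * Real.pi * x))))
          simp_rw [disp_glue]
          congr 1; ext y; congr 3; ring
      _ = _ := by rw [lintegral_const, Measure.restrict_apply_univ, Real.volume_Ico]; norm_num

/-! ### Disintegration along the dispersion relation -/

/-- The closed fundamental cell. -/
def box (d : ℕ) : Set (Mom d) := {p | ∀ i, p i ∈ Set.Icc (-(1 / 2) : ℝ) (1 / 2)}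

/-- The point of energy `a` on the upper branch above `y`. -/
def upper {n : ℕ} (a : ℝ) (y : Mom n) : Mom (n + 1) := glue (arcAngle (a - disp y)) y

/-- The point of energy `a` on the lower branch above `y`. -/
def lower {n : ℕ} (a : ℝ) (y : Mom n) : Mom (n + 1) := glue (-arcAngle (a - disp y)) y

/-- The energy shell integral, written as an integral over the last coordinates. -/
def shellInt {n : ℕ} (h : Mom (n + 1) → ℂ) (a : ℝ) : ℂ :=
  ∫ y in cell n, (arcDensity (a - disp y) : ℂ) * (h (upper a y) + h (lower a y))

lemma continuous_upper {n : ℕ} : Continuous (fun z : ℝ × Mom n => upper z.1 z.2) :=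
  continuous_glue.comp (Continuous.prodMk (continuous_arcAngle.comp
    (continuous_fst.sub (continuous_disp.comp continuous_snd))) continuous_snd)

lemma continuous_lower {n : ℕ} : Continuous (fun z : ℝ × Mom n => lower z.1 z.2) :=
  continuous_glue.comp (Continuous.prodMk (continuous_arcAngle.comp
    (continuous_fst.sub (continuous_disp.comp continuous_snd))).neg continuous_snd)

lemma measurable_upper {n : ℕ} (a : ℝ) : Measurable (fun y : Mom n => upper a y) :=
  (continuous_upper.comp (Continuous.prodMk_right a)).measurable

lemma measurable_lower {n : ℕ} (a : ℝ) : Measurable (fun y : Mom n => lower a y) :=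
  (continuous_lower.comp (Continuous.prodMk_right a)).measurable

lemma measurable_arcDensity_disp {n : ℕ} (a : ℝ) :
    Measurable (fun y : Mom n => arcDensity (a - disp y)) :=
  measurable_arcDensity.comp (measurable_const.sub continuous_disp.measurable)

lemma glue_mem_box {n : ℕ} {x : ℝ} {y : Mom n} (hx : x ∈ Set.Icc (-(1 / 2) : ℝ) (1 / 2))
    (hy : y ∈ cell n) : glue x y ∈ box (n + 1) := by
  intro i
  refine Fin.cases ?_ (fun j => ?_) i
  · exact hx
  · exact ⟨(hy j).1, (hy j).2.le⟩

lemma upper_mem_box {n : ℕ} (a : ℝ) {y : Mom n} (hy : y ∈ cell n) : upper a y ∈ box (n + 1) :=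
  glue_mem_box ⟨by linarith [(arcAngle_mem (a - disp y)).1], (arcAngle_mem (a - disp y)).2⟩ hy

lemma lower_mem_box {n : ℕ} (a : ℝ) {y : Mom n} (hy : y ∈ cell n) : lower a y ∈ box (n + 1) :=
  glue_mem_box ⟨by linarith [(arcAngle_mem (a - disp y)).2],
    by linarith [(arcAngle_mem (a - disp y)).1]⟩ hy

lemma norm_upper_sub_upper {n : ℕ} (a b : ℝ) (y : Mom n) :
    ‖upper a y - upper b y‖ ≤ |a - b| ^ (3 / 8 : ℝ) := by
  rw [upper, upper, norm_glue_sub_glue]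
  simpa using arcAngle_holder (a - disp y) (b - disp y)

lemma norm_lower_sub_lower {n : ℕ} (a b : ℝ) (y : Mom n) :
    ‖lower a y - lower b y‖ ≤ |a - b| ^ (3 / 8 : ℝ) := by
  rw [lower, lower, norm_glue_sub_glue, neg_sub_neg, abs_sub_comm]
  simpa using arcAngle_holder (a - disp y) (b - disp y)

lemma integrable_arcDensity_rpow {n : ℕ} (hn : 2 ≤ n) : ∃ K : ℝ, 0 ≤ K ∧ ∀ a : ℝ,
    IntegrableOn (fun y : Mom n => arcDensity (a - disp y) ^ (7 / 4 : ℝ)) (cell n) ∧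
    ∫ y in cell n, arcDensity (a - disp y) ^ (7 / 4 : ℝ) ≤ K := by
  set J := 12 * (∫⁻ t, ENNReal.ofReal (arcDensity t ^ (15 / 8 : ℝ))) ^ 2 with hJ
  have hJt : J ≠ ⊤ := ENNReal.mul_ne_top (by simp)
    (ENNReal.pow_ne_top lintegral_arcDensity_rpow_lt_top.ne)
  refine ⟨J.toReal, ENNReal.toReal_nonneg, fun a => ?_⟩
  have hb := lintegral_arcDensity_disp_le hn a
  have hm : Measurable fun y : Mom n => arcDensity (a - disp y) ^ (7 / 4 : ℝ) :=
    (measurable_arcDensity.comp (measurable_const.sub continuous_disp.measurable)).pow_const _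
  have h0 : ∀ y : Mom n, 0 ≤ arcDensity (a - disp y) ^ (7 / 4 : ℝ) := fun y =>
    Real.rpow_nonneg (arcDensity_nonneg _) _
  refine ⟨⟨hm.aestronglyMeasurable, ?_⟩, ?_⟩
  · rw [hasFiniteIntegral_iff_ofReal (Eventually.of_forall h0)]
    exact lt_of_le_of_lt hb hJt.lt_top
  · rw [integral_eq_lintegral_of_nonneg_ae (Eventually.of_forall h0) hm.aestronglyMeasurable]
    exact ENNReal.toReal_mono hJt hb

lemma integrable_arcDensity {n : ℕ} (hn : 2 ≤ n) : ∃ K : ℝ, 0 ≤ K ∧ ∀ a : ℝ,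
    IntegrableOn (fun y : Mom n => arcDensity (a - disp y)) (cell n) ∧
    ∫ y in cell n, arcDensity (a - disp y) ≤ K := by
  obtain ⟨K, hK, h⟩ := integrable_arcDensity_rpow hn
  refine ⟨2 * Real.pi * K, by positivity, fun a => ?_⟩
  have hi : IntegrableOn (fun y : Mom n => arcDensity (a - disp y)) (cell n) :=
    ((h a).1.const_mul (2 * Real.pi)).mono'
      (measurable_arcDensity_disp a).aestronglyMeasurable
      (Eventually.of_forall fun y => by
        rw [Real.norm_of_nonneg (arcDensity_nonneg _)]; exact arcDensity_le_rpow _)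
  refine ⟨hi, ?_⟩
  calc _ ≤ ∫ y in cell n, 2 * Real.pi * arcDensity (a - disp y) ^ (7 / 4 : ℝ) :=
        integral_mono hi ((h a).1.const_mul _) fun y => arcDensity_le_rpow _
    _ ≤ _ := by rw [integral_const_mul]; gcongr; exact (h a).2

lemma integrable_shellInt {n : ℕ} (hn : 2 ≤ n) {h : Mom (n + 1) → ℂ} (hm : Measurable h) {N : ℝ}
    (hN : ∀ p ∈ box (n + 1), ‖h p‖ ≤ N) (a : ℝ) :
    IntegrableOn (fun y : Mom n => (arcDensity (a - disp y) : ℂ) * (h (upper a y) + h (lower a y)))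
      (cell n) := by
  obtain ⟨K, hK, hi⟩ := integrable_arcDensity hn
  refine ((hi a).1.mul_const (2 * N)).mono' ?_ ?_
  · exact ((Complex.measurable_ofReal.comp (measurable_arcDensity_disp a)).mul
      ((hm.comp (measurable_upper a)).add (hm.comp (measurable_lower a)))).aestronglyMeasurable
  · refine (ae_restrict_mem (measurableSet_cell n)).mono fun y hy => ?_
    rw [norm_mul, Complex.norm_real, Real.norm_of_nonneg (arcDensity_nonneg _)]
    refine mul_le_mul_of_nonneg_left ((norm_add_le _ _).trans ?_) (arcDensity_nonneg _)
    linarith [hN _ (upper_mem_box a hy), hN _ (lower_mem_box a hy)]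

/-- Energy shell integrals of Lipschitz functions are Hölder continuous in the energy. -/
lemma shellInt_holder {n : ℕ} (hn : 2 ≤ n) : ∃ C : ℝ, 0 ≤ C ∧
    ∀ (h : Mom (n + 1) → ℂ) (N : ℝ), Measurable h → (∀ p ∈ box (n + 1), ‖h p‖ ≤ N) →
      (∀ p ∈ box (n + 1), ∀ q ∈ box (n + 1), ‖h p - h q‖ ≤ N * ‖p - q‖) →
      ∀ a b : ℝ, ‖shellInt h a - shellInt h b‖ ≤ C * (N * |a - b| ^ (3 / 8 : ℝ)) := by
  obtain ⟨K, hK, hi⟩ := integrable_arcDensity_rpow hn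
  obtain ⟨C, hC, hg⟩ := arcDensity_holder
  refine ⟨4 * C * K + 4 * Real.pi * K, by positivity, ?_⟩
  intro h N hm hN hL a b
  have hN0 : 0 ≤ N := by
    have : (0 : Mom (n + 1)) ∈ box (n + 1) := fun i => by simp
    exact (norm_nonneg _).trans (hN 0 this)
  set δ := |a - b| ^ (3 / 8 : ℝ) with hδ
  have hδ0 : 0 ≤ δ := by positivity
  rw [shellInt, shellInt, ← integral_sub (integrable_shellInt hn hm hN a)
    (integrable_shellInt hn hm hN b)]
  set k : ℝ → Mom n → ℝ := fun a y => arcDensity (a - disp y) ^ (7 / 4 : ℝ) with hk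
  have hpt : ∀ y ∈ cell n,
      ‖(arcDensity (a - disp y) : ℂ) * (h (upper a y) + h (lower a y)) -
        (arcDensity (b - disp y) : ℂ) * (h (upper b y) + h (lower b y))‖ ≤
      N * δ * (2 * C * (k a y + k b y) + 4 * Real.pi * k b y) := by
    intro y hy
    have key : ∀ u v : Mom (n + 1), u ∈ box (n + 1) → v ∈ box (n + 1) → ‖u - v‖ ≤ δ →
        ‖(arcDensity (a - disp y) : ℂ) * h u - (arcDensity (b - disp y) : ℂ) * h v‖ ≤
        N * δ * (C * (k a y + k b y) + 2 * Real.pi * k b y) := by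
      intro u v hu hv huv
      -- The density and the point both move with the energy. The first variation is paid by the
      -- size of h, the second by its Lipschitz constant.
      have e : (arcDensity (a - disp y) : ℂ) * h u - (arcDensity (b - disp y) : ℂ) * h v =
          ((arcDensity (a - disp y) - arcDensity (b - disp y) : ℝ) : ℂ) * h u +
          (arcDensity (b - disp y) : ℂ) * (h u - h v) := by push_cast; ring
      have h1 := hg (a - disp y) (b - disp y)
      rw [sub_sub_sub_cancel_right] at h1
      have h2 := arcDensity_le_rpow (b - disp y)
      have h3 : ‖h u - h v‖ ≤ N * δ := (hL u hu v hv).trans (by gcongr)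
      rw [e]
      refine (norm_add_le _ _).trans ?_
      rw [norm_mul, norm_mul, Complex.norm_real, Complex.norm_real, Real.norm_eq_abs,
        Real.norm_of_nonneg (arcDensity_nonneg _)]
      calc _ ≤ C * δ * (k a y + k b y) * N + 2 * Real.pi * k b y * (N * δ) :=
            add_le_add (mul_le_mul h1 (hN u hu) (norm_nonneg _) (le_trans (abs_nonneg _) h1))
              (mul_le_mul h2 h3 (norm_nonneg _) (le_trans (arcDensity_nonneg _) h2))
        _ = _ := by ring
    have e : (arcDensity (a - disp y) : ℂ) * (h (upper a y) + h (lower a y)) -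
        (arcDensity (b - disp y) : ℂ) * (h (upper b y) + h (lower b y)) =
        ((arcDensity (a - disp y) : ℂ) * h (upper a y) -
          (arcDensity (b - disp y) : ℂ) * h (upper b y)) +
        ((arcDensity (a - disp y) : ℂ) * h (lower a y) -
          (arcDensity (b - disp y) : ℂ) * h (lower b y)) := by ring
    rw [e]
    refine (norm_add_le _ _).trans ?_
    have h1 := key _ _ (upper_mem_box a hy) (upper_mem_box b hy) (norm_upper_sub_upper a b y)
    have h2 := key _ _ (lower_mem_box a hy) (lower_mem_box b hy) (norm_lower_sub_lower a b y)
    calc _ ≤ _ := add_le_add h1 h2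
      _ = _ := by ring
  have hint : IntegrableOn (fun y => N * δ * (2 * C * (k a y + k b y) + 4 * Real.pi * k b y))
      (cell n) :=
    ((((hi a).1.add (hi b).1).const_mul _).add ((hi b).1.const_mul _)).const_mul _
  refine (norm_integral_le_of_norm_le hint ((ae_restrict_mem (measurableSet_cell n)).mono hpt)).trans ?_
  have hka : IntegrableOn (k a) (cell n) := (hi a).1
  have hkb : IntegrableOn (k b) (cell n) := (hi b).1
  have e1 : ∫ y in cell n, (2 * C * (k a y + k b y) + 4 * Real.pi * k b y) =
      2 * C * (∫ y in cell n, k a y) + (2 * C + 4 * Real.pi) * ∫ y in cell n, k b y := by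
    rw [← integral_const_mul, ← integral_const_mul,
      ← integral_add (hka.const_mul _) (hkb.const_mul _)]
    congr 1; ext y; ring
  rw [integral_const_mul, e1]
  have h1 := (hi a).2
  have h2 := (hi b).2
  calc _ ≤ N * δ * (2 * C * K + (2 * C + 4 * Real.pi) * K) := by gcongr
    _ = _ := by ring

/-- The joint law of energy and last coordinates, per branch. -/
def branchMeasure (n : ℕ) : Measure (ℝ × Mom n) :=
  ((volume : Measure ℝ).prod (volume.restrict (cell n))).withDensity
    fun z => ENNReal.ofReal (arcDensity (z.1 - disp z.2))

lemma measurable_arcDensity_sub_disp {n : ℕ} :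
    Measurable fun z : ℝ × Mom n => arcDensity (z.1 - disp z.2) :=
  measurable_arcDensity.comp (measurable_fst.sub (continuous_disp.measurable.comp measurable_snd))

lemma disp_upper {n : ℕ} {a : ℝ} {y : Mom n} (h : a - disp y ∈ Set.Ioo (0 : ℝ) 2) :
    disp (upper a y) = a := by
  rw [upper, disp_glue, one_sub_cos_arcAngle ⟨h.1.le, h.2.le⟩]; ring

lemma disp_lower {n : ℕ} {a : ℝ} {y : Mom n} (h : a - disp y ∈ Set.Ioo (0 : ℝ) 2) :
    disp (lower a y) = a := by
  rw [lower, disp_glue, mul_neg, Real.cos_neg, one_sub_cos_arcAngle ⟨h.1.le, h.2.le⟩]; ring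

/-- On each half circle t = 1 - cos(2πx) is a coordinate with density `arcDensity`. Where t leaves
(0, 2) the branches no longer have energy a, but there the density vanishes. -/
lemma map_cell_eq (n : ℕ) :
    (volume.restrict (cell (n + 1))).map (fun p => (p, disp p)) =
      (branchMeasure n).map (fun z => (upper z.1 z.2, z.1)) +
        (branchMeasure n).map (fun z => (lower z.1 z.2, z.1)) := by
  have mu : Measurable (fun z : ℝ × Mom n => (upper z.1 z.2, z.1)) :=
    continuous_upper.measurable.prodMk measurable_fst
  have ml : Measurable (fun z : ℝ × Mom n => (lower z.1 z.2, z.1)) :=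
    continuous_lower.measurable.prodMk measurable_fst
  have mp : Measurable (fun p : Mom (n + 1) => (p, disp p)) :=
    measurable_id.prodMk continuous_disp.measurable
  have mg := (measurable_arcDensity_sub_disp (n := n)).ennreal_ofReal
  refine Measure.ext_of_lintegral _ fun Φ hΦ => ?_
  have hu : Measurable (fun z : ℝ × Mom n => Φ (upper z.1 z.2, z.1)) := hΦ.comp mu
  have hl : Measurable (fun z : ℝ × Mom n => Φ (lower z.1 z.2, z.1)) := hΦ.comp ml
  rw [lintegral_add_measure, lintegral_map hΦ mp, lintegral_map hΦ mu, lintegral_map hΦ ml,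
    branchMeasure, lintegral_withDensity_eq_lintegral_mul _ mg hu,
    lintegral_withDensity_eq_lintegral_mul _ mg hl,
    ← lintegral_add_left (mg.mul hu),
    lintegral_cell_succ (Φ := fun p => Φ (p, disp p)) (hΦ.comp mp)]
  refine Eq.trans ?_ (lintegral_prod_symm' _ ((mg.mul hu).add (mg.mul hl))).symm
  congr 1; ext y
  have mgl : Measurable fun x : ℝ => glue x y :=
    continuous_glue.measurable.comp measurable_prodMk_right
  rw [lintegral_circle (Φ := fun x => Φ (glue x y, disp (glue x y))) ((hΦ.comp mp).comp mgl)]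
  -- The substitution t = a - e(y) makes the total energy a the variable of integration.
  rw [← lintegral_sub_right_eq_self _ (disp y)]
  congr 1; ext a
  simp only [Pi.add_apply, Pi.mul_apply, ← mul_add]
  by_cases ht : a - disp y ∈ Set.Ioo (0 : ℝ) 2
  · have h1 := disp_upper ht
    have h2 := disp_lower ht
    rw [upper] at h1
    rw [lower] at h2
    rw [h1, h2]; rfl
  · simp [arcDensity_of_notMem ht]

lemma integral_ofReal_smul_branch {n : ℕ} (ψ : ℝ × Mom n → ℂ) :
    ∫ z, ψ z ∂(branchMeasure n) =
      ∫ z, (arcDensity (z.1 - disp z.2) : ℂ) * ψ z ∂(volume.prod (volume.restrict (cell n))) := by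
  rw [branchMeasure, integral_withDensity_eq_integral_toReal_smul
    measurable_arcDensity_sub_disp.ennreal_ofReal (by simp)]
  congr 1; ext z
  rw [ENNReal.toReal_ofReal (arcDensity_nonneg _), Complex.real_smul]

lemma integrable_branch_iff {n : ℕ} (ψ : ℝ × Mom n → ℂ) :
    Integrable ψ (branchMeasure n) ↔ Integrable (fun z => (arcDensity (z.1 - disp z.2) : ℂ) * ψ z)
      (volume.prod (volume.restrict (cell n))) := by
  rw [branchMeasure, integrable_withDensity_iff_integrable_smul'
    measurable_arcDensity_sub_disp.ennreal_ofReal (by simp)]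
  refine integrable_congr (Eventually.of_forall fun z => ?_)
  simp only
  rw [ENNReal.toReal_ofReal (arcDensity_nonneg _), Complex.real_smul]

/-- The energy marginal has density ∫ g(a - e(y)) dy, which is bounded in a. -/
lemma lintegral_branch_le {n : ℕ} (hn : 2 ≤ n) : ∃ K : ℝ, 0 ≤ K ∧ ∀ N : ℝ → ENNReal, Measurable N →
    ∫⁻ z, N z.1 ∂(branchMeasure n) ≤ ENNReal.ofReal K * ∫⁻ a, N a := by
  obtain ⟨K, hK, hi⟩ := integrable_arcDensity hn
  refine ⟨K, hK, fun N hN => ?_⟩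
  have mg := (measurable_arcDensity_sub_disp (n := n)).ennreal_ofReal
  have hN1 : Measurable (fun z : ℝ × Mom n => N z.1) := hN.comp measurable_fst
  rw [branchMeasure, lintegral_withDensity_eq_lintegral_mul _ mg hN1,
    lintegral_prod _ (mg.mul hN1).aemeasurable, ← lintegral_const_mul _ hN]
  refine lintegral_mono fun a => ?_
  simp only [Pi.mul_apply]
  rw [lintegral_mul_const _ (measurable_arcDensity_disp a).ennreal_ofReal]
  gcongr
  rw [← ofReal_integral_eq_lintegral_ofReal (hi a).1
    (Eventually.of_forall fun y => arcDensity_nonneg _)]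
  exact ENNReal.ofReal_le_ofReal (hi a).2

/-- The density of states is bounded. -/
lemma lintegral_cell_disp_le {n : ℕ} (hn : 2 ≤ n) : ∃ K : ℝ, 0 ≤ K ∧
    ∀ N : ℝ → ENNReal, Measurable N →
    ∫⁻ p in cell (n + 1), N (disp p) ≤ ENNReal.ofReal K * ∫⁻ a, N a := by
  obtain ⟨K, hK, hb⟩ := lintegral_branch_le hn
  refine ⟨2 * K, by positivity, fun N hN => ?_⟩
  have mu : Measurable (fun z : ℝ × Mom n => (upper z.1 z.2, z.1)) :=
    continuous_upper.measurable.prodMk measurable_fst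
  have ml : Measurable (fun z : ℝ × Mom n => (lower z.1 z.2, z.1)) :=
    continuous_lower.measurable.prodMk measurable_fst
  have mp : Measurable (fun p : Mom (n + 1) => (p, disp p)) :=
    measurable_id.prodMk continuous_disp.measurable
  have h := lintegral_map (μ := volume.restrict (cell (n + 1))) (hN.comp measurable_snd) mp
  rw [map_cell_eq, lintegral_add_measure, lintegral_map (hN.comp measurable_snd) mu,
    lintegral_map (hN.comp measurable_snd) ml] at h
  simp only [Function.comp_def] at h
  rw [← h, ENNReal.ofReal_mul (by norm_num), ENNReal.ofReal_ofNat, mul_assoc, two_mul]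
  exact add_le_add (hb N hN) (hb N hN)

lemma ae_branch_mem (n : ℕ) : ∀ᵐ z ∂(branchMeasure n), z.2 ∈ cell n := by
  refine (withDensity_absolutelyContinuous _ _) ?_
  have : (volume : Measure ℝ).prod (volume.restrict (cell n)) =
      ((volume : Measure ℝ).prod volume).restrict (Set.univ ×ˢ cell n) := by
    rw [← Measure.prod_restrict, Measure.restrict_univ]
  rw [this]
  exact (ae_restrict_mem (MeasurableSet.univ.prod (measurableSet_cell n))).mono fun z hz => hz.2

lemma integrable_branch {n : ℕ} (hn : 2 ≤ n) {ψ : ℝ × Mom n → ℂ} (hψ : Measurable ψ) {N : ℝ → ℝ}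
    (hN : Integrable N) (hb : ∀ a, ∀ y ∈ cell n, ‖ψ (a, y)‖ ≤ N a) :
    Integrable ψ (branchMeasure n) := by
  refine ⟨hψ.aestronglyMeasurable, ?_⟩
  obtain ⟨K, hK, hle⟩ := lintegral_branch_le hn
  -- N is only almost everywhere measurable; a measurable version is needed for
  -- `lintegral_branch_le`.
  obtain ⟨M, hM, hMi, hMeq⟩ : ∃ M : ℝ → ENNReal, Measurable M ∧ ∫⁻ a, M a < ⊤ ∧
      ∀ᵐ a, ENNReal.ofReal (N a) ≤ M a := by
    have h1 : AEMeasurable (fun a => ENNReal.ofReal (N a)) := hN.1.aemeasurable.ennreal_ofReal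
    refine ⟨h1.mk _, h1.measurable_mk, ?_, h1.ae_eq_mk.mono fun a ha => ha.le⟩
    rw [← lintegral_congr_ae h1.ae_eq_mk]
    exact hN.lintegral_lt_top
  have hMeq' : ∀ᵐ z ∂(branchMeasure n), ENNReal.ofReal (N z.1) ≤ M z.1 :=
    (withDensity_absolutelyContinuous _ _) (Measure.quasiMeasurePreserving_fst.ae hMeq)
  refine lt_of_le_of_lt (b := ∫⁻ z, M z.1 ∂(branchMeasure n)) ?_ ?_
  · refine lintegral_mono_ae ?_
    filter_upwards [ae_branch_mem n, hMeq'] with z hz hz'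
    refine le_trans ?_ hz'
    rw [← ofReal_norm]
    exact ENNReal.ofReal_le_ofReal (hb z.1 z.2 hz)
  · exact lt_of_le_of_lt (hle M hM) (ENNReal.mul_lt_top ENNReal.ofReal_lt_top hMi)

/-- Replacing the energy variable in a function on phase space by a fixed energy, after integration:
the error is controlled by the Hölder continuity of energy shell integrals. -/
lemma integral_disp_sub_shellInt_le {n : ℕ} (hn : 2 ≤ n) : ∃ C : ℝ, 0 ≤ C ∧
    ∀ (F : Mom (n + 1) → ℝ → ℂ) (N : ℝ → ℝ) (γ : ℝ), Measurable (Function.uncurry F) →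
      Integrable N → Integrable (fun a => N a * |a - γ| ^ (3 / 8 : ℝ)) →
      (∀ a, ∀ p ∈ box (n + 1), ‖F p a‖ ≤ N a) →
      (∀ a, ∀ p ∈ box (n + 1), ∀ q ∈ box (n + 1), ‖F p a - F q a‖ ≤ N a * ‖p - q‖) →
      ‖(∫ p in cell (n + 1), F p (disp p)) - shellInt (fun p => ∫ a, F p a) γ‖ ≤
        C * ∫ a, N a * |a - γ| ^ (3 / 8 : ℝ) := by
  obtain ⟨C, hC, hH⟩ := shellInt_holder hn
  refine ⟨C, hC, fun F N γ hF hN hNγ hb hL => ?_⟩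
  have mu : Measurable (fun z : ℝ × Mom n => (upper z.1 z.2, z.1)) :=
    continuous_upper.measurable.prodMk measurable_fst
  have ml : Measurable (fun z : ℝ × Mom n => (lower z.1 z.2, z.1)) :=
    continuous_lower.measurable.prodMk measurable_fst
  have mp : Measurable (fun p : Mom (n + 1) => (p, disp p)) :=
    measurable_id.prodMk continuous_disp.measurable
  have hFu : Measurable fun z : ℝ × Mom n => F (upper z.1 z.2) z.1 := hF.comp mu
  have hFl : Measurable fun z : ℝ × Mom n => F (lower z.1 z.2) z.1 := hF.comp ml
  have iu := integrable_branch hn hFu hN fun a y hy => hb a _ (upper_mem_box a hy)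
  have il := integrable_branch hn hFl hN fun a y hy => hb a _ (lower_mem_box a hy)
  have hFs : StronglyMeasurable (Function.uncurry F) := hF.stronglyMeasurable
  have iu' : Integrable (Function.uncurry F)
      ((branchMeasure n).map (fun z => (upper z.1 z.2, z.1))) :=
    (integrable_map_measure hFs.aestronglyMeasurable mu.aemeasurable).2 iu
  have il' : Integrable (Function.uncurry F)
      ((branchMeasure n).map (fun z => (lower z.1 z.2, z.1))) :=
    (integrable_map_measure hFs.aestronglyMeasurable ml.aemeasurable).2 il
  have iu2 := (integrable_branch_iff _).1 iu
  have il2 := (integrable_branch_iff _).1 il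
  have isum : Integrable (fun z : ℝ × Mom n => (arcDensity (z.1 - disp z.2) : ℂ) *
      (F (upper z.1 z.2) z.1 + F (lower z.1 z.2) z.1)) (volume.prod (volume.restrict (cell n))) :=
    (iu2.add il2).congr (Eventually.of_forall fun z => by simp only [Pi.add_apply]; ring)
  -- Disintegration: both the shell and the second argument of F still carry the same energy a.
  have step1 : ∫ p in cell (n + 1), F p (disp p) = ∫ a, shellInt (fun p => F p a) a := by
    have h1 := integral_map (μ := volume.restrict (cell (n + 1))) mp.aemeasurable
      (f := Function.uncurry F) hFs.aestronglyMeasurable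
    rw [map_cell_eq, integral_add_measure iu' il',
      integral_map mu.aemeasurable hFs.aestronglyMeasurable,
      integral_map ml.aemeasurable hFs.aestronglyMeasurable] at h1
    simp only [Function.uncurry] at h1
    rw [← h1, integral_ofReal_smul_branch, integral_ofReal_smul_branch, ← integral_add iu2 il2]
    simp only [← mul_add]
    exact integral_prod _ isum
  have i1 : Integrable fun a => shellInt (fun p => F p a) a := isum.integral_prod_left
  have iγ : Integrable (fun z : ℝ × Mom n => (arcDensity (γ - disp z.2) : ℂ) *
      (F (upper γ z.2) z.1 + F (lower γ z.2) z.1)) (volume.prod (volume.restrict (cell n))) := by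
    obtain ⟨K, hK, hi⟩ := integrable_arcDensity hn
    have hdom : Integrable (fun z : ℝ × Mom n => N z.1 * (2 * arcDensity (γ - disp z.2)))
        (volume.prod (volume.restrict (cell n))) := hN.mul_prod ((hi γ).1.const_mul 2)
    refine hdom.mono' ?_ ?_
    · refine Measurable.aestronglyMeasurable ?_
      refine Measurable.mul ?_ (Measurable.add ?_ ?_)
      · exact Complex.measurable_ofReal.comp ((measurable_arcDensity_disp γ).comp measurable_snd)
      · exact hF.comp (((measurable_upper γ).comp measurable_snd).prodMk measurable_fst)
      · exact hF.comp (((measurable_lower γ).comp measurable_snd).prodMk measurable_fst)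
    · have : ∀ᵐ z ∂((volume : Measure ℝ).prod (volume.restrict (cell n))), z.2 ∈ cell n :=
        Measure.quasiMeasurePreserving_snd.ae (ae_restrict_mem (measurableSet_cell n))
      refine this.mono fun z hz => ?_
      rw [norm_mul, Complex.norm_real, Real.norm_of_nonneg (arcDensity_nonneg _)]
      have h1 := hb z.1 _ (upper_mem_box γ hz)
      have h2 := hb z.1 _ (lower_mem_box γ hz)
      calc _ ≤ arcDensity (γ - disp z.2) * (N z.1 + N z.1) :=
            mul_le_mul_of_nonneg_left ((norm_add_le _ _).trans (add_le_add h1 h2))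
              (arcDensity_nonneg _)
        _ = _ := by ring
  have i2 : Integrable fun a => shellInt (fun p => F p a) γ := iγ.integral_prod_left
  have hmu : ∀ y, Measurable fun a => F (upper γ y) a := fun y => hF.comp measurable_prodMk_left
  have hml : ∀ y, Measurable fun a => F (lower γ y) a := fun y => hF.comp measurable_prodMk_left
  -- Once the shell is frozen at γ, Fubini moves the energy integral inside it.
  have step2 : ∫ a, shellInt (fun p => F p a) γ = shellInt (fun p => ∫ a, F p a) γ := by
    simp only [shellInt]
    rw [integral_integral_swap iγ]
    refine setIntegral_congr_fun (measurableSet_cell n) fun y hy => ?_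
    rw [integral_const_mul, integral_add]
    · exact hN.mono' (hmu y).aestronglyMeasurable
        (Eventually.of_forall fun a => hb a _ (upper_mem_box γ hy))
    · exact hN.mono' (hml y).aestronglyMeasurable
        (Eventually.of_forall fun a => hb a _ (lower_mem_box γ hy))
  rw [step1, ← step2, ← integral_sub i1 i2, ← integral_const_mul]
  refine norm_integral_le_of_norm_le (hNγ.const_mul C) (Eventually.of_forall fun a => ?_)
  exact hH (fun p => F p a) (N a) (hF.comp measurable_prodMk_right) (hb a) (hL a) a γ

/-! ### Resolvent integrals over the line -/

lemma ofReal_sub_ne_zero {z : ℂ} (hz : z.im ≠ 0) (x : ℝ) : (x : ℂ) - z ≠ 0 := fun h => by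
  have := congrArg Complex.im h
  simp at this
  exact hz this

lemma hasDerivAt_log_ofReal_sub {z : ℂ} (hz : z.im ≠ 0) (x : ℝ) :
    HasDerivAt (fun x : ℝ => Complex.log ((x : ℂ) - z)) (1 / ((x : ℂ) - z)) x := by
  have h1 : HasDerivAt (fun x : ℝ => (x : ℂ) - z) 1 x :=
    (Complex.ofRealCLM.hasDerivAt (x := x)).sub_const z
  exact h1.clog_real (Or.inr (by simpa using hz))

lemma tendsto_ofReal_inv : Tendsto (fun x : ℝ => ((x⁻¹ : ℝ) : ℂ)) atTop (𝓝 0) :=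
  (Complex.continuous_ofReal.tendsto' 0 0 Complex.ofReal_zero).comp tendsto_inv_atTop_zero

/-- The difference is log(1 - z/x). Subtracting log x makes the limit finite, and it cancels between
two poles. -/
lemma tendsto_log_sub_log_atTop {z : ℂ} :
    Tendsto (fun x : ℝ => Complex.log ((x : ℂ) - z) - (Real.log x : ℂ)) atTop (𝓝 0) := by
  have h1 : Tendsto (fun x : ℝ => (1 : ℂ) - z * ((x⁻¹ : ℝ) : ℂ)) atTop (𝓝 1) := by
    simpa using (tendsto_ofReal_inv.const_mul z).const_sub 1
  have h2 := h1.clog (by simp [Complex.slitPlane])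
  rw [Complex.log_one] at h2
  refine h2.congr' ?_
  filter_upwards [eventually_gt_atTop 0, eventually_gt_atTop ‖z‖] with x hx hxz
  have hx' : (x : ℂ) ≠ 0 := by exact_mod_cast hx.ne'
  have e : (x : ℂ) - z = (x : ℂ) * (1 - z * ((x⁻¹ : ℝ) : ℂ)) := by push_cast; field_simp
  have hne : (1 : ℂ) - z * ((x⁻¹ : ℝ) : ℂ) ≠ 0 := by
    intro h
    rw [h, mul_zero, sub_eq_zero] at e
    rw [← e, Complex.norm_real, Real.norm_of_nonneg hx.le] at hxz
    exact lt_irrefl _ hxz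
  rw [e, Complex.log_ofReal_mul hx hne]; ring

/-- Here -1 - z/x approaches -1 from above the branch cut, where the principal logarithm tends to
πi. -/
lemma tendsto_log_sub_log_atBot_of_neg {z : ℂ} (hz : z.im < 0) :
    Tendsto (fun x : ℝ => Complex.log (((-x : ℝ) : ℂ) - z) - (Real.log x : ℂ)) atTop
      (𝓝 (Real.pi * Complex.I)) := by
  have h1 : Tendsto (fun x : ℝ => (-1 : ℂ) - z * ((x⁻¹ : ℝ) : ℂ)) atTop (𝓝 (-1)) := by
    simpa using (tendsto_ofReal_inv.const_mul z).const_sub (-1)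
  have h1' : Tendsto (fun x : ℝ => (-1 : ℂ) - z * ((x⁻¹ : ℝ) : ℂ)) atTop
      (𝓝[{z : ℂ | 0 ≤ z.im}] (-1)) := by
    refine tendsto_nhdsWithin_iff.2 ⟨h1, ?_⟩
    filter_upwards [eventually_gt_atTop 0] with x hx
    have : 0 ≤ -(z.im * x⁻¹) := by
      rw [← neg_mul]; have := neg_pos.2 hz; positivity
    simpa [← Complex.ofReal_inv] using this
  have h2 := (Complex.tendsto_log_nhdsWithin_im_nonneg_of_re_neg_of_im_zero (z := -1)
    (by simp) (by simp)).comp h1'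
  have h3 : ((Real.log ‖(-1 : ℂ)‖ : ℝ) : ℂ) + Real.pi * Complex.I = Real.pi * Complex.I := by simp
  rw [h3] at h2
  refine h2.congr' ?_
  filter_upwards [eventually_gt_atTop 0] with x hx
  have hx' : (x : ℂ) ≠ 0 := by exact_mod_cast hx.ne'
  have e : ((-x : ℝ) : ℂ) - z = (x : ℂ) * (-1 - z * ((x⁻¹ : ℝ) : ℂ)) := by
    push_cast; field_simp
  have hne : (-1 : ℂ) - z * ((x⁻¹ : ℝ) : ℂ) ≠ 0 := by
    intro h
    rw [h, mul_zero] at e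
    exact ofReal_sub_ne_zero hz.ne _ e
  simp only [Function.comp]
  rw [e, Complex.log_ofReal_mul hx hne]; ring

/-- Now the branch cut is approached from below, whence the opposite sign. -/
lemma tendsto_log_sub_log_atBot_of_pos {z : ℂ} (hz : 0 < z.im) :
    Tendsto (fun x : ℝ => Complex.log (((-x : ℝ) : ℂ) - z) - (Real.log x : ℂ)) atTop
      (𝓝 (-(Real.pi * Complex.I))) := by
  have h1 : Tendsto (fun x : ℝ => (-1 : ℂ) - z * ((x⁻¹ : ℝ) : ℂ)) atTop (𝓝 (-1)) := by
    simpa using (tendsto_ofReal_inv.const_mul z).const_sub (-1)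
  have h1' : Tendsto (fun x : ℝ => (-1 : ℂ) - z * ((x⁻¹ : ℝ) : ℂ)) atTop
      (𝓝[{z : ℂ | z.im < 0}] (-1)) := by
    refine tendsto_nhdsWithin_iff.2 ⟨h1, ?_⟩
    filter_upwards [eventually_gt_atTop 0] with x hx
    have : -(z.im * x⁻¹) < 0 := by
      rw [neg_lt_zero]; positivity
    simpa [← Complex.ofReal_inv] using this
  have h2 := (Complex.tendsto_log_nhdsWithin_im_neg_of_re_neg_of_im_zero (z := -1)
    (by simp) (by simp)).comp h1'
  have h3 : ((Real.log ‖(-1 : ℂ)‖ : ℝ) : ℂ) - Real.pi * Complex.I = -(Real.pi * Complex.I) := by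
    simp
  rw [h3] at h2
  refine h2.congr' ?_
  filter_upwards [eventually_gt_atTop 0] with x hx
  have hx' : (x : ℂ) ≠ 0 := by exact_mod_cast hx.ne'
  have e : ((-x : ℝ) : ℂ) - z = (x : ℂ) * (-1 - z * ((x⁻¹ : ℝ) : ℂ)) := by
    push_cast; field_simp
  have hne : (-1 : ℂ) - z * ((x⁻¹ : ℝ) : ℂ) ≠ 0 := by
    intro h
    rw [h, mul_zero] at e
    exact ofReal_sub_ne_zero hz.ne' _ e
  simp only [Function.comp]
  rw [e, Complex.log_ofReal_mul hx hne]; ring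

/-- Partial fractions give the antiderivative (log(x - z) - log(x - w))/(z - w). It vanishes at +∞,
so the value is decided by the branches of the logarithms at -∞. -/
lemma integral_resolvent_mul {z w c d : ℂ} (hz : z.im ≠ 0) (hw : w.im ≠ 0) (hzw : z ≠ w)
    (hi : Integrable fun x : ℝ => 1 / (((x : ℂ) - z) * ((x : ℂ) - w)))
    (hc : Tendsto (fun x : ℝ => Complex.log (((-x : ℝ) : ℂ) - z) - (Real.log x : ℂ)) atTop (𝓝 c))
    (hd : Tendsto (fun x : ℝ => Complex.log (((-x : ℝ) : ℂ) - w) - (Real.log x : ℂ)) atTop (𝓝 d)) :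
    ∫ x : ℝ, 1 / (((x : ℂ) - z) * ((x : ℂ) - w)) = (d - c) / (z - w) := by
  have hzw' : z - w ≠ 0 := sub_ne_zero.2 hzw
  have hder : ∀ x : ℝ, HasDerivAt
      (fun x : ℝ => (Complex.log ((x : ℂ) - z) - Complex.log ((x : ℂ) - w)) / (z - w))
      (1 / (((x : ℂ) - z) * ((x : ℂ) - w))) x := by
    intro x
    refine (((hasDerivAt_log_ofReal_sub hz x).sub (hasDerivAt_log_ofReal_sub hw x)).div_const
      (z - w)).congr_deriv ?_
    have h1 := ofReal_sub_ne_zero hz x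
    have h2 := ofReal_sub_ne_zero hw x
    field_simp; ring
  have ht : Tendsto
      (fun x : ℝ => (Complex.log ((x : ℂ) - z) - Complex.log ((x : ℂ) - w)) / (z - w)) atTop
      (𝓝 0) := by
    have := ((tendsto_log_sub_log_atTop (z := z)).sub
      (tendsto_log_sub_log_atTop (z := w))).div_const (z - w)
    simpa using this
  have hb : Tendsto
      (fun x : ℝ => (Complex.log ((x : ℂ) - z) - Complex.log ((x : ℂ) - w)) / (z - w)) atBot
      (𝓝 ((c - d) / (z - w))) := by
    have := ((hc.sub hd).div_const (z - w)).comp tendsto_neg_atBot_atTop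
    refine this.congr fun x => ?_
    simp
  rw [integral_of_hasDerivAt_of_tendsto hder hi hb ht]
  ring

/-! ### Elementary integrals on the line -/

/-- The exponents are -5/8 > -1 at the origin and -13/8 < -1 at infinity. -/
lemma integrable_abs_rpow_mul : Integrable (fun x : ℝ => |x| ^ (-(5 / 8) : ℝ) * (|x| + 1)⁻¹) := by
  have h1 : Integrable ((Set.Ioc (0 : ℝ) 1).indicator (fun t : ℝ => t ^ (-(5 / 8) : ℝ))) :=
    (integrable_indicator_iff measurableSet_Ioc).2
      ((intervalIntegrable_iff_integrableOn_Ioc_of_le zero_le_one).1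
        (intervalIntegral.intervalIntegrable_rpow' (by norm_num)))
  have h2 : Integrable (fun x : ℝ => (1 + ‖x‖) ^ (-(13 / 8) : ℝ)) :=
    integrable_one_add_norm (by simp; norm_num)
  refine ((h1.add h1.comp_neg).add (h2.const_mul 2)).mono'
    (Measurable.aestronglyMeasurable (by fun_prop)) (Eventually.of_forall fun x => ?_)
  rw [Real.norm_of_nonneg (by positivity)]
  simp only [Pi.add_apply, Real.norm_eq_abs]
  have p0 : ∀ x : ℝ, 0 ≤ (Set.Ioc (0 : ℝ) 1).indicator (fun t : ℝ => t ^ (-(5 / 8) : ℝ)) x :=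
    fun x => Set.indicator_nonneg (fun t ht => Real.rpow_nonneg ht.1.le _) x
  have h3 : 0 ≤ 2 * (1 + |x|) ^ (-(13 / 8) : ℝ) := by positivity
  rcases eq_or_ne x 0 with rfl | hx0
  · have := p0 0; have := p0 (-0)
    rw [abs_zero, Real.zero_rpow (by norm_num), zero_mul]
    simp only [abs_zero] at h3
    linarith
  have hxpos : 0 < |x| := abs_pos.2 hx0
  rcases le_or_gt |x| 1 with hx | hx
  · have hle : |x| ^ (-(5 / 8) : ℝ) * (|x| + 1)⁻¹ ≤ |x| ^ (-(5 / 8) : ℝ) := by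
      refine mul_le_of_le_one_right (by positivity) (inv_le_one_of_one_le₀ (by linarith))
    rcases lt_or_gt_of_ne hx0 with h | h
    · rw [abs_of_neg h] at *
      have : (-x) ∈ Set.Ioc (0 : ℝ) 1 := ⟨hxpos, hx⟩
      rw [Set.indicator_of_mem this]
      linarith [p0 x]
    · rw [abs_of_pos h] at *
      have : x ∈ Set.Ioc (0 : ℝ) 1 := ⟨hxpos, hx⟩
      rw [Set.indicator_of_mem this]
      linarith [p0 (-x)]
  · have h4 : |x| ^ (-(5 / 8) : ℝ) ≤ 2 * (1 + |x|) ^ (-(5 / 8) : ℝ) := by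
      calc |x| ^ (-(5 / 8) : ℝ) ≤ ((1 + |x|) / 2) ^ (-(5 / 8) : ℝ) :=
            Real.rpow_le_rpow_of_nonpos (by positivity) (by linarith) (by norm_num)
        _ = 2 ^ (5 / 8 : ℝ) * (1 + |x|) ^ (-(5 / 8) : ℝ) := by
            rw [Real.div_rpow (by positivity) (by norm_num), Real.rpow_neg (by norm_num : (0:ℝ) ≤ 2),
              div_inv_eq_mul, mul_comm]
        _ ≤ 2 * (1 + |x|) ^ (-(5 / 8) : ℝ) := by
            gcongr
            conv_rhs => rw [← Real.rpow_one 2]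
            exact Real.rpow_le_rpow_of_exponent_le (by norm_num) (by norm_num)
    have h5 : (1 + |x|) ^ (-(13 / 8) : ℝ) = (1 + |x|) ^ (-(5 / 8) : ℝ) * (|x| + 1)⁻¹ := by
      rw [add_comm |x| 1, ← Real.rpow_neg_one (1 + |x|), ← Real.rpow_add (by positivity)]; norm_num
    rw [h5, ← mul_assoc]
    have h6 : |x| ^ (-(5 / 8) : ℝ) * (|x| + 1)⁻¹ ≤ 2 * (1 + |x|) ^ (-(5 / 8) : ℝ) * (|x| + 1)⁻¹ := by
      gcongr
    linarith [p0 x, p0 (-x)]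

lemma integral_abs_rpow_scaled : ∃ K : ℝ, 0 ≤ K ∧ ∀ a ε : ℝ, 0 < ε →
    Integrable (fun u : ℝ => |u - a| ^ (-(5 / 8) : ℝ) * (|u - a| + ε)⁻¹) ∧
    ∫ u : ℝ, |u - a| ^ (-(5 / 8) : ℝ) * (|u - a| + ε)⁻¹ = K * ε ^ (-(5 / 8) : ℝ) := by
  refine ⟨∫ x : ℝ, |x| ^ (-(5 / 8) : ℝ) * (|x| + 1)⁻¹, integral_nonneg fun x => by positivity,
    fun a ε hε => ?_⟩
  set k : ℝ → ℝ := fun x => |x| ^ (-(5 / 8) : ℝ) * (|x| + 1)⁻¹ with hk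
  have e : ∀ u, |u - a| ^ (-(5 / 8) : ℝ) * (|u - a| + ε)⁻¹ =
      ε ^ (-(13 / 8) : ℝ) * k ((u - a) / ε) := by
    intro u
    simp only [hk]
    rw [abs_div, abs_of_pos hε, Real.div_rpow (abs_nonneg _) hε.le]
    have h1 : ε ^ (-(13 / 8) : ℝ) = ε ^ (-(5 / 8) : ℝ) * ε⁻¹ := by
      rw [← Real.rpow_neg_one, ← Real.rpow_add hε]; norm_num
    have h2 : ε ^ (-(5 / 8) : ℝ) ≠ 0 := (Real.rpow_pos_of_pos hε _).ne'
    have h3 : |u - a| + ε ≠ 0 := by positivity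
    have h4 : |u - a| / ε + 1 = (|u - a| + ε) / ε := by field_simp
    rw [h1, h4, inv_div]
    field_simp
  have hi : Integrable fun u => k ((u - a) / ε) :=
    (integrable_abs_rpow_mul.comp_div hε.ne').comp_sub_right a
  simp_rw [e]
  refine ⟨hi.const_mul _, ?_⟩
  rw [integral_const_mul, integral_sub_right_eq_self (fun x => k (x / ε)) a,
    Measure.integral_comp_div, abs_of_pos hε, smul_eq_mul]
  have h1 : ε ^ (-(13 / 8) : ℝ) * ε = ε ^ (-(5 / 8) : ℝ) := by
    conv_lhs => rw [← Real.rpow_one ε, ← Real.rpow_mul hε.le, ← Real.rpow_add hε]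
    norm_num
  rw [← h1]; ring

lemma integral_abs_add_rpow_scaled (s : ℝ) (hs : s < -1) : ∃ K : ℝ, 0 ≤ K ∧ ∀ a ε : ℝ, 0 < ε →
    Integrable (fun u : ℝ => (|u - a| + ε) ^ s) ∧
    ∫ u : ℝ, (|u - a| + ε) ^ s = K * ε ^ (s + 1) := by
  refine ⟨∫ x : ℝ, (1 + ‖x‖) ^ s, integral_nonneg fun x => by positivity, fun a ε hε => ?_⟩
  have h0 : Integrable (fun x : ℝ => (1 + ‖x‖) ^ s) := by
    have := integrable_one_add_norm (E := ℝ) (μ := volume) (r := -s) (by simp; linarith)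
    simpa using this
  set k : ℝ → ℝ := fun x => (1 + ‖x‖) ^ s with hk
  have e : ∀ u, (|u - a| + ε) ^ s = ε ^ s * k ((u - a) / ε) := by
    intro u
    simp only [hk]
    rw [Real.norm_eq_abs, abs_div, abs_of_pos hε, ← Real.mul_rpow hε.le (by positivity)]
    congr 1; field_simp; ring
  have hi : Integrable fun u => k ((u - a) / ε) := (h0.comp_div hε.ne').comp_sub_right a
  simp_rw [e]
  refine ⟨hi.const_mul _, ?_⟩
  rw [integral_const_mul, integral_sub_right_eq_self (fun x => k (x / ε)) a,
    Measure.integral_comp_div, abs_of_pos hε, smul_eq_mul, Real.rpow_add hε, Real.rpow_one]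
  ring

lemma isCompact_box (d : ℕ) : IsCompact (box d) := by
  have : box d = (PiLp.homeomorph 2 (fun _ : Fin d => ℝ)) ⁻¹'
      (Set.univ.pi fun _ => Set.Icc (-(1 / 2) : ℝ) (1 / 2)) := by
    ext p; simp only [Set.mem_preimage, Set.mem_univ_pi]; rfl
  rw [this, Homeomorph.isCompact_preimage]
  exact isCompact_univ_pi fun _ => isCompact_Icc

lemma cell_subset_box (d : ℕ) : cell d ⊆ box d := fun _ hp i => ⟨(hp i).1, (hp i).2.le⟩

lemma integrableOn_cell {d : ℕ} {f : Mom d → ℂ} (hf : Continuous f) : IntegrableOn f (cell d) :=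
  (hf.continuousOn.integrableOn_compact (isCompact_box d)).mono_set (cell_subset_box d)

/-! ### The limit `Θ` -/

lemma norm_ofReal_sub_ge_re (z : ℂ) (u : ℝ) : |u - z.re| ≤ ‖(u : ℂ) - z‖ := by
  simpa using Complex.abs_re_le_norm ((u : ℂ) - z)

lemma norm_ofReal_sub_ge_im (z : ℂ) (u : ℝ) : |z.im| ≤ ‖(u : ℂ) - z‖ := by
  simpa using Complex.abs_im_le_norm ((u : ℂ) - z)

lemma continuous_one_div_ofReal_sub {z w : ℂ} (hz : z.im ≠ 0) (hw : w.im ≠ 0) :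
    Continuous fun u : ℝ => 1 / (((u : ℂ) - z) * ((u : ℂ) - w)) :=
  Continuous.div₀ continuous_const (by fun_prop) fun u =>
    mul_ne_zero (ofReal_sub_ne_zero hz u) (ofReal_sub_ne_zero hw u)

lemma integrable_resolvent_mul {z w : ℂ} (hz : z.im ≠ 0) (hw : w.im ≠ 0) :
    Integrable fun u : ℝ => 1 / (((u : ℂ) - z) * ((u : ℂ) - w)) := by
  obtain ⟨K, -, hK⟩ := integral_abs_add_rpow_scaled (-2) (by norm_num)
  have hz' : 0 < |z.im| := abs_pos.2 hz
  have hw' : 0 < |w.im| := abs_pos.2 hw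
  refine (((hK z.re _ hz').1.add (hK w.re _ hw').1).const_mul 4).mono'
    (continuous_one_div_ofReal_sub hz hw).aestronglyMeasurable (Eventually.of_forall fun u => ?_)
  have key : ∀ z : ℂ, z.im ≠ 0 →
      ‖(u : ℂ) - z‖⁻¹ ^ 2 ≤ 4 * (|u - z.re| + |z.im|) ^ (-2 : ℝ) := by
    intro z hz
    have h0 : 0 < |z.im| := abs_pos.2 hz
    have h1 := norm_ofReal_sub_ge_re z u
    have h2 := norm_ofReal_sub_ge_im z u
    rw [Real.rpow_neg (by positivity), Real.rpow_ofNat, inv_pow]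
    have h3 : 0 < ‖(u : ℂ) - z‖ := lt_of_lt_of_le h0 h2
    rw [← div_eq_mul_inv, inv_eq_one_div, div_le_div_iff₀ (by positivity) (by positivity)]
    nlinarith [abs_nonneg (u - z.re)]
  rw [norm_div, norm_one, norm_mul, one_div, mul_inv]
  have h1 := key z hz
  have h2 := key w hw
  simp only [Pi.add_apply]
  nlinarith [sq_nonneg (‖(u : ℂ) - z‖⁻¹ - ‖(u : ℂ) - w‖⁻¹), sq_nonneg (‖(u : ℂ) - z‖⁻¹),
    sq_nonneg (‖(u : ℂ) - w‖⁻¹)]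

/-- Both logarithms jump alike. This cancellation removes the main term when two regularizations of
Θ are compared. -/
lemma integral_resolvent_mul_same_side {z w : ℂ} (hz : 0 < z.im) (hw : 0 < w.im) (hzw : z ≠ w) :
    ∫ x : ℝ, 1 / (((x : ℂ) - z) * ((x : ℂ) - w)) = 0 := by
  rw [integral_resolvent_mul hz.ne' hw.ne' hzw (integrable_resolvent_mul hz.ne' hw.ne')
    (tendsto_log_sub_log_atBot_of_pos hz) (tendsto_log_sub_log_atBot_of_pos hw)]
  simp

lemma integral_resolvent_mul_opposite {z w : ℂ} (hz : z.im < 0) (hw : 0 < w.im) :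
    ∫ x : ℝ, 1 / (((x : ℂ) - z) * ((x : ℂ) - w)) = -2 * Real.pi * Complex.I / (z - w) := by
  have hzw : z ≠ w := fun h => by rw [h] at hz; exact lt_asymm hz hw
  rw [integral_resolvent_mul hz.ne hw.ne' hzw (integrable_resolvent_mul hz.ne hw.ne')
    (tendsto_log_sub_log_atBot_of_neg hz) (tendsto_log_sub_log_atBot_of_pos hw)]
  ring

lemma ThetaReg_eq (d : ℕ) (ε a : ℝ) :
    ThetaReg d ε a = ∫ p in cell d, -(1 / ((disp p : ℂ) - ((a : ℂ) + Complex.I * ε))) := by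
  unfold ThetaReg
  congr 1; ext p
  rw [← one_div_neg_eq_neg_one_div]; congr 1; ring

/-- The resolvent identity extracts w - z, of size at most 2ε. The shell term of the remaining
integral is zero because both poles lie above the axis, and the Hölder error is of order ε^(-5/8).
Uniformity in ε' yields existence of Θ; the freedom in a and b yields its Hölder continuity. -/
lemma ThetaReg_sub_le {n : ℕ} (hn : 2 ≤ n) : ∃ C : ℝ, 0 ≤ C ∧ ∀ a b ε' ε : ℝ, 0 < ε' → ε' ≤ ε →
    |a - b| ≤ ε → ‖ThetaReg (n + 1) ε' a - ThetaReg (n + 1) ε b‖ ≤ C * ε ^ (3 / 8 : ℝ) := by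
  obtain ⟨C, hC, hS⟩ := integral_disp_sub_shellInt_le hn
  obtain ⟨K, hK, hk⟩ := integral_abs_rpow_scaled
  refine ⟨6 * C * K, by positivity, fun a b ε' ε hε' hle hab => ?_⟩
  have hε : 0 < ε := hε'.trans_le hle
  set z : ℂ := (a : ℂ) + Complex.I * ε' with hz
  set w : ℂ := (b : ℂ) + Complex.I * ε with hw
  have zre : z.re = a := by simp [hz]
  have zim : z.im = ε' := by simp [hz]
  have wre : w.re = b := by simp [hw]
  have wim : w.im = ε := by simp [hw]
  have hz0 : z.im ≠ 0 := by rw [zim]; exact hε'.ne'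
  have hw0 : w.im ≠ 0 := by rw [wim]; exact hε.ne'
  have hcd : Continuous fun p : Mom (n + 1) => (disp p : ℂ) :=
    Complex.continuous_ofReal.comp continuous_disp
  have hR : ThetaReg (n + 1) ε' a - ThetaReg (n + 1) ε b =
      (w - z) * ∫ p in cell (n + 1), 1 / (((disp p : ℂ) - z) * ((disp p : ℂ) - w)) := by
    have hci : ∀ z : ℂ, z.im ≠ 0 → Continuous fun p : Mom (n + 1) => -(1 / ((disp p : ℂ) - z)) :=
      fun z hz => (Continuous.div₀ continuous_const (hcd.sub continuous_const)
        fun p => ofReal_sub_ne_zero hz _).neg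
    rw [ThetaReg_eq, ThetaReg_eq, ← integral_sub (integrableOn_cell (hci z hz0))
      (integrableOn_cell (hci w hw0)), ← integral_const_mul]
    congr 1; ext p
    have h1 := ofReal_sub_ne_zero hz0 (disp p)
    have h2 := ofReal_sub_ne_zero hw0 (disp p)
    field_simp; ring
  have hwz : ‖w - z‖ ≤ 2 * ε := by
    have e : w - z = ((b - a : ℝ) : ℂ) + Complex.I * ((ε - ε' : ℝ) : ℂ) := by
      rw [hz, hw]; push_cast; ring
    rw [e]
    refine (norm_add_le _ _).trans ?_
    rw [norm_mul, Complex.norm_I, one_mul, Complex.norm_real, Complex.norm_real, Real.norm_eq_abs,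
      Real.norm_eq_abs, abs_sub_comm, abs_of_nonneg (by linarith : 0 ≤ ε - ε')]
    linarith
  -- The integral formula divides by z - w, so coinciding poles are set aside.
  rcases eq_or_ne z w with hzw | hzw
  · rw [hR, hzw, sub_self, zero_mul, norm_zero]; positivity
  set f : ℝ → ℂ := fun u => 1 / (((u : ℂ) - z) * ((u : ℂ) - w)) with hf
  have hfc : Continuous f := continuous_one_div_ofReal_sub hz0 hw0
  have hbound : ∀ u : ℝ, ‖f u‖ * |u - a| ^ (3 / 8 : ℝ) ≤
      3 * (|u - a| ^ (-(5 / 8) : ℝ) * (|u - a| + ε)⁻¹) := by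
    intro u
    rcases eq_or_ne u a with rfl | hua
    · simp [Real.zero_rpow]
    have hpos : 0 < |u - a| := abs_pos.2 (sub_ne_zero.2 hua)
    have h1 := norm_ofReal_sub_ge_re z u
    have h2 := norm_ofReal_sub_ge_re w u
    have h3 := norm_ofReal_sub_ge_im w u
    rw [zre] at h1
    rw [wre] at h2
    rw [wim, abs_of_pos hε] at h3
    have h4 : |u - a| ≤ |u - b| + |a - b| := by
      have := abs_sub_le u b a
      rwa [abs_sub_comm b a] at this
    -- Only w supplies a cutoff at scale ε. The resolvent at z is bounded by 1/|u - a| alone,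
    -- independently of ε'; the factor |u - a|^(3/8) makes this integrable.
    have h5 : |u - a| + ε ≤ 3 * ‖(u : ℂ) - w‖ := by linarith
    have h6 : ‖f u‖ ≤ |u - a|⁻¹ * (3 * (|u - a| + ε)⁻¹) := by
      rw [hf]
      simp only
      rw [norm_div, norm_one, norm_mul, one_div, mul_inv]
      gcongr
      rw [inv_le_iff_one_le_mul₀ (by linarith), mul_assoc, ← div_eq_inv_mul, mul_div_assoc', le_div_iff₀ (by positivity)]
      linarith
    calc ‖f u‖ * |u - a| ^ (3 / 8 : ℝ)
        ≤ |u - a|⁻¹ * (3 * (|u - a| + ε)⁻¹) * |u - a| ^ (3 / 8 : ℝ) := by gcongr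
      _ = 3 * ((|u - a| ^ (-1 : ℝ) * |u - a| ^ (3 / 8 : ℝ)) * (|u - a| + ε)⁻¹) := by
          rw [Real.rpow_neg_one]; ring
      _ = _ := by rw [← Real.rpow_add hpos]; norm_num
  have hint : Integrable fun u => ‖f u‖ * |u - a| ^ (3 / 8 : ℝ) := by
    refine ((hk a ε hε).1.const_mul 3).mono' ?_ (Eventually.of_forall fun u => ?_)
    · exact (hfc.norm.measurable.mul (by fun_prop)).aestronglyMeasurable
    · rw [Real.norm_of_nonneg (by positivity)]; exact hbound u
  have hS' := hS (fun _ u => f u) (fun u => ‖f u‖) a (hfc.measurable.comp measurable_snd)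
    (integrable_resolvent_mul hz0 hw0).norm hint (fun u p _ => le_rfl)
    (fun u p _ q _ => by rw [sub_self, norm_zero]; positivity)
  have h0 : ∫ u, f u = 0 := integral_resolvent_mul_same_side (by rw [zim]; exact hε')
    (by rw [wim]; exact hε) hzw
  have h0' : shellInt (fun _ : Mom (n + 1) => ∫ u, f u) a = 0 := by simp [shellInt, h0]
  rw [h0', sub_zero] at hS'
  rw [hR, norm_mul]
  calc _ ≤ 2 * ε * (C * ∫ u, ‖f u‖ * |u - a| ^ (3 / 8 : ℝ)) := by gcongr
    _ ≤ 2 * ε * (C * (3 * (K * ε ^ (-(5 / 8) : ℝ)))) := by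
        gcongr
        rw [← (hk a ε hε).2, ← integral_const_mul]
        exact integral_mono hint ((hk a ε hε).1.const_mul 3) hbound
    _ = 6 * C * K * (ε ^ (1 : ℝ) * ε ^ (-(5 / 8) : ℝ)) := by rw [Real.rpow_one]; ring
    _ = _ := by rw [← Real.rpow_add hε]; norm_num

lemma tendsto_ThetaReg {n : ℕ} (hn : 2 ≤ n) (a : ℝ) :
    Tendsto (fun ε : ℝ => ThetaReg (n + 1) ε a) (𝓝[>] (0 : ℝ)) (𝓝 (Theta (n + 1) a)) := by
  refine tendsto_nhds_limUnder ?_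
  obtain ⟨C, hC, h⟩ := ThetaReg_sub_le hn
  refine cauchy_map_iff_exists_tendsto.1 (Metric.cauchy_iff.2 ⟨inferInstance, fun δ hδ => ?_⟩)
  have ht : Tendsto (fun ε : ℝ => C * ε ^ (3 / 8 : ℝ)) (𝓝[>] 0) (𝓝 0) := by
    have h1 : Continuous fun ε : ℝ => C * ε ^ (3 / 8 : ℝ) :=
      continuous_const.mul (Real.continuous_rpow_const (by norm_num))
    exact (h1.tendsto' 0 0 (by simp [Real.zero_rpow])).mono_left nhdsWithin_le_nhds
  obtain ⟨ε₀, hε₀⟩ := ((ht.eventually (gt_mem_nhds (half_pos hδ))).and self_mem_nhdsWithin).exists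
  have hε₀pos : 0 < ε₀ := hε₀.2
  refine ⟨(fun ε : ℝ => ThetaReg (n + 1) ε a) '' Set.Ioc 0 ε₀,
    image_mem_map (Ioc_mem_nhdsGT hε₀pos), ?_⟩
  rintro _ ⟨x, hx, rfl⟩ _ ⟨y, hy, rfl⟩
  have h1 := h a a x ε₀ hx.1 hx.2 (by simpa using hε₀pos.le)
  have h2 := h a a y ε₀ hy.1 hy.2 (by simpa using hε₀pos.le)
  rw [← dist_eq_norm] at h1 h2
  calc _ ≤ _ := dist_triangle_right _ _ (ThetaReg (n + 1) ε₀ a)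
    _ < δ := by linarith [hε₀.1]

lemma Theta_sub_ThetaReg_le {n : ℕ} (hn : 2 ≤ n) : ∃ C : ℝ, 0 ≤ C ∧ ∀ a b ε : ℝ, 0 < ε →
    |a - b| ≤ ε → ‖Theta (n + 1) a - ThetaReg (n + 1) ε b‖ ≤ C * ε ^ (3 / 8 : ℝ) := by
  obtain ⟨C, hC, h⟩ := ThetaReg_sub_le hn
  refine ⟨C, hC, fun a b ε hε hab => ?_⟩
  refine le_of_tendsto ((tendsto_ThetaReg hn a).sub_const _).norm ?_
  filter_upwards [Ioc_mem_nhdsGT hε] with ε' hε'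
  exact h a b ε' ε hε'.1 hε'.2 hab

/-- Both values are compared with the regularization at energy b and scale ε = |a - b|. -/
lemma Theta_holder {n : ℕ} (hn : 2 ≤ n) : ∃ C : ℝ, 0 ≤ C ∧ ∀ a b : ℝ,
    ‖Theta (n + 1) a - Theta (n + 1) b‖ ≤ C * |a - b| ^ (3 / 8 : ℝ) := by
  obtain ⟨C, hC, h⟩ := Theta_sub_ThetaReg_le hn
  refine ⟨2 * C, by positivity, fun a b => ?_⟩
  rcases eq_or_ne a b with rfl | hab
  · simp [Real.zero_rpow]
  have hpos : 0 < |a - b| := abs_pos.2 (sub_ne_zero.2 hab)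
  have h1 := h a b _ hpos le_rfl
  have h2 := h b b |a - b| hpos (by simp)
  calc _ = ‖(Theta (n + 1) a - ThetaReg (n + 1) |a - b| b) -
        (Theta (n + 1) b - ThetaReg (n + 1) |a - b| b)‖ := by congr 1; ring
    _ ≤ _ := (norm_sub_le _ _).trans (by linarith)

lemma Theta_bounded {n : ℕ} (hn : 2 ≤ n) : ∃ C : ℝ, 0 ≤ C ∧ ∀ a : ℝ, ‖Theta (n + 1) a‖ ≤ C := by
  obtain ⟨C, hC, h⟩ := Theta_sub_ThetaReg_le hn
  refine ⟨C + 1, by positivity, fun a => ?_⟩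
  have h1 := h a a 1 one_pos (by simp)
  have h2 : ‖ThetaReg (n + 1) 1 a‖ ≤ 1 := by
    unfold ThetaReg
    have := norm_setIntegral_le_of_norm_le_const (μ := volume) (s := cell (n + 1))
      (f := fun q => 1 / ((a : ℂ) - (disp q : ℂ) + Complex.I * ((1 : ℝ) : ℂ))) (C := 1)
      (by rw [volume_cell]; simp) (fun q _ => by
        rw [norm_div, norm_one]
        refine div_le_one_of_le₀ ?_ (norm_nonneg _)
        have := Complex.abs_im_le_norm ((a : ℂ) - (disp q : ℂ) + Complex.I * ((1 : ℝ) : ℂ))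
        simpa using this)
    simpa [Measure.real, volume_cell] using this
  rw [Real.one_rpow, mul_one] at h1
  calc _ = ‖(Theta (n + 1) a - ThetaReg (n + 1) 1 a) + ThetaReg (n + 1) 1 a‖ := by congr 1; ring
    _ ≤ _ := (norm_add_le _ _).trans (by linarith)

lemma continuous_Theta {n : ℕ} (hn : 2 ≤ n) : Continuous (Theta (n + 1)) := by
  obtain ⟨C, hC, h⟩ := Theta_holder hn
  refine continuous_iff_continuousAt.2 fun a => ?_
  refine tendsto_iff_norm_sub_tendsto_zero.2 ?_
  have h1 : Continuous fun b : ℝ => C * |b - a| ^ (3 / 8 : ℝ) :=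
    continuous_const.mul ((Real.continuous_rpow_const (by norm_num)).comp (by fun_prop))
  exact squeeze_zero (fun b => norm_nonneg _) (fun b => h b a)
    (h1.tendsto' a 0 (by simp [Real.zero_rpow]))

/-- Each regularized integrand has negative imaginary part. Hence the self-energy only pushes the
poles further from the real axis. -/
lemma Theta_im_nonpos {n : ℕ} (hn : 2 ≤ n) (a : ℝ) : (Theta (n + 1) a).im ≤ 0 := by
  have ht := (Complex.continuous_im.tendsto _).comp (tendsto_ThetaReg hn a)
  refine le_of_tendsto ht ?_
  filter_upwards [self_mem_nhdsWithin] with ε hε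
  have hε : 0 < ε := hε
  have hne : ∀ p : Mom (n + 1), (a : ℂ) - (disp p : ℂ) + Complex.I * (ε : ℂ) ≠ 0 := fun p h => by
    have := congrArg Complex.im h
    simp at this; exact hε.ne' this
  have hc : Continuous fun p : Mom (n + 1) =>
      1 / ((a : ℂ) - (disp p : ℂ) + Complex.I * (ε : ℂ)) :=
    Continuous.div₀ continuous_const (((continuous_const.sub
      (Complex.continuous_ofReal.comp continuous_disp)).add continuous_const)) hne
  have e := Complex.imCLM.integral_comp_comm (integrableOn_cell hc)
  simp only [Complex.imCLM_apply] at e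
  simp only [Function.comp, ThetaReg]
  rw [← e]
  refine integral_nonpos fun p => ?_
  simp only [one_div, Complex.inv_im]
  refine div_nonpos_of_nonpos_of_nonneg ?_ (Complex.normSq_nonneg _)
  simpa using hε.le

/-! ### The area formula for graphs -/

/-- The tail projection, a left inverse of `glue x`. -/
def tail {n : ℕ} (p : Mom (n + 1)) : Mom n := WithLp.toLp 2 (fun i => p i.succ)

@[simp] lemma tail_glue {n : ℕ} (x : ℝ) (y : Mom n) : tail (glue x y) = y := by ext; simp [tail]

/-- The graph of `φ`, parametrized by the last coordinates. -/
def graphMap {n : ℕ} (φ : Mom n → ℝ) (y : Mom n) : Mom (n + 1) := glue (φ y) y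

@[simp] lemma tail_graphMap {n : ℕ} (φ : Mom n → ℝ) (y : Mom n) : tail (graphMap φ y) = y := by
  simp [graphMap]

lemma graphMap_injective {n : ℕ} (φ : Mom n → ℝ) : Function.Injective (graphMap φ) :=
  Function.LeftInverse.injective (g := tail) (tail_graphMap φ)

/-- The area element of a graph whose height function has derivative `A`. -/
def areaElt {n : ℕ} (A : Mom n →L[ℝ] ℝ) : ℝ := Real.sqrt (1 + ‖A‖ ^ 2)

lemma one_le_areaElt {n : ℕ} (A : Mom n →L[ℝ] ℝ) : 1 ≤ areaElt A :=
  Real.one_le_sqrt.2 (by nlinarith [norm_nonneg A])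

/-- The area element is 1-Lipschitz in the norm of the derivative and at least 1, so an additive
error is also a relative one. -/
lemma areaElt_le {n : ℕ} {A B : Mom n →L[ℝ] ℝ} {δ : ℝ} (h : ‖A - B‖ ≤ δ) :
    areaElt A ≤ (1 + δ) * areaElt B := by
  have hδ : 0 ≤ δ := (norm_nonneg _).trans h
  have h1 : ‖A‖ ≤ ‖B‖ + δ := by
    calc ‖A‖ = ‖B + (A - B)‖ := by congr 1; abel
      _ ≤ _ := (norm_add_le _ _).trans (by linarith)
  have hB := one_le_areaElt B
  have hsq : areaElt B ^ 2 = 1 + ‖B‖ ^ 2 := Real.sq_sqrt (by positivity)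
  have hBn : ‖B‖ ≤ areaElt B := by
    refine Real.le_sqrt_of_sq_le (by linarith)
  have h2 : areaElt A ≤ areaElt B + δ := by
    refine Real.sqrt_le_iff.2 ⟨by linarith, ?_⟩
    nlinarith [norm_nonneg A, norm_nonneg B]
  nlinarith

lemma euclideanHausdorffMeasure_image_le {X Y : Type*} [EMetricSpace X] [EMetricSpace Y]
    [MeasurableSpace X] [BorelSpace X] [MeasurableSpace Y] [BorelSpace Y]
    {K : NNReal} {f : X → Y} {s : Set X} (h : LipschitzOnWith K f s) (n : ℕ) :
    (Measure.euclideanHausdorffMeasure n : Measure Y) (f '' s) ≤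
      (K : ENNReal) ^ n * (Measure.euclideanHausdorffMeasure n : Measure X) s := by
  rw [Measure.euclideanHausdorffMeasure_def, Measure.euclideanHausdorffMeasure_def,
    Measure.smul_apply, Measure.smul_apply]
  have := h.hausdorffMeasure_image_le (d := n) (Nat.cast_nonneg n)
  rw [ENNReal.rpow_natCast] at this
  rw [ENNReal.smul_def, ENNReal.smul_def, smul_eq_mul, smul_eq_mul, mul_left_comm]
  gcongr

/-- Let v represent A. The graph map is an isometry composed with T, the positive square root of I +
v vᵀ, and the determinant of T is the area element. -/
lemma euclideanHausdorffMeasure_graph_linear {n : ℕ} (A : Mom n →L[ℝ] ℝ) (S : Set (Mom n)) :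
    (Measure.euclideanHausdorffMeasure n : Measure (Mom (n + 1))) (graphMap A '' S) =
      ENNReal.ofReal (areaElt A) * volume S := by
  set v : Mom n := (InnerProductSpace.toDual ℝ (Mom n)).symm A with hv
  have hA : ∀ x, A x = inner ℝ v x := fun x => by
    rw [hv, InnerProductSpace.toDual_symm_apply]
  have hnv : ‖v‖ = ‖A‖ := by rw [hv, LinearIsometryEquiv.norm_map]
  set J := areaElt A with hJ
  have hJ1 : 1 ≤ J := one_le_areaElt A
  have hJsq : J ^ 2 = 1 + ‖v‖ ^ 2 := by rw [hnv]; exact Real.sq_sqrt (by positivity)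
  -- Squaring I + c v vᵀ gives I + v vᵀ exactly when 2c + c²‖v‖² = 1; as ‖v‖² = J² - 1, this c is
  -- the positive solution when v ≠ 0.
  set c : ℝ := (J + 1)⁻¹ with hc
  have hcJ : c * (J + 1) = 1 := inv_mul_cancel₀ (by linarith)
  set T : Mom n →ₗ[ℝ] Mom n := LinearMap.transvection (A : Mom n →ₗ[ℝ] ℝ) (c • v) with hT
  have hTx : ∀ x, T x = x + (A x * c) • v := fun x => by
    rw [hT, LinearMap.transvection.apply, smul_smul]; rfl
  have hdet : LinearMap.det T = J := by
    rw [hT, LinearMap.transvection.det]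
    have : (A : Mom n →ₗ[ℝ] ℝ) (c • v) = c * ‖v‖ ^ 2 := by
      change A (c • v) = _
      rw [hA, inner_smul_right, real_inner_self_eq_norm_sq]
    rw [this]
    have : ‖v‖ ^ 2 = (J + 1) * (J - 1) := by linarith
    rw [this, ← mul_assoc, hcJ]; ring
  have hnorm : ∀ x, ‖T x‖ ^ 2 = A x ^ 2 + ‖x‖ ^ 2 := by
    intro x
    rw [hTx, norm_add_sq_real, inner_smul_right, real_inner_comm, ← hA, norm_smul, mul_pow,
      Real.norm_eq_abs, sq_abs]
    have h1 : 2 * c + c ^ 2 * ‖v‖ ^ 2 = 1 := by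
      have : ‖v‖ ^ 2 = (J + 1) * (J - 1) := by linarith
      rw [this]
      have : c ^ 2 * ((J + 1) * (J - 1)) = c * (c * (J + 1)) * (J - 1) := by ring
      rw [this, hcJ]
      linear_combination hcJ
    linear_combination (A x) ^ 2 * h1
  have hdet0 : LinearMap.det T ≠ 0 := by rw [hdet]; linarith
  set e := LinearEquiv.ofIsUnitDet (f := T) (v := Module.finBasis ℝ (Mom n))
    (v' := Module.finBasis ℝ (Mom n)) (by rw [LinearMap.det_toMatrix]; exact hdet0.isUnit) with he
  have heT : ∀ x, e x = T x := fun x => rfl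
  have hgsub : ∀ x y, graphMap A x - graphMap A y = graphMap A (x - y) := by
    intro x y; simp only [graphMap, glue_sub, map_sub]
  have hiso : Isometry (fun x => graphMap A (e.symm x)) := by
    refine Isometry.of_dist_eq fun x y => ?_
    rw [dist_eq_norm, dist_eq_norm, hgsub, ← map_sub]
    have h1 : ‖graphMap A (e.symm (x - y))‖ ^ 2 = ‖x - y‖ ^ 2 := by
      rw [graphMap, norm_glue_sq, ← hnorm, ← heT, LinearEquiv.apply_symm_apply]
    exact (pow_left_inj₀ (norm_nonneg _) (norm_nonneg _) two_ne_zero).1 h1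
  have himg : graphMap A '' S = (fun x => graphMap A (e.symm x)) '' (T '' S) := by
    rw [Set.image_image]
    refine Set.image_congr fun x _ => ?_
    rw [← heT, LinearEquiv.symm_apply_apply]
  rw [himg, hiso.euclideanHausdorffMeasure_image, EuclideanSpace.euclideanHausdorffMeasure_eq_volume,
    Measure.addHaar_image_linearMap, hdet, abs_of_pos (by linarith)]

lemma graphMap_image_comp {n : ℕ} (φ ψ : Mom n → ℝ) (S : Set (Mom n)) :
    graphMap φ '' S = (fun p => graphMap φ (tail p)) '' (graphMap ψ '' S) := by
  rw [Set.image_image]; simp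

/-- Sliding vertically from one graph to the other alters a difference of points by at most δ times
its horizontal part, which is no longer than the difference itself. -/
lemma lipschitzOnWith_graph {n : ℕ} {φ ψ : Mom n → ℝ} {S : Set (Mom n)} {δ : NNReal}
    (h : ∀ x ∈ S, ∀ y ∈ S, |(φ x - φ y) - (ψ x - ψ y)| ≤ δ * ‖x - y‖) :
    LipschitzOnWith (1 + δ) (fun p => graphMap φ (tail p)) (graphMap ψ '' S) := by
  refine LipschitzOnWith.of_dist_le_mul ?_
  rintro _ ⟨x, hx, rfl⟩ _ ⟨y, hy, rfl⟩
  rw [tail_graphMap, tail_graphMap, dist_eq_norm, dist_eq_norm]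
  simp only [graphMap, glue_sub]
  have h1 : ‖x - y‖ ≤ ‖glue (ψ x - ψ y) (x - y)‖ := by
    rw [norm_glue]; exact Real.le_sqrt_of_sq_le (by nlinarith [sq_nonneg (ψ x - ψ y)])
  have h2 : glue (φ x - φ y) (x - y) =
      glue (ψ x - ψ y) (x - y) + (glue ((φ x - φ y)) (x - y) - glue (ψ x - ψ y) (x - y)) := by abel
  rw [h2]
  refine (norm_add_le _ _).trans ?_
  rw [norm_glue_sub_glue]
  have h3 := h x hx y hy
  have h4 : (δ : ℝ) * ‖x - y‖ ≤ δ * ‖glue (ψ x - ψ y) (x - y)‖ := by gcongr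
  push_cast
  linarith

lemma approximatesLinearOn_abs_le {n : ℕ} {φ : Mom n → ℝ} {A : Mom n →L[ℝ] ℝ} {S : Set (Mom n)}
    {δ : NNReal} (h : ApproximatesLinearOn φ A S δ) :
    ∀ x ∈ S, ∀ y ∈ S, |(φ x - φ y) - (A x - A y)| ≤ δ * ‖x - y‖ := by
  intro x hx y hy
  have := h x hx y hy
  rwa [map_sub, Real.norm_eq_abs] at this

/-- The almost everywhere bound `ApproximatesLinearOn.norm_fderiv_sub_le` concerns self-maps of a
space. Multiplying φ by a fixed unit vector turns it into one without changing norms. -/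
lemma norm_fderiv_sub_le_of_approximates {n : ℕ} (hn : n ≠ 0) {φ : Mom n → ℝ}
    {A : Mom n →L[ℝ] ℝ} {S : Set (Mom n)} {δ : NNReal} (h : ApproximatesLinearOn φ A S δ)
    (hS : MeasurableSet S) {φ' : Mom n → Mom n →L[ℝ] ℝ}
    (hφ : ∀ x ∈ S, HasFDerivWithinAt φ (φ' x) S x) :
    ∀ᵐ x ∂(volume.restrict S), ‖φ' x - A‖ ≤ δ := by
  have : NeZero n := ⟨hn⟩
  set e : Mom n := EuclideanSpace.single 0 1
  have he : ‖e‖ = 1 := by simp [e]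
  have h1 : ApproximatesLinearOn (fun x => φ x • e) (A.smulRight e) S δ := by
    intro x hx y hy
    have := h x hx y hy
    rw [ContinuousLinearMap.smulRight_apply, ← sub_smul, ← sub_smul, norm_smul, he, mul_one]
    exact this
  have h2 := h1.norm_fderiv_sub_le volume hS (fun x => (φ' x).smulRight e)
    (fun x hx => (hφ x hx).smul_const e)
  refine h2.mono fun x hx => ?_
  have h3 : (φ' x).smulRight e - A.smulRight e = (φ' x - A).smulRight e := by
    ext y; simp [sub_smul]
  rw [h3] at hx
  have h4 : ‖(φ' x - A).smulRight e‖ ≤ δ := hx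
  rwa [ContinuousLinearMap.norm_smulRight_apply, he, mul_one] at h4

lemma le_of_forall_one_add_pow_mul_le {x y : ENNReal} (m : ℕ)
    (h : ∀ δ : NNReal, 0 < δ → x ≤ (1 + δ : ENNReal) ^ m * y) : x ≤ y := by
  have ht : Tendsto (fun δ : NNReal => (1 + δ : ENNReal) ^ m * y) (𝓝[>] 0) (𝓝 (1 * y)) := by
    refine ENNReal.Tendsto.mul_const ?_ (Or.inl one_ne_zero)
    have : Continuous fun δ : NNReal => (1 + δ : ENNReal) ^ m := by fun_prop
    exact (this.tendsto' 0 1 (by simp)).mono_left nhdsWithin_le_nhds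
  rw [one_mul] at ht
  refine ge_of_tendsto ht ?_
  filter_upwards [self_mem_nhdsWithin] with δ hδ using h δ hδ

/-- Area formula: the surface measure of a graph. -/
theorem euclideanHausdorffMeasure_graph {n : ℕ} (hn : n ≠ 0) {φ : Mom n → ℝ} {S : Set (Mom n)}
    (hS : MeasurableSet S) {φ' : Mom n → Mom n →L[ℝ] ℝ}
    (hφ : ∀ x ∈ S, HasFDerivWithinAt φ (φ' x) S x) :
    (Measure.euclideanHausdorffMeasure n : Measure (Mom (n + 1))) (graphMap φ '' S) =
      ∫⁻ x in S, ENNReal.ofReal (areaElt (φ' x)) := by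
  have hcont : ContinuousOn (graphMap φ) S := by
    have h1 : ContinuousOn (fun y => (φ y, y)) S :=
      (ContinuousOn.prodMk (fun x hx => (hφ x hx).continuousWithinAt) continuousOn_id)
    exact continuous_glue.comp_continuousOn h1
  -- On each piece φ is δ-close to a linear map, and both sides are compared with its graph. The
  -- Lipschitz maps cost (1 + δ)^n and the area element one more factor; summing the pieces and
  -- letting δ → 0 gives equality.
  have piece : ∀ δ : NNReal, 0 < δ → ∃ t : ℕ → Set (Mom n),
      Pairwise (Function.onFun Disjoint t) ∧ (∀ k, MeasurableSet (S ∩ t k)) ∧ S = ⋃ k, S ∩ t k ∧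
      ∀ k, (Measure.euclideanHausdorffMeasure n : Measure (Mom (n + 1))) (graphMap φ '' (S ∩ t k)) ≤
          (1 + δ : ENNReal) ^ (n + 1) * (∫⁻ x in S ∩ t k, ENNReal.ofReal (areaElt (φ' x))) ∧
        (∫⁻ x in S ∩ t k, ENNReal.ofReal (areaElt (φ' x))) ≤ (1 + δ : ENNReal) ^ (n + 1) *
          (Measure.euclideanHausdorffMeasure n : Measure (Mom (n + 1))) (graphMap φ '' (S ∩ t k)) := by
    intro δ hδ
    obtain ⟨t, A, hdis, htm, hcov, happ, -⟩ :=
      exists_partition_approximatesLinearOn_of_hasFDerivWithinAt φ S φ' hφ (fun _ => δ)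
        (fun _ => hδ.ne')
    refine ⟨t, hdis, fun k => hS.inter (htm k), ?_, fun k => ?_⟩
    · rw [← Set.inter_iUnion, Set.inter_eq_left.2 hcov]
    have hm := hS.inter (htm k)
    have hae := norm_fderiv_sub_le_of_approximates hn (happ k) hm
      (fun x hx => (hφ x hx.1).mono Set.inter_subset_left)
    have hab := approximatesLinearOn_abs_le (happ k)
    have hlip1 := euclideanHausdorffMeasure_image_le
      (lipschitzOnWith_graph (φ := φ) (ψ := A k) hab) n
    have hlip2 := euclideanHausdorffMeasure_image_le
      (lipschitzOnWith_graph (φ := A k) (ψ := φ) (fun x hx y hy => by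
        rw [abs_sub_comm]; exact hab x hx y hy)) n
    rw [← graphMap_image_comp, euclideanHausdorffMeasure_graph_linear] at hlip1
    rw [← graphMap_image_comp, euclideanHausdorffMeasure_graph_linear] at hlip2
    push_cast at hlip1 hlip2
    have hδe : ENNReal.ofReal (1 + (δ : ℝ)) = 1 + (δ : ENNReal) := by
      rw [ENNReal.ofReal_add zero_le_one δ.coe_nonneg, ENNReal.ofReal_one, ENNReal.ofReal_coe_nnreal]
    have c1 : ENNReal.ofReal (areaElt (A k)) * volume (S ∩ t k) ≤
        (1 + δ : ENNReal) * ∫⁻ x in S ∩ t k, ENNReal.ofReal (areaElt (φ' x)) := by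
      rw [← setLIntegral_const, ← lintegral_const_mul' _ _ (by simp)]
      refine lintegral_mono_ae (hae.mono fun x hx => ?_)
      rw [← hδe, ← ENNReal.ofReal_mul (by positivity)]
      refine ENNReal.ofReal_le_ofReal (areaElt_le ?_)
      rwa [norm_sub_rev]
    have c2 : (∫⁻ x in S ∩ t k, ENNReal.ofReal (areaElt (φ' x))) ≤
        (1 + δ : ENNReal) * (ENNReal.ofReal (areaElt (A k)) * volume (S ∩ t k)) := by
      rw [← setLIntegral_const, ← lintegral_const_mul' _ _ (by simp)]
      refine lintegral_mono_ae (hae.mono fun x hx => ?_)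
      rw [← hδe, ← ENNReal.ofReal_mul (by positivity)]
      exact ENNReal.ofReal_le_ofReal (areaElt_le hx)
    constructor
    · refine hlip1.trans ((mul_le_mul_right c1 _).trans_eq ?_)
      rw [pow_succ, mul_assoc]
    · refine c2.trans ((mul_le_mul_right hlip2 _).trans_eq ?_)
      rw [pow_succ', mul_assoc]
  have sums : ∀ t : ℕ → Set (Mom n), Pairwise (Function.onFun Disjoint t) →
      (∀ k, MeasurableSet (S ∩ t k)) → S = ⋃ k, S ∩ t k →
      (Measure.euclideanHausdorffMeasure n : Measure (Mom (n + 1))) (graphMap φ '' S) =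
        ∑' k, (Measure.euclideanHausdorffMeasure n : Measure (Mom (n + 1)))
          (graphMap φ '' (S ∩ t k)) ∧
      (∫⁻ x in S, ENNReal.ofReal (areaElt (φ' x))) =
        ∑' k, ∫⁻ x in S ∩ t k, ENNReal.ofReal (areaElt (φ' x)) := by
    intro t hdis hm hcov
    have hdis' : Pairwise (Function.onFun Disjoint fun k => S ∩ t k) := fun i j hij =>
      (hdis hij).mono Set.inter_subset_right Set.inter_subset_right
    constructor
    · conv_lhs => rw [hcov, Set.image_iUnion]
      refine measure_iUnion (fun i j hij => ?_) fun k => ?_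
      · exact (Set.disjoint_image_iff (graphMap_injective φ)).2 (hdis' hij)
      · exact (hm k).image_of_continuousOn_injOn (hcont.mono Set.inter_subset_left)
          (graphMap_injective φ).injOn
    · conv_lhs => rw [hcov]
      exact lintegral_iUnion hm hdis' _
  refine le_antisymm ?_ ?_
  · refine le_of_forall_one_add_pow_mul_le (n + 1) fun δ hδ => ?_
    obtain ⟨t, hdis, hm, hcov, hle⟩ := piece δ hδ
    obtain ⟨h1, h2⟩ := sums t hdis hm hcov
    rw [h1, h2, ← ENNReal.tsum_mul_left]
    exact ENNReal.tsum_le_tsum fun k => (hle k).1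
  · refine le_of_forall_one_add_pow_mul_le (n + 1) fun δ hδ => ?_
    obtain ⟨t, hdis, hm, hcov, hle⟩ := piece δ hδ
    obtain ⟨h1, h2⟩ := sums t hdis hm hcov
    rw [h1, h2, ← ENNReal.tsum_mul_left]
    exact ENNReal.tsum_le_tsum fun k => (hle k).2

/-! ### The surface measure of the energy shells -/

/-- The gradient of the dispersion relation. -/
def gradDisp {d : ℕ} (p : Mom d) : Mom d :=
  WithLp.toLp 2 (fun i => 2 * Real.pi * Real.sin (2 * Real.pi * p i))

lemma continuous_gradDisp {d : ℕ} : Continuous (gradDisp (d := d)) :=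
  (PiLp.continuous_toLp 2 _).comp (by fun_prop)

lemma inner_gradDisp {d : ℕ} (p r : Mom d) :
    inner ℝ (gradDisp p) r = ∑ i, 2 * Real.pi * Real.sin (2 * Real.pi * p i) * r i := by
  simp only [PiLp.inner_apply, gradDisp, RCLike.inner_apply, conj_trivial]
  exact Finset.sum_congr rfl fun i _ => mul_comm _ _

lemma hasGradientAt_disp {d : ℕ} (p : Mom d) : HasGradientAt (disp (d := d)) (gradDisp p) p := by
  rw [hasGradientAt_iff_hasFDerivAt]
  have h1 : ∀ i : Fin d, HasFDerivAt (fun p : Mom d => 1 - Real.cos (2 * Real.pi * p i))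
      ((2 * Real.pi * Real.sin (2 * Real.pi * p i)) • (EuclideanSpace.proj i : Mom d →L[ℝ] ℝ))
      p := by
    intro i
    have h2 : HasFDerivAt (fun p : Mom d => p i) (EuclideanSpace.proj i : Mom d →L[ℝ] ℝ) p :=
      (EuclideanSpace.proj i : Mom d →L[ℝ] ℝ).hasFDerivAt
    refine ((h2.const_mul (2 * Real.pi)).cos.const_sub 1).congr_fderiv ?_
    ext v; simp; ring
  refine (HasFDerivAt.fun_sum fun i _ => h1 i).congr_fderiv ?_
  ext v
  rw [InnerProductSpace.toDual_apply_apply, inner_gradDisp]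
  simp

lemma gradient_disp {d : ℕ} (p : Mom d) : gradient (disp (d := d)) p = gradDisp p :=
  (hasGradientAt_disp p).gradient

lemma gradDisp_glue {n : ℕ} (x : ℝ) (y : Mom n) :
    gradDisp (glue x y) = glue (2 * Real.pi * Real.sin (2 * Real.pi * x)) (gradDisp y) := by
  ext i; refine Fin.cases ?_ (fun j => ?_) i <;> simp [gradDisp]

/-- The set of last coordinates above which the energy shell has two nondegenerate branches. -/
def base (n : ℕ) (a : ℝ) : Set (Mom n) := {y | y ∈ cell n ∧ a - disp y ∈ Set.Ioo (0 : ℝ) 2}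

lemma measurableSet_base (n : ℕ) (a : ℝ) : MeasurableSet (base n a) :=
  (measurableSet_cell n).inter
    ((continuous_const.sub continuous_disp).measurable measurableSet_Ioo)

lemma hasFDerivAt_branch {n : ℕ} {a : ℝ} {y : Mom n} (hy : y ∈ base n a) :
    HasFDerivAt (fun y => arcAngle (a - disp y))
      ((-arcDensity (a - disp y)) • innerSL ℝ (gradDisp y)) y := by
  have h1 := (hasGradientAt_iff_hasFDerivAt.1 (hasGradientAt_disp y)).const_sub a
  refine ((hasDerivAt_arcAngle hy.2).comp_hasFDerivAt y h1).congr_fderiv ?_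
  ext v; simp

/-- The area element of the branches of the energy shell. -/
def shellArea {n : ℕ} (a : ℝ) (y : Mom n) : ℝ :=
  Real.sqrt (1 + (arcDensity (a - disp y) * ‖gradDisp y‖) ^ 2)

lemma shellArea_nonneg {n : ℕ} (a : ℝ) (y : Mom n) : 0 ≤ shellArea a y := Real.sqrt_nonneg _

lemma measurable_shellArea {n : ℕ} (a : ℝ) : Measurable (shellArea (n := n) a) := by
  unfold shellArea
  have h1 := measurable_arcDensity_disp (n := n) a
  have h2 := (continuous_gradDisp (d := n)).norm.measurable
  fun_prop

lemma areaElt_branch {n : ℕ} (a : ℝ) (y : Mom n) :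
    areaElt ((-arcDensity (a - disp y)) • innerSL ℝ (gradDisp y)) = shellArea a y := by
  rw [areaElt, shellArea, norm_smul, innerSL_apply_norm, norm_neg,
    Real.norm_of_nonneg (arcDensity_nonneg _)]

lemma areaElt_branch_neg {n : ℕ} (a : ℝ) (y : Mom n) :
    areaElt (-((-arcDensity (a - disp y)) • innerSL ℝ (gradDisp y))) = shellArea a y := by
  rw [← areaElt_branch, areaElt, areaElt, norm_neg]

/-- The area formula is applied to the part of S that the graph map sends into an arbitrary Borel
set. -/
lemma restrict_graph {n : ℕ} (hn : n ≠ 0) {φ : Mom n → ℝ} {S : Set (Mom n)}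
    (hS : MeasurableSet S) {φ' : Mom n → Mom n →L[ℝ] ℝ}
    (hφ : ∀ x ∈ S, HasFDerivWithinAt φ (φ' x) S x) (hm : Measurable (graphMap φ))
    {J : Mom n → ℝ} (hJ : ∀ x, areaElt (φ' x) = J x) :
    (Measure.euclideanHausdorffMeasure n : Measure (Mom (n + 1))).restrict (graphMap φ '' S) =
      ((volume.restrict S).withDensity fun x => ENNReal.ofReal (J x)).map (graphMap φ) := by
  ext B hB
  have h1 : B ∩ graphMap φ '' S = graphMap φ '' (S ∩ graphMap φ ⁻¹' B) := by
    rw [Set.inter_comm, Set.image_inter_preimage]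
  have h2 : MeasurableSet (graphMap φ ⁻¹' B) := hm hB
  rw [Measure.restrict_apply hB, Measure.map_apply hm hB, h1, withDensity_apply _ h2,
    Measure.restrict_restrict h2, Set.inter_comm,
    euclideanHausdorffMeasure_graph hn (h2.inter hS) fun x hx =>
      (hφ x hx.2).mono Set.inter_subset_right]
  simp_rw [hJ]

/-- With the other coordinates fixed, the energy of the first must take one value, which its
absolutely continuous law does not charge. -/
lemma volume_level_eq_zero (m : ℕ) (b : ℝ) : volume {y | y ∈ cell (m + 1) ∧ disp y = b} = 0 := by
  have hm : MeasurableSet {y : Mom (m + 1) | disp y = b} :=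
    continuous_disp.measurable (measurableSet_singleton b)
  have e : {y | y ∈ cell (m + 1) ∧ disp y = b} = {y : Mom (m + 1) | disp y = b} ∩ cell (m + 1) := by
    ext y; exact and_comm
  have hφ : Measurable (Set.indicator {b} (1 : ℝ → ENNReal)) :=
    measurable_one.indicator (measurableSet_singleton b)
  rw [e, ← Measure.restrict_apply hm, ← lintegral_indicator_one hm]
  have e2 : ∀ y : Mom (m + 1), Set.indicator {y : Mom (m + 1) | disp y = b} (1 : Mom (m + 1) → ENNReal) y =
      Set.indicator {b} (1 : ℝ → ENNReal) (disp y) := fun y => by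
    simp [Set.indicator_apply]
  simp_rw [e2]
  rw [lintegral_cell_succ (Φ := fun p => Set.indicator {b} (1 : ℝ → ENNReal) (disp p))
    (hφ.comp continuous_disp.measurable)]
  refine (lintegral_congr fun y => ?_).trans lintegral_zero
  simp_rw [disp_glue]
  rw [lintegral_circle_cos (φ := fun t => Set.indicator {b} (1 : ℝ → ENNReal) (t + disp y))
    (hφ.comp (by fun_prop))]
  refine mul_eq_zero_of_right _ ?_
  refine (lintegral_congr_ae (g := fun _ => 0) ?_).trans lintegral_zero
  have : ∀ᵐ t : ℝ, t ∉ ({b - disp y} : Set ℝ) :=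
    measure_eq_zero_iff_ae_notMem.1 (measure_singleton (b - disp y))
  filter_upwards [this] with t ht
  have h1 : t + disp y ∉ ({b} : Set ℝ) := fun h => ht (by
    simp only [Set.mem_singleton_iff] at h ⊢; linarith)
  simp [Set.indicator_of_notMem h1]

lemma euclideanHausdorffMeasure_const_graph {n : ℕ} (hn : n ≠ 0) (c : ℝ) {S : Set (Mom n)}
    (hS : MeasurableSet S) (h0 : volume S = 0) :
    (Measure.euclideanHausdorffMeasure n : Measure (Mom (n + 1))) (graphMap (fun _ => c) '' S) = 0 := by
  rw [euclideanHausdorffMeasure_graph hn hS (φ' := fun _ => 0)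
    (fun x _ => hasFDerivWithinAt_const c x S)]
  exact setLIntegral_measure_zero _ _ h0

lemma measurableSet_level (n : ℕ) (b : ℝ) : MeasurableSet {y | y ∈ cell n ∧ disp y = b} :=
  (measurableSet_cell n).inter (continuous_disp.measurable (measurableSet_singleton b))

/-- The branches meet where the first coordinate is critical, at 0 or -1/2; the point 1/2 is not in
the half-open cell. The exceptional part lies in two flat slices over level sets of dimension one
lower, which are null when n ≠ 0. -/
lemma shell_eq_union (n : ℕ) (a : ℝ) : ∃ Z : Set (Mom (n + 1)),
    shell (n + 1) a = (upper a '' base n a ∪ lower a '' base n a) ∪ Z ∧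
    Z ⊆ graphMap (fun _ => 0) '' {y | y ∈ cell n ∧ disp y = a} ∪
      graphMap (fun _ => -(1 / 2)) '' {y | y ∈ cell n ∧ disp y = a - 2} := by
  refine ⟨{p | p ∈ shell (n + 1) a ∧ (p 0 = 0 ∨ p 0 = -(1 / 2))}, ?_, ?_⟩
  · ext p
    obtain ⟨⟨x, y⟩, rfl⟩ := (glueEquiv n).surjective p
    simp only [glueEquiv_apply]
    constructor
    · intro hp
      by_cases h0 : x = 0 ∨ x = -(1 / 2)
      · exact Or.inr ⟨hp, h0⟩
      · left
        push Not at h0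
        obtain ⟨hx, hy⟩ := glue_mem_cell.1 hp.1
        have hd : a - disp y = 1 - Real.cos (2 * Real.pi * x) := by
          have := hp.2; rw [disp_glue] at this; linarith
        have hmem : ∀ x : ℝ, x ∈ Set.Ioo (0 : ℝ) (1 / 2) →
            1 - Real.cos (2 * Real.pi * x) ∈ Set.Ioo (0 : ℝ) 2 := by
          intro x hx
          rw [← image_arcAngle] at hx
          obtain ⟨t, ht, rfl⟩ := hx
          rwa [one_sub_cos_arcAngle ⟨ht.1.le, ht.2.le⟩]
        rcases lt_or_gt_of_ne h0.1 with h | h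
        · right
          have hx' : -x ∈ Set.Ioo (0 : ℝ) (1 / 2) :=
            ⟨by linarith, by have := lt_of_le_of_ne hx.1 (Ne.symm h0.2); linarith⟩
          have hc : Real.cos (2 * Real.pi * x) = Real.cos (2 * Real.pi * -x) := by
            rw [mul_neg, Real.cos_neg]
          refine ⟨y, ⟨hy, by rw [hd, hc]; exact hmem _ hx'⟩, ?_⟩
          rw [lower, hd, hc, arcAngle_one_sub_cos ⟨hx'.1.le, hx'.2.le⟩, neg_neg]
        · left
          have hx' : x ∈ Set.Ioo (0 : ℝ) (1 / 2) := ⟨h, hx.2⟩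
          refine ⟨y, ⟨hy, by rw [hd]; exact hmem _ hx'⟩, ?_⟩
          rw [upper, hd, arcAngle_one_sub_cos ⟨hx'.1.le, hx'.2.le⟩]
    · rintro ((⟨y', hy', h⟩ | ⟨y', hy', h⟩) | h)
      · rw [← h]
        have := arcAngle_mem_Ioo hy'.2
        exact ⟨glue_mem_cell.2 ⟨⟨by linarith [this.1], this.2⟩, hy'.1⟩, disp_upper hy'.2⟩
      · rw [← h]
        have := arcAngle_mem_Ioo hy'.2
        exact ⟨glue_mem_cell.2 ⟨⟨by linarith [this.2], by linarith [this.1]⟩, hy'.1⟩,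
          disp_lower hy'.2⟩
      · exact h.1
  · rintro p ⟨hp, h0⟩
    obtain ⟨⟨x, y⟩, rfl⟩ := (glueEquiv n).surjective p
    simp only [glueEquiv_apply, glue_zero] at hp h0 ⊢
    have hy := (glue_mem_cell.1 hp.1).2
    have hd := hp.2
    rw [disp_glue] at hd
    rcases h0 with rfl | rfl
    · left; exact ⟨y, ⟨hy, by simpa using hd⟩, rfl⟩
    · right
      have : 2 * Real.pi * (-(1 / 2)) = -Real.pi := by ring
      rw [this, Real.cos_neg, Real.cos_pi] at hd
      exact ⟨y, ⟨hy, by linarith⟩, rfl⟩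

/-- The surface measure of an energy shell in coordinates. -/
lemma shellMeasure_eq {n : ℕ} (hn : n ≠ 0) (a : ℝ) : shellMeasure (n + 1) a =
    ((volume.restrict (base n a)).withDensity fun y => ENNReal.ofReal (shellArea a y)).map (upper a) +
    ((volume.restrict (base n a)).withDensity fun y => ENNReal.ofReal (shellArea a y)).map
      (lower a) := by
  have hv : ∀ b, volume {y : Mom n | y ∈ cell n ∧ disp y = b} = 0 := fun b => by
    obtain ⟨m, rfl⟩ := Nat.exists_eq_succ_of_ne_zero hn
    exact volume_level_eq_zero m b
  obtain ⟨Z, hZ, hZsub⟩ := shell_eq_union n a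
  have hZ0 : (Measure.euclideanHausdorffMeasure n : Measure (Mom (n + 1))) Z = 0 := by
    refine measure_mono_null hZsub (measure_union_null ?_ ?_)
    · exact euclideanHausdorffMeasure_const_graph hn 0 (measurableSet_level n a)
        (hv a)
    · exact euclideanHausdorffMeasure_const_graph hn _ (measurableSet_level n (a - 2))
        (hv (a - 2))
  have hlower : lower a = graphMap (fun y : Mom n => -arcAngle (a - disp y)) := rfl
  have hupper : upper a = graphMap (fun y : Mom n => arcAngle (a - disp y)) := rfl
  have hmL : MeasurableSet (lower a '' base n a) := by
    refine (measurableSet_base n a).image_of_continuousOn_injOn ?_ ?_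
    · exact (continuous_lower.comp (Continuous.prodMk_right a)).continuousOn
    · rw [hlower]; exact (graphMap_injective _).injOn
  have hdisj : Disjoint (upper a '' base n a) (lower a '' base n a) := by
    rw [Set.disjoint_left]
    rintro _ ⟨y, hy, rfl⟩ ⟨y', hy', h⟩
    have h1 := arcAngle_mem_Ioo hy.2
    have h2 := arcAngle_mem_Ioo hy'.2
    have h3 := congrArg (fun p : Mom (n + 1) => p 0) h
    simp only [lower, upper, glue_zero] at h3
    linarith [h1.1, h2.1]
  have hae : (shell (n + 1) a : Set (Mom (n + 1))) =ᵐ[Measure.euclideanHausdorffMeasure n]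
      (upper a '' base n a ∪ lower a '' base n a : Set (Mom (n + 1))) := by
    rw [hZ]
    exact union_ae_eq_left_of_ae_eq_empty (ae_eq_empty.2 hZ0)
  have hmu : Measurable (graphMap (fun y : Mom n => arcAngle (a - disp y))) := measurable_upper a
  have hml : Measurable (graphMap (fun y : Mom n => -arcAngle (a - disp y))) := measurable_lower a
  unfold shellMeasure
  rw [Nat.add_sub_cancel, Measure.restrict_congr_set hae, Measure.restrict_union hdisj hmL,
    hupper, hlower,
    restrict_graph hn (measurableSet_base n a)
      (fun y hy => (hasFDerivAt_branch hy).hasFDerivWithinAt) hmu (areaElt_branch a),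
    restrict_graph (φ := fun y => -arcAngle (a - disp y)) hn (measurableSet_base n a)
      (fun y hy => (hasFDerivAt_branch hy).neg.hasFDerivWithinAt) hml (areaElt_branch_neg a)]

/-- If q = 1/g is the size of the first partial derivative of e, then ‖∇e‖ = √(q² + ‖∇e(y)‖²), which
is q times the area element. -/
lemma shellArea_div_norm_gradDisp {n : ℕ} {a : ℝ} {y : Mom n} (hy : y ∈ base n a)
    {x : ℝ} (hx : x = arcAngle (a - disp y) ∨ x = -arcAngle (a - disp y)) :
    shellArea a y / ‖gradDisp (glue x y)‖ = arcDensity (a - disp y) := by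
  set t := a - disp y with ht
  have hP : 0 < t * (2 - t) := mul_pos hy.2.1 (by linarith [hy.2.2])
  have hs : (2 * Real.pi * Real.sin (2 * Real.pi * x)) ^ 2 =
      (2 * Real.pi * Real.sqrt (t * (2 - t))) ^ 2 := by
    rcases hx with rfl | rfl
    · rw [sin_arcAngle]
    · rw [mul_neg, Real.sin_neg, sin_arcAngle]; ring
  have hq : 0 < 2 * Real.pi * Real.sqrt (t * (2 - t)) := by
    have := Real.sqrt_pos.2 hP; positivity
  have hg : arcDensity t = (2 * Real.pi * Real.sqrt (t * (2 - t)))⁻¹ := rfl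
  rw [gradDisp_glue, norm_glue, hs, shellArea, ← ht, hg]
  set q := 2 * Real.pi * Real.sqrt (t * (2 - t))
  have h1 : 1 + (q⁻¹ * ‖gradDisp y‖) ^ 2 = (q⁻¹) ^ 2 * (q ^ 2 + ‖gradDisp y‖ ^ 2) := by
    field_simp
  have h2 : 0 < Real.sqrt (q ^ 2 + ‖gradDisp y‖ ^ 2) := Real.sqrt_pos.2 (by positivity)
  rw [h1, Real.sqrt_mul (by positivity), Real.sqrt_sq (by positivity), mul_div_assoc,
    div_self h2.ne', mul_one]

lemma integrableOn_arcDensity_mul {n : ℕ} (hn : 2 ≤ n) {ψ : Mom n → ℂ} (hm : Measurable ψ) {N : ℝ}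
    (hN : ∀ y ∈ cell n, ‖ψ y‖ ≤ N) (a : ℝ) :
    IntegrableOn (fun y : Mom n => (arcDensity (a - disp y) : ℂ) * ψ y) (cell n) := by
  obtain ⟨K, hK, hi⟩ := integrable_arcDensity hn
  refine ((hi a).1.mul_const N).mono'
    ((Complex.measurable_ofReal.comp (measurable_arcDensity_disp a)).mul hm).aestronglyMeasurable ?_
  refine (ae_restrict_mem (measurableSet_cell n)).mono fun y hy => ?_
  rw [norm_mul, Complex.norm_real, Real.norm_of_nonneg (arcDensity_nonneg _)]
  exact mul_le_mul_of_nonneg_left (hN y hy) (arcDensity_nonneg _)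

lemma branch_integral {n : ℕ} (hn : 2 ≤ n) {h : Mom (n + 1) → ℂ} (hm : Measurable h) {N : ℝ}
    (hN : ∀ p ∈ box (n + 1), ‖h p‖ ≤ N) (a : ℝ) {br : Mom n → Mom (n + 1)} (hbr : Measurable br)
    (hbox : ∀ y ∈ cell n, br y ∈ box (n + 1))
    (hx : ∀ y, br y = glue (arcAngle (a - disp y)) y ∨ br y = glue (-arcAngle (a - disp y)) y) :
    Integrable (shellDensity h) (((volume.restrict (base n a)).withDensity
        fun y => ENNReal.ofReal (shellArea a y)).map br) ∧
      ∫ p, shellDensity h p ∂(((volume.restrict (base n a)).withDensity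
        fun y => ENNReal.ofReal (shellArea a y)).map br) =
      ∫ y in cell n, (arcDensity (a - disp y) : ℂ) * h (br y) := by
  have hsd : Measurable (shellDensity h) := by
    have : shellDensity h = fun q => h q / ((‖gradDisp q‖ : ℝ) : ℂ) := by
      funext q; rw [shellDensity, gradient_disp]
    rw [this]
    exact hm.div (Complex.measurable_ofReal.comp continuous_gradDisp.norm.measurable)
  have hint := integrableOn_arcDensity_mul hn (hm.comp hbr) (N := N)
    (fun y hy => hN _ (hbox y hy)) a
  have hsub : base n a ⊆ cell n := fun y hy => hy.1
  have hpt : ∀ y ∈ base n a, (ENNReal.ofReal (shellArea a y)).toReal • shellDensity h (br y) =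
      (arcDensity (a - disp y) : ℂ) * h (br y) := by
    intro y hy
    rw [ENNReal.toReal_ofReal (shellArea_nonneg a y), shellDensity, gradient_disp, Complex.real_smul]
    have : shellArea a y / ‖gradDisp (br y)‖ = arcDensity (a - disp y) := by
      rcases hx y with h' | h' <;> rw [h']
      · exact shellArea_div_norm_gradDisp hy (Or.inl rfl)
      · exact shellArea_div_norm_gradDisp hy (Or.inr rfl)
    rw [← this]; push_cast; ring
  constructor
  · rw [integrable_map_measure hsd.aestronglyMeasurable hbr.aemeasurable,
      integrable_withDensity_iff_integrable_smul' (measurable_shellArea a).ennreal_ofReal (by simp)]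
    exact (hint.mono_set hsub).congr_fun (fun y hy => (hpt y hy).symm) (measurableSet_base n a)
  · rw [integral_map hbr.aemeasurable hsd.aestronglyMeasurable,
      integral_withDensity_eq_integral_toReal_smul (measurable_shellArea a).ennreal_ofReal (by simp),
      setIntegral_congr_fun (measurableSet_base n a) hpt]
    -- Off the base the density is zero, so the integral extends to the whole cell.
    refine (setIntegral_eq_of_subset_of_forall_sdiff_eq_zero (measurableSet_cell n) hsub ?_).symm
    intro y hy
    have : a - disp y ∉ Set.Ioo (0 : ℝ) 2 := fun h => hy.2 ⟨hy.1, h⟩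
    rw [arcDensity_of_notMem this]; simp

/-- Energy shell integrals in coordinates. -/
theorem deltaIntegral_eq_shellInt {n : ℕ} (hn : 2 ≤ n) {h : Mom (n + 1) → ℂ} (hm : Measurable h)
    {N : ℝ} (hN : ∀ p ∈ box (n + 1), ‖h p‖ ≤ N) (a : ℝ) :
    Integrable (shellDensity h) (shellMeasure (n + 1) a) ∧ deltaIntegral h a = shellInt h a := by
  obtain ⟨iu, eu⟩ := branch_integral hn hm hN a (measurable_upper a)
    (fun y hy => upper_mem_box a hy) (fun y => Or.inl rfl)
  obtain ⟨il, el⟩ := branch_integral hn hm hN a (measurable_lower a)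
    (fun y hy => lower_mem_box a hy) (fun y => Or.inr rfl)
  rw [deltaIntegral, shellMeasure_eq (by omega)]
  refine ⟨iu.add_measure il, ?_⟩
  rw [integral_add_measure iu il, eu, el, shellInt, ← integral_add]
  · simp only [mul_add]
  · exact integrableOn_arcDensity_mul hn (hm.comp (measurable_upper a))
      (fun y hy => hN _ (upper_mem_box a hy)) a
  · exact integrableOn_arcDensity_mul hn (hm.comp (measurable_lower a))
      (fun y hy => hN _ (lower_mem_box a hy)) a

/-! ### Taylor estimates for the dispersion relation -/

lemma abs_cos_add_sub_le (θ h : ℝ) : |Real.cos (θ + h) - Real.cos θ + h * Real.sin θ| ≤ h ^ 2 := by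
  set f : ℝ → ℝ := fun t => Real.cos (θ + t) + t * Real.sin θ with hf
  have hd : ∀ t : ℝ, HasDerivAt f (-Real.sin (θ + t) + Real.sin θ) t := by
    intro t
    have h1 := ((hasDerivAt_id t).const_add θ).cos
    have h2 := (hasDerivAt_id t).mul_const (Real.sin θ)
    refine (h1.add h2).congr_deriv ?_
    simp
  have hb : ∀ t ∈ Set.uIcc 0 h, ‖-Real.sin (θ + t) + Real.sin θ‖ ≤ |h| := by
    intro t ht
    have h3 : |t| ≤ |h| := by
      have := Set.abs_sub_left_of_mem_uIcc ht
      simpa using this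
    refine le_trans ?_ h3
    have := Real.abs_sin_sub_sin_le θ (θ + t)
    rw [Real.norm_eq_abs, neg_add_eq_sub]
    refine this.trans ?_
    simp
  have := (convex_uIcc 0 h).norm_image_sub_le_of_norm_hasDerivWithin_le
    (fun t _ => (hd t).hasDerivWithinAt) hb Set.left_mem_uIcc Set.right_mem_uIcc
  simp only [hf, add_zero, zero_mul, sub_zero, Real.norm_eq_abs] at this
  rw [abs_mul_abs_self] at this
  calc _ = |Real.cos (θ + h) + h * Real.sin θ - Real.cos θ| := by congr 1; ring
    _ ≤ _ := by rw [sq]; exact this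

lemma abs_apply_le {d : ℕ} (r : Mom d) (i : Fin d) : |r i| ≤ ‖r‖ := by
  have := PiLp.norm_apply_le (p := 2) r i
  rwa [Real.norm_eq_abs] at this

lemma abs_sum_le_card {d : ℕ} {u : Fin d → ℝ} {c : ℝ} (h : ∀ i, |u i| ≤ c) :
    |∑ i, u i| ≤ d * c := by
  refine (Finset.abs_sum_le_sum_abs _ _).trans ((Finset.sum_le_sum fun i _ => h i).trans ?_)
  simp

/-- The crude constant d(2π)² is shared by all the following estimates on e, so that a single c
serves them in `exists_constants`. -/
lemma abs_inner_gradDisp_le {d : ℕ} (p r : Mom d) :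
    |inner ℝ (gradDisp p) r| ≤ d * (2 * Real.pi) ^ 2 * ‖r‖ := by
  rw [inner_gradDisp, mul_assoc]
  refine abs_sum_le_card fun i => ?_
  have h1 := Real.abs_sin_le_one (2 * Real.pi * p i)
  have h2 := abs_apply_le r i
  have h3 : (1 : ℝ) ≤ 2 * Real.pi := by linarith [Real.pi_gt_three]
  rw [abs_mul, abs_mul, abs_of_pos Real.two_pi_pos]
  calc 2 * Real.pi * |Real.sin (2 * Real.pi * p i)| * |r i| ≤ 2 * Real.pi * 1 * ‖r‖ := by gcongr
    _ ≤ (2 * Real.pi) ^ 2 * ‖r‖ := by gcongr; nlinarith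

lemma abs_inner_gradDisp_sub_le {d : ℕ} (p q r : Mom d) :
    |inner ℝ (gradDisp p) r - inner ℝ (gradDisp q) r| ≤
      d * (2 * Real.pi) ^ 2 * (‖p - q‖ * ‖r‖) := by
  rw [inner_gradDisp, inner_gradDisp, ← Finset.sum_sub_distrib, mul_assoc]
  refine abs_sum_le_card fun i => ?_
  have h2 := abs_apply_le r i
  have h3 := abs_apply_le (p - q) i
  have h4 := Real.abs_sin_sub_sin_le (2 * Real.pi * p i) (2 * Real.pi * q i)
  rw [← mul_sub, abs_mul, abs_of_pos Real.two_pi_pos] at h4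
  have e : 2 * Real.pi * Real.sin (2 * Real.pi * p i) * r i -
      2 * Real.pi * Real.sin (2 * Real.pi * q i) * r i =
      2 * Real.pi * (Real.sin (2 * Real.pi * p i) - Real.sin (2 * Real.pi * q i)) * r i := by ring
  rw [e, abs_mul, abs_mul, abs_of_pos Real.two_pi_pos]
  have h5 : |p i - q i| ≤ ‖p - q‖ := by simpa using h3
  calc _ ≤ 2 * Real.pi * (2 * Real.pi * ‖p - q‖) * ‖r‖ := by
        gcongr; exact h4.trans (by gcongr)
    _ = _ := by ring

lemma abs_disp_add_sub_le {d : ℕ} (p r : Mom d) :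
    |disp (p + r) - disp p| ≤ d * (2 * Real.pi) ^ 2 * ‖r‖ := by
  rw [disp, disp, ← Finset.sum_sub_distrib, mul_assoc]
  refine abs_sum_le_card fun i => ?_
  have h2 := abs_apply_le r i
  have h3 : (1 : ℝ) ≤ 2 * Real.pi := by linarith [Real.pi_gt_three]
  have h4 := Real.abs_cos_sub_cos_le (2 * Real.pi * p i) (2 * Real.pi * (p i + r i))
  have e : 1 - Real.cos (2 * Real.pi * (p + r) i) - (1 - Real.cos (2 * Real.pi * p i)) =
      Real.cos (2 * Real.pi * p i) - Real.cos (2 * Real.pi * (p i + r i)) := by simp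
  rw [e]
  refine h4.trans ?_
  have e2 : 2 * Real.pi * p i - 2 * Real.pi * (p i + r i) = -(2 * Real.pi * r i) := by ring
  rw [e2, abs_neg, abs_mul, abs_of_pos Real.two_pi_pos]
  calc 2 * Real.pi * |r i| ≤ 2 * Real.pi * ‖r‖ := by gcongr
    _ ≤ (2 * Real.pi) ^ 2 * ‖r‖ := by gcongr; nlinarith

lemma abs_disp_add_sub_sub_le {d : ℕ} (p r : Mom d) :
    |disp (p + r) - disp p - inner ℝ (gradDisp p) r| ≤ d * (2 * Real.pi) ^ 2 * ‖r‖ ^ 2 := by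
  rw [disp, disp, inner_gradDisp, ← Finset.sum_sub_distrib, ← Finset.sum_sub_distrib, mul_assoc]
  refine abs_sum_le_card fun i => ?_
  have h2 := abs_apply_le r i
  have h4 := abs_cos_add_sub_le (2 * Real.pi * p i) (2 * Real.pi * r i)
  have e : 1 - Real.cos (2 * Real.pi * (p + r) i) - (1 - Real.cos (2 * Real.pi * p i)) -
      2 * Real.pi * Real.sin (2 * Real.pi * p i) * r i =
      -(Real.cos (2 * Real.pi * p i + 2 * Real.pi * r i) - Real.cos (2 * Real.pi * p i) +
        2 * Real.pi * r i * Real.sin (2 * Real.pi * p i)) := by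
    rw [PiLp.add_apply, mul_add]; ring
  rw [e, abs_neg]
  refine h4.trans ?_
  rw [mul_pow, ← sq_abs (r i)]
  gcongr

/-! ### Resolvent estimates -/

/-- If x ≤ y, the numerator is at most 2y^(3/8) and y^(-5/8) ≤ x^(-5/8). Weights centred at two
energies are thereby separated, which makes the bounds uniform in α and β. -/
lemma rpow_add_div_mul_le {x y : ℝ} (hx : 0 < x) (hy : 0 < y) :
    (x + y) ^ (3 / 8 : ℝ) * (x * y)⁻¹ ≤ 2 * (x ^ (-(13 / 8) : ℝ) + y ^ (-(13 / 8) : ℝ)) := by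
  wlog hxy : x ≤ y generalizing x y
  · have := this hy hx (le_of_not_ge hxy)
    rw [add_comm x y, mul_comm x y]; linarith
  have e : x ^ (-(13 / 8) : ℝ) = x ^ (-(5 / 8) : ℝ) * x⁻¹ := by
    rw [← Real.rpow_neg_one x, ← Real.rpow_add hx]; norm_num
  have e2 : y ^ (3 / 8 : ℝ) * y⁻¹ = y ^ (-(5 / 8) : ℝ) := by
    rw [← Real.rpow_neg_one y, ← Real.rpow_add hy]; norm_num
  have h1 : (x + y) ^ (3 / 8 : ℝ) ≤ 2 * y ^ (3 / 8 : ℝ) := by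
    calc (x + y) ^ (3 / 8 : ℝ) ≤ (2 * y) ^ (3 / 8 : ℝ) := by gcongr; linarith
      _ = 2 ^ (3 / 8 : ℝ) * y ^ (3 / 8 : ℝ) := Real.mul_rpow (by norm_num) hy.le
      _ ≤ 2 * y ^ (3 / 8 : ℝ) := by
          gcongr
          conv_rhs => rw [← Real.rpow_one 2]
          exact Real.rpow_le_rpow_of_exponent_le (by norm_num) (by norm_num)
  have h2 : y ^ (-(5 / 8) : ℝ) ≤ x ^ (-(5 / 8) : ℝ) :=
    Real.rpow_le_rpow_of_nonpos hx hxy (by norm_num)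
  have h3 : 0 ≤ y ^ (-(13 / 8) : ℝ) := by positivity
  calc (x + y) ^ (3 / 8 : ℝ) * (x * y)⁻¹ ≤ 2 * y ^ (3 / 8 : ℝ) * (x * y)⁻¹ := by gcongr
    _ = 2 * (y ^ (3 / 8 : ℝ) * y⁻¹) * x⁻¹ := by rw [mul_inv]; ring
    _ ≤ 2 * x ^ (-(5 / 8) : ℝ) * x⁻¹ := by rw [e2]; gcongr
    _ = 2 * x ^ (-(13 / 8) : ℝ) := by rw [e]; ring
    _ ≤ _ := by linarith

/-- The real part controls |x| up to an error cℓ, and ℓρ is controlled by the imaginary part;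
multiplying the former by ρ ≤ 1 lets them be added. -/
lemma norm_lower_bound {A : ℂ} {x c ℓ ρ : ℝ} (hc : 0 ≤ c) (hρ : 0 < ρ) (hρ1 : ρ ≤ 1)
    (him : ℓ * ρ ≤ |A.im|) (hre : |x| - c * ℓ ≤ |A.re|) :
    ρ / (c + 2) * (|x| + ℓ) ≤ ‖A‖ := by
  have h1 := him.trans (Complex.abs_im_le_norm A)
  have h2 := hre.trans (Complex.abs_re_le_norm A)
  rw [div_mul_eq_mul_div, div_le_iff₀ (by positivity)]
  have h3 : ρ * (|x| + ℓ) ≤ ρ * ‖A‖ + (c + 1) * (ℓ * ρ) := by nlinarith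
  nlinarith [norm_nonneg A]

/-- Telescoping changes one factor at a time and leaves three reciprocals in each term. This is the
source of ρ^(-3) in the final bound. -/
lemma norm_inv_mul_sub_le {A A' B B' : ℂ} {c x y D : ℝ} (hc : 0 < c) (hx : 0 < x) (hy : 0 < y)
    (hA : c * x ≤ ‖A‖) (hA' : c * x ≤ ‖A'‖) (hB : c * y ≤ ‖B‖) (hB' : c * y ≤ ‖B'‖)
    (hAA : ‖A - A'‖ ≤ D) (hBB : ‖B - B'‖ ≤ D) :
    ‖1 / (A * B) - 1 / (A' * B')‖ ≤ D * (c ^ 3)⁻¹ * ((x⁻¹ + y⁻¹) * (x * y)⁻¹) := by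
  have hcx : 0 < c * x := by positivity
  have hcy : 0 < c * y := by positivity
  have nA : A ≠ 0 := norm_pos_iff.1 (hcx.trans_le hA)
  have nA' : A' ≠ 0 := norm_pos_iff.1 (hcx.trans_le hA')
  have nB : B ≠ 0 := norm_pos_iff.1 (hcy.trans_le hB)
  have nB' : B' ≠ 0 := norm_pos_iff.1 (hcy.trans_le hB')
  have hD : 0 ≤ D := (norm_nonneg _).trans hAA
  have e : 1 / (A * B) - 1 / (A' * B') =
      (A' - A) * (A⁻¹ * A'⁻¹ * B⁻¹) + (B' - B) * (A'⁻¹ * B⁻¹ * B'⁻¹) := by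
    field_simp; ring
  have iA : ‖A⁻¹‖ ≤ (c * x)⁻¹ := by rw [norm_inv]; gcongr
  have iA' : ‖A'⁻¹‖ ≤ (c * x)⁻¹ := by rw [norm_inv]; gcongr
  have iB : ‖B⁻¹‖ ≤ (c * y)⁻¹ := by rw [norm_inv]; gcongr
  have iB' : ‖B'⁻¹‖ ≤ (c * y)⁻¹ := by rw [norm_inv]; gcongr
  rw [e]
  refine (norm_add_le _ _).trans ?_
  simp only [norm_mul]
  rw [norm_sub_rev A' A, norm_sub_rev B' B]
  calc _ ≤ D * ((c * x)⁻¹ * (c * x)⁻¹ * (c * y)⁻¹) + D * ((c * x)⁻¹ * (c * y)⁻¹ * (c * y)⁻¹) := by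
        gcongr
    _ = _ := by field_simp

/-- The third reciprocal from `norm_inv_mul_sub_le` is absorbed by the factor ℓ = λ² present in
every perturbation of the denominators. -/
lemma mul_inv_add_inv_le {ℓ x y : ℝ} (hℓ : 0 < ℓ) (hx : ℓ ≤ x) (hy : ℓ ≤ y) :
    ℓ * (x⁻¹ + y⁻¹) ≤ 2 := by
  have h1 : ℓ * x⁻¹ ≤ 1 := by rw [← div_eq_mul_inv]; exact div_le_one_of_le₀ hx (by linarith)
  have h2 : ℓ * y⁻¹ ≤ 1 := by rw [← div_eq_mul_inv]; exact div_le_one_of_le₀ hy (by linarith)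
  linarith

lemma convex_box (d : ℕ) : Convex ℝ (box d) := by
  intro p hp q hq a b ha hb hab i
  have h1 := hp i
  have h2 := hq i
  exact (convex_Icc (-(1 / 2) : ℝ) (1 / 2)) h1 h2 ha hb hab

lemma exists_bound_lipschitz_box {d : ℕ} {f : Mom d → ℂ} (hf : ContDiff ℝ 1 f) : ∃ M : ℝ, 0 ≤ M ∧
    (∀ p ∈ box d, ‖f p‖ ≤ M) ∧ ∀ p ∈ box d, ∀ q ∈ box d, ‖f p - f q‖ ≤ M * ‖p - q‖ := by
  obtain ⟨M1, h1⟩ := (isCompact_box d).exists_bound_of_continuousOn hf.continuous.continuousOn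
  obtain ⟨M2, h2⟩ := (isCompact_box d).exists_bound_of_continuousOn
    (hf.continuous_fderiv one_ne_zero).continuousOn
  refine ⟨max 0 (max M1 M2), le_max_left _ _, fun p hp => (h1 p hp).trans (by simp), ?_⟩
  intro p hp q hq
  exact (convex_box d).norm_image_sub_le_of_norm_fderiv_le
    (fun x _ => hf.differentiable one_ne_zero x) (fun x hx => (h2 x hx).trans (by simp)) hq hp

lemma integral_cell_disp_le {n : ℕ} (hn : 2 ≤ n) : ∃ K : ℝ, 0 ≤ K ∧ ∀ ψ : ℝ → ℝ, Measurable ψ →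
    (∀ a, 0 ≤ ψ a) → Integrable ψ → IntegrableOn (fun p : Mom (n + 1) => ψ (disp p)) (cell (n + 1)) ∧
      ∫ p in cell (n + 1), ψ (disp p) ≤ K * ∫ a, ψ a := by
  obtain ⟨K, hK, h⟩ := lintegral_cell_disp_le hn
  refine ⟨K, hK, fun ψ hm h0 hi => ?_⟩
  have hb := h (fun a => ENNReal.ofReal (ψ a)) hm.ennreal_ofReal
  rw [← ofReal_integral_eq_lintegral_ofReal hi (Eventually.of_forall h0),
    ← ENNReal.ofReal_mul hK] at hb
  have hm' : Measurable fun p : Mom (n + 1) => ψ (disp p) := hm.comp continuous_disp.measurable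
  refine ⟨⟨hm'.aestronglyMeasurable, ?_⟩, ?_⟩
  · rw [hasFiniteIntegral_iff_ofReal (Eventually.of_forall fun p => h0 _)]
    exact lt_of_le_of_lt hb ENNReal.ofReal_lt_top
  · rw [integral_eq_lintegral_of_nonneg_ae (Eventually.of_forall fun p => h0 _)
      hm'.aestronglyMeasurable]
    exact ENNReal.toReal_le_of_le_ofReal (mul_nonneg hK (integral_nonneg h0)) hb

/-! ### The ladder integral -/

lemma sq_mul_re (lam : ℝ) (z : ℂ) : ((lam : ℂ) ^ 2 * z).re = lam ^ 2 * z.re := by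
  rw [← Complex.ofReal_pow, Complex.re_ofReal_mul]

lemma sq_mul_im (lam : ℝ) (z : ℂ) : ((lam : ℂ) ^ 2 * z).im = lam ^ 2 * z.im := by
  rw [← Complex.ofReal_pow, Complex.im_ofReal_mul]

/-- The advanced denominator of the ladder integrand. -/
def advDen {d : ℕ} (lam η α : ℝ) (r p : Mom d) : ℂ :=
  (α : ℂ) - (starRingEnd ℂ) (omega lam (p - r)) - Complex.I * (η : ℂ)

/-- The retarded denominator of the ladder integrand. -/
def retDen {d : ℕ} (lam η β : ℝ) (r p : Mom d) : ℂ :=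
  (β : ℂ) - omega lam (p + r) + Complex.I * (η : ℂ)

/-- The energy at which the linearized advanced denominator vanishes. -/
def advPole {d : ℕ} (lam η α γ : ℝ) (r p : Mom d) : ℂ :=
  ((α + inner ℝ (gradDisp p) r : ℝ) : ℂ) - (lam : ℂ) ^ 2 * (starRingEnd ℂ) (Theta d γ) -
    Complex.I * (η : ℂ)

/-- The energy at which the linearized retarded denominator vanishes. -/
def retPole {d : ℕ} (lam η β γ : ℝ) (r p : Mom d) : ℂ :=
  ((β - inner ℝ (gradDisp p) r : ℝ) : ℂ) - (lam : ℂ) ^ 2 * Theta d γ + Complex.I * (η : ℂ)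

lemma advPole_im {d : ℕ} (lam η α γ : ℝ) (r p : Mom d) :
    (advPole lam η α γ r p).im = -(η - lam ^ 2 * (Theta d γ).im) := by
  simp only [advPole, Complex.sub_im, Complex.ofReal_im, sq_mul_im, Complex.conj_im,
    Complex.I_mul_im, Complex.ofReal_re]
  ring

lemma retPole_im {d : ℕ} (lam η β γ : ℝ) (r p : Mom d) :
    (retPole lam η β γ r p).im = η - lam ^ 2 * (Theta d γ).im := by
  simp only [retPole, Complex.sub_im, Complex.add_im, Complex.ofReal_im, sq_mul_im,
    Complex.I_mul_im, Complex.ofReal_re]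
  ring

lemma advPole_re {d : ℕ} (lam η α γ : ℝ) (r p : Mom d) :
    (advPole lam η α γ r p).re = α + inner ℝ (gradDisp p) r - lam ^ 2 * (Theta d γ).re := by
  simp only [advPole, Complex.sub_re, Complex.ofReal_re, sq_mul_re, Complex.conj_re,
    Complex.I_mul_re, Complex.ofReal_im]
  ring

lemma retPole_re {d : ℕ} (lam η β γ : ℝ) (r p : Mom d) :
    (retPole lam η β γ r p).re = β - inner ℝ (gradDisp p) r - lam ^ 2 * (Theta d γ).re := by
  simp only [retPole, Complex.sub_re, Complex.add_re, Complex.ofReal_re, sq_mul_re,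
    Complex.I_mul_re, Complex.ofReal_im]
  ring

lemma advDen_im {d : ℕ} (lam η α : ℝ) (r p : Mom d) :
    (advDen lam η α r p).im = -(η - lam ^ 2 * (Theta d (disp (p - r))).im) := by
  simp only [advDen, omega, Complex.sub_im, Complex.ofReal_im, sq_mul_im, Complex.conj_im,
    Complex.add_im, Complex.I_mul_im, Complex.ofReal_re]
  ring

lemma retDen_im {d : ℕ} (lam η β : ℝ) (r p : Mom d) :
    (retDen lam η β r p).im = η - lam ^ 2 * (Theta d (disp (p + r))).im := by
  simp only [retDen, omega, Complex.sub_im, Complex.ofReal_im, sq_mul_im,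
    Complex.add_im, Complex.I_mul_im, Complex.ofReal_re]
  ring

lemma advDen_re {d : ℕ} (lam η α : ℝ) (r p : Mom d) :
    (advDen lam η α r p).re = α - disp (p - r) - lam ^ 2 * (Theta d (disp (p - r))).re := by
  simp only [advDen, omega, Complex.sub_re, Complex.ofReal_re, sq_mul_re, Complex.conj_re,
    Complex.add_re, Complex.I_mul_re, Complex.ofReal_im]
  ring

lemma retDen_re {d : ℕ} (lam η β : ℝ) (r p : Mom d) :
    (retDen lam η β r p).re = β - disp (p + r) - lam ^ 2 * (Theta d (disp (p + r))).re := by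
  simp only [retDen, omega, Complex.sub_re, Complex.ofReal_re, sq_mul_re,
    Complex.add_re, Complex.I_mul_re, Complex.ofReal_im]
  ring

/-- The constants of the dispersion relation and of `Θ` that enter the estimates. -/
lemma exists_constants {n : ℕ} (hn : 2 ≤ n) : ∃ c : ℝ, 1 ≤ c ∧
    (∀ a, ‖Theta (n + 1) a‖ ≤ c) ∧
    (∀ a b, ‖Theta (n + 1) a - Theta (n + 1) b‖ ≤ c * |a - b| ^ (3 / 8 : ℝ)) ∧
    (∀ p r : Mom (n + 1), |inner ℝ (gradDisp p) r| ≤ c * ‖r‖) ∧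
    (∀ p q r : Mom (n + 1), |inner ℝ (gradDisp p) r - inner ℝ (gradDisp q) r| ≤
      c * (‖p - q‖ * ‖r‖)) ∧
    (∀ p r : Mom (n + 1), |disp (p + r) - disp p| ≤ c * ‖r‖) ∧
    (∀ p r : Mom (n + 1), |disp (p + r) - disp p - inner ℝ (gradDisp p) r| ≤ c * ‖r‖ ^ 2) := by
  obtain ⟨c1, h1, H1⟩ := Theta_bounded hn
  obtain ⟨c2, h2, H2⟩ := Theta_holder hn
  set c3 : ℝ := ((n + 1 : ℕ) : ℝ) * (2 * Real.pi) ^ 2 with hc3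
  have h3 : 0 ≤ c3 := by positivity
  have l1 : c1 ≤ c1 + c2 + c3 + 1 := by linarith
  have l2 : c2 ≤ c1 + c2 + c3 + 1 := by linarith
  have l3 : c3 ≤ c1 + c2 + c3 + 1 := by linarith
  refine ⟨c1 + c2 + c3 + 1, by linarith, fun a => (H1 a).trans l1,
    fun a b => (H2 a b).trans (by gcongr), fun p r => (abs_inner_gradDisp_le p r).trans (by gcongr),
    fun p q r => (abs_inner_gradDisp_sub_le p q r).trans (by gcongr),
    fun p r => (abs_disp_add_sub_le p r).trans (by gcongr),
    fun p r => (abs_disp_add_sub_sub_le p r).trans (by gcongr)⟩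

/-! ### Lower bounds for the denominators and their linearization errors. -/

section Bounds

variable {n : ℕ} {c lam ρ η : ℝ} {r : Mom (n + 1)}

lemma sq_mul_abs_re_le (hΘ : ∀ a, ‖Theta (n + 1) a‖ ≤ c) (lam a : ℝ) :
    |lam ^ 2 * (Theta (n + 1) a).re| ≤ c * lam ^ 2 := by
  rw [abs_mul, abs_of_nonneg (sq_nonneg lam), mul_comm]
  gcongr
  exact (Complex.abs_re_le_norm _).trans (hΘ a)

lemma le_abs_im (hn : 2 ≤ n) (hη : lam ^ 2 * ρ ≤ η) (a : ℝ) :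
    lam ^ 2 * ρ ≤ |η - lam ^ 2 * (Theta (n + 1) a).im| := by
  refine le_trans ?_ (le_abs_self _)
  have := mul_nonneg (sq_nonneg lam) (neg_nonneg.2 (Theta_im_nonpos hn a))
  linarith

/-- The shift ∇e·r and the real part of the self-energy each move the pole by at most cλ², so
`norm_lower_bound` applies with 2c in place of c. The next three bounds follow the same pattern,
with the variation of e in place of ∇e·r for the true denominators. -/
lemma advPole_lower (hn : 2 ≤ n) (hc : 1 ≤ c) (hΘ : ∀ a, ‖Theta (n + 1) a‖ ≤ c)
    (hg : ∀ p r : Mom (n + 1), |inner ℝ (gradDisp p) r| ≤ c * ‖r‖)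
    (hρ : 0 < ρ) (hρ1 : ρ ≤ 1) (hη : lam ^ 2 * ρ ≤ η) (hr : ‖r‖ ≤ lam ^ 2)
    (α γ a : ℝ) (p : Mom (n + 1)) :
    ρ / (2 * c + 2) * (|a - α| + lam ^ 2) ≤ ‖(a : ℂ) - advPole lam η α γ r p‖ := by
  refine norm_lower_bound (by linarith) hρ hρ1 ?_ ?_
  · rw [Complex.sub_im, Complex.ofReal_im, advPole_im, zero_sub, neg_neg]
    exact le_abs_im hn hη γ
  · rw [Complex.sub_re, Complex.ofReal_re, advPole_re]
    have h1 := sq_mul_abs_re_le hΘ lam γ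
    have h2 : |inner ℝ (gradDisp p) r| ≤ c * lam ^ 2 := (hg p r).trans (by gcongr)
    have e : a - α = (a - (α + inner ℝ (gradDisp p) r - lam ^ 2 * (Theta (n + 1) γ).re)) +
      (inner ℝ (gradDisp p) r - lam ^ 2 * (Theta (n + 1) γ).re) := by ring
    have h3 := abs_add_le (a - (α + inner ℝ (gradDisp p) r - lam ^ 2 * (Theta (n + 1) γ).re))
      (inner ℝ (gradDisp p) r - lam ^ 2 * (Theta (n + 1) γ).re)
    rw [← e] at h3
    have h4 := abs_sub (inner ℝ (gradDisp p) r) (lam ^ 2 * (Theta (n + 1) γ).re)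
    linarith

lemma retPole_lower (hn : 2 ≤ n) (hc : 1 ≤ c) (hΘ : ∀ a, ‖Theta (n + 1) a‖ ≤ c)
    (hg : ∀ p r : Mom (n + 1), |inner ℝ (gradDisp p) r| ≤ c * ‖r‖)
    (hρ : 0 < ρ) (hρ1 : ρ ≤ 1) (hη : lam ^ 2 * ρ ≤ η) (hr : ‖r‖ ≤ lam ^ 2)
    (β γ a : ℝ) (p : Mom (n + 1)) :
    ρ / (2 * c + 2) * (|a - β| + lam ^ 2) ≤ ‖(a : ℂ) - retPole lam η β γ r p‖ := by
  refine norm_lower_bound (by linarith) hρ hρ1 ?_ ?_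
  · rw [Complex.sub_im, Complex.ofReal_im, retPole_im, zero_sub, abs_neg]
    exact le_abs_im hn hη γ
  · rw [Complex.sub_re, Complex.ofReal_re, retPole_re]
    have h1 := sq_mul_abs_re_le hΘ lam γ
    have h2 : |inner ℝ (gradDisp p) r| ≤ c * lam ^ 2 := (hg p r).trans (by gcongr)
    have e : a - β = (a - (β - inner ℝ (gradDisp p) r - lam ^ 2 * (Theta (n + 1) γ).re)) -
      (inner ℝ (gradDisp p) r + lam ^ 2 * (Theta (n + 1) γ).re) := by ring
    have h3 := abs_sub (a - (β - inner ℝ (gradDisp p) r - lam ^ 2 * (Theta (n + 1) γ).re))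
      (inner ℝ (gradDisp p) r + lam ^ 2 * (Theta (n + 1) γ).re)
    rw [← e] at h3
    have h4 := abs_add_le (inner ℝ (gradDisp p) r) (lam ^ 2 * (Theta (n + 1) γ).re)
    linarith

lemma advDen_lower (hn : 2 ≤ n) (hc : 1 ≤ c) (hΘ : ∀ a, ‖Theta (n + 1) a‖ ≤ c)
    (hd : ∀ p r : Mom (n + 1), |disp (p + r) - disp p| ≤ c * ‖r‖)
    (hρ : 0 < ρ) (hρ1 : ρ ≤ 1) (hη : lam ^ 2 * ρ ≤ η) (hr : ‖r‖ ≤ lam ^ 2)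
    (α : ℝ) (p : Mom (n + 1)) :
    ρ / (2 * c + 2) * (|disp p - α| + lam ^ 2) ≤ ‖advDen lam η α r p‖ := by
  refine norm_lower_bound (by linarith) hρ hρ1 ?_ ?_
  · rw [advDen_im, abs_neg]
    exact le_abs_im hn hη _
  · rw [advDen_re]
    have h1 := sq_mul_abs_re_le hΘ lam (disp (p - r))
    have h2 : |disp (p - r) - disp p| ≤ c * lam ^ 2 := by
      have := hd p (-r)
      rw [← sub_eq_add_neg, norm_neg] at this
      exact this.trans (by gcongr)
    have e : disp p - α = -(α - disp (p - r) - lam ^ 2 * (Theta (n + 1) (disp (p - r))).re) -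
      (disp (p - r) - disp p + lam ^ 2 * (Theta (n + 1) (disp (p - r))).re) := by ring
    have h3 := abs_sub (-(α - disp (p - r) - lam ^ 2 * (Theta (n + 1) (disp (p - r))).re))
      (disp (p - r) - disp p + lam ^ 2 * (Theta (n + 1) (disp (p - r))).re)
    rw [← e, abs_neg] at h3
    have h4 := abs_add_le (disp (p - r) - disp p) (lam ^ 2 * (Theta (n + 1) (disp (p - r))).re)
    linarith

lemma retDen_lower (hn : 2 ≤ n) (hc : 1 ≤ c) (hΘ : ∀ a, ‖Theta (n + 1) a‖ ≤ c)
    (hd : ∀ p r : Mom (n + 1), |disp (p + r) - disp p| ≤ c * ‖r‖)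
    (hρ : 0 < ρ) (hρ1 : ρ ≤ 1) (hη : lam ^ 2 * ρ ≤ η) (hr : ‖r‖ ≤ lam ^ 2)
    (β : ℝ) (p : Mom (n + 1)) :
    ρ / (2 * c + 2) * (|disp p - β| + lam ^ 2) ≤ ‖retDen lam η β r p‖ := by
  refine norm_lower_bound (by linarith) hρ hρ1 ?_ ?_
  · rw [retDen_im]
    exact le_abs_im hn hη _
  · rw [retDen_re]
    have h1 := sq_mul_abs_re_le hΘ lam (disp (p + r))
    have h2 : |disp (p + r) - disp p| ≤ c * lam ^ 2 := (hd p r).trans (by gcongr)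
    have e : disp p - β = -(β - disp (p + r) - lam ^ 2 * (Theta (n + 1) (disp (p + r))).re) -
      (disp (p + r) - disp p + lam ^ 2 * (Theta (n + 1) (disp (p + r))).re) := by ring
    have h3 := abs_sub (-(β - disp (p + r) - lam ^ 2 * (Theta (n + 1) (disp (p + r))).re))
      (disp (p + r) - disp p + lam ^ 2 * (Theta (n + 1) (disp (p + r))).re)
    rw [← e, abs_neg] at h3
    have h4 := abs_add_le (disp (p + r) - disp p) (lam ^ 2 * (Theta (n + 1) (disp (p + r))).re)
    linarith

/-- The linearization error of a denominator, in terms of the weights of both energies. -/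
lemma linearization_le (hc : 1 ≤ c)
    (hH : ∀ a b, ‖Theta (n + 1) a - Theta (n + 1) b‖ ≤ c * |a - b| ^ (3 / 8 : ℝ))
    (hd : ∀ p r : Mom (n + 1), |disp (p + r) - disp p| ≤ c * ‖r‖)
    (ht : ∀ p r : Mom (n + 1), |disp (p + r) - disp p - inner ℝ (gradDisp p) r| ≤ c * ‖r‖ ^ 2)
    (hlam : 0 < lam) (hlam1 : lam ≤ 1) (hr : ‖r‖ ≤ lam ^ 2) (α β : ℝ) (p : Mom (n + 1)) :
    |disp (p + r) - disp p - inner ℝ (gradDisp p) r| +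
      lam ^ 2 * ‖Theta (n + 1) (disp (p + r)) - Theta (n + 1) ((α + β) / 2)‖ ≤
    3 * c ^ 2 * (lam ^ 2 *
      (|disp p - α| + lam ^ 2 + (|disp p - β| + lam ^ 2)) ^ (3 / 8 : ℝ)) := by
  set M := |disp p - α| + lam ^ 2 + (|disp p - β| + lam ^ 2) with hM
  have hℓ : 0 < lam ^ 2 := by positivity
  have hℓ1 : lam ^ 2 ≤ 1 := pow_le_one₀ hlam.le hlam1
  have a1 := abs_nonneg (disp p - α)
  have a2 := abs_nonneg (disp p - β)
  have hMℓ : lam ^ 2 ≤ M := by linarith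
  -- The quadratic Taylor remainder is of order ℓ², and ℓ ≤ ℓ^(3/8) ≤ M^(3/8) since ℓ ≤ 1 and ℓ ≤ M.
  have h1 : |disp (p + r) - disp p - inner ℝ (gradDisp p) r| ≤
      c * (lam ^ 2 * M ^ (3 / 8 : ℝ)) := by
    refine (ht p r).trans ?_
    have h2 : ‖r‖ ^ 2 ≤ lam ^ 2 * lam ^ 2 := by rw [← sq]; gcongr
    have h3 : lam ^ 2 ≤ M ^ (3 / 8 : ℝ) := by
      calc lam ^ 2 = (lam ^ 2) ^ (1 : ℝ) := (Real.rpow_one _).symm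
        _ ≤ (lam ^ 2) ^ (3 / 8 : ℝ) :=
          Real.rpow_le_rpow_of_exponent_ge hℓ hℓ1 (by norm_num)
        _ ≤ _ := by gcongr
    gcongr
    exact h2.trans (by gcongr)
  -- The energy at which Θ is evaluated differs from e(p) by at most cλ², and e(p) is no further
  -- from the midpoint γ than the sum of its distances to α and β.
  have h4 : |disp (p + r) - (α + β) / 2| ≤ 2 * c * M := by
    have h5 : |disp (p + r) - disp p| ≤ c * M := (hd p r).trans (by gcongr; linarith)
    have h6 : |disp p - (α + β) / 2| ≤ M := by
      have e : disp p - (α + β) / 2 = ((disp p - α) + (disp p - β)) / 2 := by ring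
      rw [e, abs_div, abs_two]
      have := abs_add_le (disp p - α) (disp p - β)
      linarith
    have h7 := abs_sub_le (disp (p + r)) (disp p) ((α + β) / 2)
    have h8 : M ≤ c * M := le_mul_of_one_le_left (by linarith) hc
    linarith
  have h9 : |disp (p + r) - (α + β) / 2| ^ (3 / 8 : ℝ) ≤ 2 * c * M ^ (3 / 8 : ℝ) := by
    calc _ ≤ (2 * c * M) ^ (3 / 8 : ℝ) := by gcongr
      _ = (2 * c) ^ (3 / 8 : ℝ) * M ^ (3 / 8 : ℝ) :=
        Real.mul_rpow (by linarith) (by linarith)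
      _ ≤ (2 * c) ^ (1 : ℝ) * M ^ (3 / 8 : ℝ) := by
        gcongr
        · linarith
        · norm_num
      _ = _ := by rw [Real.rpow_one]
  have h10 : lam ^ 2 * ‖Theta (n + 1) (disp (p + r)) - Theta (n + 1) ((α + β) / 2)‖ ≤
      lam ^ 2 * (c * (2 * c * M ^ (3 / 8 : ℝ))) := by
    gcongr
    exact (hH _ _).trans (by gcongr)
  have hM0 : 0 ≤ lam ^ 2 * M ^ (3 / 8 : ℝ) := by positivity
  have hcc : c ≤ c ^ 2 := by nlinarith
  nlinarith

/-- The sign of the linearized denominator cancels later against that of the retarded one. The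
advanced case is the estimate for -r, since conjugation preserves norms. -/
lemma advDen_sub_le (hc : 1 ≤ c)
    (hH : ∀ a b, ‖Theta (n + 1) a - Theta (n + 1) b‖ ≤ c * |a - b| ^ (3 / 8 : ℝ))
    (hd : ∀ p r : Mom (n + 1), |disp (p + r) - disp p| ≤ c * ‖r‖)
    (ht : ∀ p r : Mom (n + 1), |disp (p + r) - disp p - inner ℝ (gradDisp p) r| ≤ c * ‖r‖ ^ 2)
    (hlam : 0 < lam) (hlam1 : lam ≤ 1) (hr : ‖r‖ ≤ lam ^ 2) (α β : ℝ) (p : Mom (n + 1)) :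
    ‖advDen lam η α r p - -((disp p : ℂ) - advPole lam η α ((α + β) / 2) r p)‖ ≤
    3 * c ^ 2 * (lam ^ 2 *
      (|disp p - α| + lam ^ 2 + (|disp p - β| + lam ^ 2)) ^ (3 / 8 : ℝ)) := by
  have h := linearization_le hc hH hd ht hlam hlam1 (r := -r) (by rwa [norm_neg]) α β p
  rw [← sub_eq_add_neg, inner_neg_right] at h
  refine le_trans ?_ h
  have e : advDen lam η α r p - -((disp p : ℂ) - advPole lam η α ((α + β) / 2) r p) =
      -((disp (p - r) - disp p - -inner ℝ (gradDisp p) r : ℝ) : ℂ) -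
        ((lam ^ 2 : ℝ) : ℂ) * (starRingEnd ℂ) (Theta (n + 1) (disp (p - r)) -
          Theta (n + 1) ((α + β) / 2)) := by
    simp only [advDen, omega, advPole, map_add, map_mul, map_pow, Complex.conj_ofReal, map_sub]
    push_cast
    ring
  rw [e]
  refine (norm_sub_le _ _).trans ?_
  rw [norm_neg, norm_mul, RCLike.norm_conj, Complex.norm_real, Complex.norm_real, Real.norm_eq_abs,
    Real.norm_of_nonneg (sq_nonneg lam)]

lemma retDen_sub_le (hc : 1 ≤ c)
    (hH : ∀ a b, ‖Theta (n + 1) a - Theta (n + 1) b‖ ≤ c * |a - b| ^ (3 / 8 : ℝ))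
    (hd : ∀ p r : Mom (n + 1), |disp (p + r) - disp p| ≤ c * ‖r‖)
    (ht : ∀ p r : Mom (n + 1), |disp (p + r) - disp p - inner ℝ (gradDisp p) r| ≤ c * ‖r‖ ^ 2)
    (hlam : 0 < lam) (hlam1 : lam ≤ 1) (hr : ‖r‖ ≤ lam ^ 2) (α β : ℝ) (p : Mom (n + 1)) :
    ‖retDen lam η β r p - -((disp p : ℂ) - retPole lam η β ((α + β) / 2) r p)‖ ≤
    3 * c ^ 2 * (lam ^ 2 *
      (|disp p - α| + lam ^ 2 + (|disp p - β| + lam ^ 2)) ^ (3 / 8 : ℝ)) := by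
  refine le_trans ?_ (linearization_le hc hH hd ht hlam hlam1 hr α β p)
  have e : retDen lam η β r p - -((disp p : ℂ) - retPole lam η β ((α + β) / 2) r p) =
      -((disp (p + r) - disp p - inner ℝ (gradDisp p) r : ℝ) : ℂ) -
        ((lam ^ 2 : ℝ) : ℂ) * (Theta (n + 1) (disp (p + r)) - Theta (n + 1) ((α + β) / 2)) := by
    simp only [retDen, omega, retPole]
    push_cast
    ring
  rw [e]
  refine (norm_sub_le _ _).trans ?_
  rw [norm_neg, norm_mul, Complex.norm_real, Complex.norm_real, Real.norm_eq_abs,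
    Real.norm_of_nonneg (sq_nonneg lam)]

end Bounds

/-! ### Continuity of denominators and poles, and the energy weights. -/

lemma continuous_advDen {n : ℕ} (hn : 2 ≤ n) (lam η α : ℝ) (r : Mom (n + 1)) :
    Continuous (advDen lam η α r) := by
  have h1 : Continuous fun p : Mom (n + 1) => disp (p - r) := continuous_disp.comp (by fun_prop)
  have h2 := (continuous_Theta hn).comp h1
  unfold advDen omega
  exact (continuous_const.sub (Complex.continuous_conj.comp
    ((Complex.continuous_ofReal.comp h1).add (continuous_const.mul h2)))).sub continuous_const

lemma continuous_retDen {n : ℕ} (hn : 2 ≤ n) (lam η β : ℝ) (r : Mom (n + 1)) :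
    Continuous (retDen lam η β r) := by
  have h1 : Continuous fun p : Mom (n + 1) => disp (p + r) := continuous_disp.comp (by fun_prop)
  have h2 := (continuous_Theta hn).comp h1
  unfold retDen omega
  exact (continuous_const.sub ((Complex.continuous_ofReal.comp h1).add
    (continuous_const.mul h2))).add continuous_const

lemma continuous_inner_gradDisp {d : ℕ} (r : Mom d) :
    Continuous fun p : Mom d => inner ℝ (gradDisp p) r :=
  continuous_gradDisp.inner continuous_const

lemma continuous_advPole {d : ℕ} (lam η α γ : ℝ) (r : Mom d) :
    Continuous (advPole lam η α γ r) := by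
  unfold advPole
  exact ((Complex.continuous_ofReal.comp
    (continuous_const.add (continuous_inner_gradDisp r))).sub continuous_const).sub continuous_const

lemma continuous_retPole {d : ℕ} (lam η β γ : ℝ) (r : Mom d) :
    Continuous (retPole lam η β γ r) := by
  unfold retPole
  exact ((Complex.continuous_ofReal.comp
    (continuous_const.sub (continuous_inner_gradDisp r))).sub continuous_const).add continuous_const

/-- In the difference of the poles the real parts of the self-energy cancel, while the shifts ∇e·r
and the imaginary parts double. -/
lemma shellIntegrand_eq {d : ℕ} (f : Mom d → ℂ) (lam η α β : ℝ) (r p : Mom d) :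
    shellIntegrand f lam η α β r p = f p / (advPole lam η α ((α + β) / 2) r p -
      retPole lam η β ((α + β) / 2) r p) := by
  rw [shellIntegrand, gradient_disp]
  congr 1
  refine Complex.ext ?_ ?_
  · rw [Complex.sub_re, Complex.sub_re, advPole_re, retPole_re, Complex.ofReal_re]
    simp only [Complex.mul_re, Complex.mul_im, Complex.ofReal_re, Complex.ofReal_im, Complex.I_re,
      Complex.I_im, Complex.re_ofNat, Complex.im_ofNat]
    ring
  · rw [Complex.sub_im, Complex.sub_im, advPole_im, retPole_im, Complex.ofReal_im]
    simp only [Complex.mul_re, Complex.mul_im, Complex.ofReal_re, Complex.ofReal_im, Complex.I_re,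
      Complex.I_im, Complex.re_ofNat, Complex.im_ofNat]
    ring

/-- The integrals of the weights of both energies. -/
lemma integral_weight_le : ∃ K : ℝ, 0 ≤ K ∧ ∀ ℓ : ℝ, 0 < ℓ → ∀ α β : ℝ,
    Integrable (fun a : ℝ => ((|a - α| + ℓ) * (|a - β| + ℓ))⁻¹) ∧
    Integrable (fun a : ℝ => (|a - α| + ℓ + (|a - β| + ℓ)) ^ (3 / 8 : ℝ) *
      ((|a - α| + ℓ) * (|a - β| + ℓ))⁻¹) ∧
    ∫ a : ℝ, (|a - α| + ℓ + (|a - β| + ℓ)) ^ (3 / 8 : ℝ) *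
      ((|a - α| + ℓ) * (|a - β| + ℓ))⁻¹ ≤ K * ℓ ^ (-(5 / 8) : ℝ) := by
  obtain ⟨K, hK, h⟩ := integral_abs_add_rpow_scaled (-(13 / 8)) (by norm_num)
  obtain ⟨_, -, h2⟩ := integral_abs_add_rpow_scaled (-2) (by norm_num)
  refine ⟨4 * K, by positivity, fun ℓ hℓ α β => ?_⟩
  have px : ∀ a b : ℝ, 0 < |a - b| + ℓ := fun a b => by positivity
  have hle : ∀ a : ℝ, (|a - α| + ℓ + (|a - β| + ℓ)) ^ (3 / 8 : ℝ) *
      ((|a - α| + ℓ) * (|a - β| + ℓ))⁻¹ ≤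
      2 * ((|a - α| + ℓ) ^ (-(13 / 8) : ℝ) + (|a - β| + ℓ) ^ (-(13 / 8) : ℝ)) := fun a =>
    rpow_add_div_mul_le (px a α) (px a β)
  have hb := (((h α ℓ hℓ).1.add (h β ℓ hℓ).1).const_mul 2)
  have hi : Integrable (fun a : ℝ => (|a - α| + ℓ + (|a - β| + ℓ)) ^ (3 / 8 : ℝ) *
      ((|a - α| + ℓ) * (|a - β| + ℓ))⁻¹) := by
    refine hb.mono' (by fun_prop) (Eventually.of_forall fun a => ?_)
    have := px a α
    have := px a β
    rw [Real.norm_of_nonneg (by positivity)]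
    exact hle a
  refine ⟨?_, hi, ?_⟩
  · refine ((h2 α ℓ hℓ).1.add (h2 β ℓ hℓ).1).mono' (by fun_prop) (Eventually.of_forall fun a => ?_)
    have := px a α
    have := px a β
    have e : ∀ x : ℝ, 0 < x → x ^ (-2 : ℝ) = x⁻¹ ^ 2 := fun x hx => by
      rw [Real.rpow_neg hx.le, Real.rpow_two, inv_pow]
    rw [Real.norm_of_nonneg (by positivity), mul_inv, Pi.add_apply, e _ (px a α), e _ (px a β)]
    nlinarith [sq_nonneg ((|a - α| + ℓ)⁻¹ - (|a - β| + ℓ)⁻¹), sq_nonneg ((|a - α| + ℓ)⁻¹),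
      sq_nonneg ((|a - β| + ℓ)⁻¹)]
  · refine (integral_mono hi hb hle).trans (le_of_eq ?_)
    have e1 := (h α ℓ hℓ).2
    have e2 := (h β ℓ hℓ).2
    have e3 := integral_add (h α ℓ hℓ).1 (h β ℓ hℓ).1
    rw [integral_const_mul]
    simp only [Pi.add_apply] at e3 ⊢
    rw [e3, e1, e2]
    norm_num
    ring

lemma shellInt_const_mul {n : ℕ} (z : ℂ) (h : Mom (n + 1) → ℂ) (a : ℝ) :
    shellInt (fun p => z * h p) a = z * shellInt h a := by
  rw [shellInt, shellInt, ← integral_const_mul]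
  congr 1; ext y
  ring

/-! ### Size, Lipschitz constant and energy integral of the linearized integrand. -/

section LinearizedIntegrand

variable {n : ℕ} {c lam ρ η M : ℝ} {r : Mom (n + 1)} {f : Mom (n + 1) → ℂ}

/-- The pole depends on p only through ∇e·r, so its Lipschitz constant carries the small factor ‖r‖
≤ λ². -/
lemma advPole_sub_le (hg : ∀ p q r : Mom (n + 1),
      |inner ℝ (gradDisp p) r - inner ℝ (gradDisp q) r| ≤ c * (‖p - q‖ * ‖r‖))
    (hc : 1 ≤ c) (hr : ‖r‖ ≤ lam ^ 2) (α γ a : ℝ) (p q : Mom (n + 1)) :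
    ‖((a : ℂ) - advPole lam η α γ r p) - ((a : ℂ) - advPole lam η α γ r q)‖ ≤
      c * ‖p - q‖ * lam ^ 2 := by
  have e : ((a : ℂ) - advPole lam η α γ r p) - ((a : ℂ) - advPole lam η α γ r q) =
      -((inner ℝ (gradDisp p) r - inner ℝ (gradDisp q) r : ℝ) : ℂ) := by
    simp only [advPole]; push_cast; ring
  rw [e, norm_neg, Complex.norm_real, Real.norm_eq_abs, mul_assoc]
  exact (hg p q r).trans (by gcongr)

lemma retPole_sub_le (hg : ∀ p q r : Mom (n + 1),
      |inner ℝ (gradDisp p) r - inner ℝ (gradDisp q) r| ≤ c * (‖p - q‖ * ‖r‖))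
    (hc : 1 ≤ c) (hr : ‖r‖ ≤ lam ^ 2) (β γ a : ℝ) (p q : Mom (n + 1)) :
    ‖((a : ℂ) - retPole lam η β γ r p) - ((a : ℂ) - retPole lam η β γ r q)‖ ≤
      c * ‖p - q‖ * lam ^ 2 := by
  have e : ((a : ℂ) - retPole lam η β γ r p) - ((a : ℂ) - retPole lam η β γ r q) =
      ((inner ℝ (gradDisp p) r - inner ℝ (gradDisp q) r : ℝ) : ℂ) := by
    simp only [retPole]; push_cast; ring
  rw [e, Complex.norm_real, Real.norm_eq_abs, mul_assoc]
  exact (hg p q r).trans (by gcongr)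

/-- The linearized integrand, as a function of the momentum and of an independent energy. -/
def linIntegrand {d : ℕ} (f : Mom d → ℂ) (lam η α β : ℝ) (r p : Mom d) (a : ℝ) : ℂ :=
  f p * (1 / (((a : ℂ) - advPole lam η α ((α + β) / 2) r p) *
    ((a : ℂ) - retPole lam η β ((α + β) / 2) r p)))

/-- The poles lie on opposite sides of the axis, so the energy integral is a nonzero residue and
produces the main term exactly. -/
lemma integral_linIntegrand {α β : ℝ} (hη : 0 < η - lam ^ 2 * (Theta (n + 1) ((α + β) / 2)).im)
    (f : Mom (n + 1) → ℂ) (r p : Mom (n + 1)) :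
    ∫ a, linIntegrand f lam η α β r p a =
      -2 * Real.pi * Complex.I * shellIntegrand f lam η α β r p := by
  simp only [linIntegrand]
  rw [integral_const_mul, integral_resolvent_mul_opposite (by rw [advPole_im]; linarith)
    (by rw [retPole_im]; exact hη), shellIntegrand_eq]
  ring

/-- Two reciprocals would only cost c'^(-2); the weaker cube lets the same weight N serve for size
and Lipschitz constant. -/
lemma norm_linIntegrand_le {c' x y : ℝ} (hc' : 0 < c') (hc'1 : c' ≤ 1) (hx : 0 < x) (hy : 0 < y)
    {A B z : ℂ} (hA : c' * x ≤ ‖A‖) (hB : c' * y ≤ ‖B‖) (hM : 0 ≤ M) (hz : ‖z‖ ≤ M) :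
    ‖z * (1 / (A * B))‖ ≤ M * ((c' ^ 3)⁻¹ * (x * y)⁻¹) := by
  have h1 : (c' ^ 3)⁻¹ * (x * y)⁻¹ = (c' ^ 3 * (x * y))⁻¹ := (mul_inv _ _).symm
  have h2 : c' ^ 3 * (x * y) ≤ (c' * x) * (c' * y) := by
    have : c' ^ 3 ≤ c' ^ 2 := pow_le_pow_of_le_one hc'.le hc'1 (by norm_num)
    have := mul_le_mul_of_nonneg_right this (mul_pos hx hy).le
    linarith
  rw [norm_mul, norm_div, norm_one, norm_mul, one_div, h1]
  refine mul_le_mul hz (inv_anti₀ (by positivity) (h2.trans ?_)) (by positivity) hM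
  exact mul_le_mul hA hB (by positivity) (norm_nonneg _)

/-- In the factor 1 + 2c, the 1 is the variation of the numerator and 2c that of the two poles. -/
lemma norm_linIntegrand_sub_le {c' x y D ℓ : ℝ} (hc' : 0 < c') (hc'1 : c' ≤ 1) (hℓ : 0 < ℓ)
    (hx : ℓ ≤ x) (hy : ℓ ≤ y) {A A' B B' z z' : ℂ} (hA : c' * x ≤ ‖A‖) (hA' : c' * x ≤ ‖A'‖)
    (hB : c' * y ≤ ‖B‖) (hB' : c' * y ≤ ‖B'‖) (hM : 0 ≤ M) (hD : 0 ≤ D) (hz' : ‖z'‖ ≤ M)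
    (hzz : ‖z - z'‖ ≤ M * D) (hAA : ‖A - A'‖ ≤ c * D * ℓ) (hBB : ‖B - B'‖ ≤ c * D * ℓ)
    (hc : 0 ≤ c) :
    ‖z * (1 / (A * B)) - z' * (1 / (A' * B'))‖ ≤
      M * (1 + 2 * c) * ((c' ^ 3)⁻¹ * (x * y)⁻¹) * D := by
  have hx0 := hℓ.trans_le hx
  have hy0 := hℓ.trans_le hy
  have e : z * (1 / (A * B)) - z' * (1 / (A' * B')) =
      (z - z') * (1 / (A * B)) + z' * (1 / (A * B) - 1 / (A' * B')) := by ring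
  have h1 := norm_linIntegrand_le hc' hc'1 hx0 hy0 hA hB (mul_nonneg hM hD) hzz
  have h2 := norm_inv_mul_sub_le hc' hx0 hy0 hA hA' hB hB' hAA hBB
  have h3 : c * D * ℓ * (c' ^ 3)⁻¹ * ((x⁻¹ + y⁻¹) * (x * y)⁻¹) ≤
      2 * (c * D * ((c' ^ 3)⁻¹ * (x * y)⁻¹)) := by
    calc _ = (ℓ * (x⁻¹ + y⁻¹)) * (c * D * ((c' ^ 3)⁻¹ * (x * y)⁻¹)) := by ring
      _ ≤ _ := by
        gcongr
        exact mul_inv_add_inv_le hℓ hx hy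
  rw [e]
  refine (norm_add_le _ _).trans ?_
  rw [norm_mul z']
  have h4 := mul_le_mul hz' (h2.trans h3) (norm_nonneg _) hM
  refine (add_le_add h1 h4).trans (le_of_eq ?_)
  ring

end LinearizedIntegrand

/-- The ladder estimate with an arbitrary lower bound `lam ^ 2 * ρ` on the regularization. -/
theorem norm_ladder_sub_le {n : ℕ} (hn : 2 ≤ n) {f : Mom (n + 1) → ℂ} (hf : ContDiff ℝ 1 f) :
    ∃ C : ℝ, 0 ≤ C ∧ ∀ lam ρ η : ℝ, 0 < lam → lam ≤ 1 → 0 < ρ → ρ ≤ 1 → lam ^ 2 * ρ ≤ η →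
      ∀ r : Mom (n + 1), ‖r‖ ≤ lam ^ 2 → ∀ α β : ℝ,
      IntegrableOn (fun p => ladderIntegrand f lam η α β r p) (cell (n + 1)) ∧
      Integrable (shellDensity (fun p => shellIntegrand f lam η α β r p))
        (shellMeasure (n + 1) ((α + β) / 2)) ∧
      ‖(∫ p in cell (n + 1), ladderIntegrand f lam η α β r p) -
          (-2 * (Real.pi : ℂ) * Complex.I * (lam : ℂ) ^ 2 *
            deltaIntegral (fun p => shellIntegrand f lam η α β r p) ((α + β) / 2))‖
        ≤ C * ((ρ ^ 3)⁻¹ * (lam ^ 2) ^ (3 / 8 : ℝ)) := by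
  obtain ⟨c, hc, hΘ, hH, hg, hgg, hd, ht⟩ := exists_constants hn
  obtain ⟨M, hM, hfb, hfl⟩ := exists_bound_lipschitz_box hf
  obtain ⟨Kw, hKw, hw⟩ := integral_weight_le
  obtain ⟨Kd, hKd, hdisp⟩ := integral_cell_disp_le hn
  obtain ⟨Ks, hKs, hsh⟩ := integral_disp_sub_shellInt_le hn
  have hc0 : 0 < c := by linarith
  -- Here M bounds f, 3c² comes from the linearization error, and 2 from `mul_inv_add_inv_le`.
  set C1 : ℝ := M * (3 * c ^ 2 * 2) with hC1
  set C2 : ℝ := M * (1 + 2 * c) with hC2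
  have hC1' : 0 ≤ C1 := by positivity
  have hC2' : 0 ≤ C2 := by positivity
  refine ⟨(C1 * Kd + Ks * C2) * Kw * (2 * c + 2) ^ 3, by positivity, ?_⟩
  intro lam ρ η hlam hlam1 hρ hρ1 hη r hr α β
  set γ : ℝ := (α + β) / 2 with hγ
  set ℓ : ℝ := lam ^ 2 with hℓdef
  have hℓ : 0 < ℓ := by positivity
  set c' : ℝ := ρ / (2 * c + 2) with hc'def
  have hc' : 0 < c' := by positivity
  have hc'1 : c' ≤ 1 := by rw [hc'def, div_le_one (by positivity)]; linarith
  set x : ℝ → ℝ := fun a => |a - α| + ℓ with hxdef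
  set y : ℝ → ℝ := fun a => |a - β| + ℓ with hydef
  have hx : ∀ a, ℓ ≤ x a := fun a => le_add_of_nonneg_left (abs_nonneg _)
  have hy : ∀ a, ℓ ≤ y a := fun a => le_add_of_nonneg_left (abs_nonneg _)
  have hx0 : ∀ a, 0 < x a := fun a => hℓ.trans_le (hx a)
  have hy0 : ∀ a, 0 < y a := fun a => hℓ.trans_le (hy a)
  have xm : Measurable x := by fun_prop
  have ym : Measurable y := by fun_prop
  obtain ⟨hw1, hw2, hw3⟩ := hw ℓ hℓ α β
  set W : ℝ → ℝ := fun a => (x a + y a) ^ (3 / 8 : ℝ) * (x a * y a)⁻¹ with hWdef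
  have hW0 : ∀ a, 0 ≤ W a := fun a => by
    have := hx0 a
    have := hy0 a
    positivity
  have hWm : Measurable W := by fun_prop
  have lA := fun a p => advPole_lower (η := η) hn hc hΘ hg hρ hρ1 hη hr α γ a p
  have lB := fun a p => retPole_lower (η := η) hn hc hΘ hg hρ hρ1 hη hr β γ a p
  have lA' := fun p => advDen_lower (η := η) hn hc hΘ hd hρ hρ1 hη hr α p
  have lB' := fun p => retDen_lower (η := η) hn hc hΘ hd hρ hρ1 hη hr β p
  have nA : ∀ (a : ℝ) p, (a : ℂ) - advPole lam η α γ r p ≠ 0 := fun a p =>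
    norm_pos_iff.1 ((mul_pos hc' (hx0 a)).trans_le (lA a p))
  have nB : ∀ (a : ℝ) p, (a : ℂ) - retPole lam η β γ r p ≠ 0 := fun a p =>
    norm_pos_iff.1 ((mul_pos hc' (hy0 a)).trans_le (lB a p))
  have nA' : ∀ p, advDen lam η α r p ≠ 0 := fun p =>
    norm_pos_iff.1 ((mul_pos hc' (hx0 (disp p))).trans_le (lA' p))
  have nB' : ∀ p, retDen lam η β r p ≠ 0 := fun p =>
    norm_pos_iff.1 ((mul_pos hc' (hy0 (disp p))).trans_le (lB' p))
  have him : 0 < η - lam ^ 2 * (Theta (n + 1) γ).im := by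
    have h1 := mul_nonneg (sq_nonneg lam) (neg_nonneg.2 (Theta_im_nonpos hn γ))
    have h2 : 0 < lam ^ 2 * ρ := by positivity
    linarith
  -- continuity
  have cg : Continuous fun p => f p * (1 / (advDen lam η α r p * retDen lam η β r p)) :=
    hf.continuous.mul (continuous_const.div
      ((continuous_advDen hn lam η α r).mul (continuous_retDen hn lam η β r))
      fun p => mul_ne_zero (nA' p) (nB' p))
  have cF : Continuous (Function.uncurry (linIntegrand f lam η α β r)) := by
    refine (hf.continuous.comp continuous_fst).mul (continuous_const.div
      (((Complex.continuous_ofReal.comp continuous_snd).sub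
        ((continuous_advPole lam η α γ r).comp continuous_fst)).mul
        ((Complex.continuous_ofReal.comp continuous_snd).sub
        ((continuous_retPole lam η β γ r).comp continuous_fst)))
      fun z => mul_ne_zero (nA _ _) (nB _ _))
  have cG : Continuous fun p : Mom (n + 1) => linIntegrand f lam η α β r p (disp p) :=
    cF.comp (continuous_id.prodMk continuous_disp)
  have cS : Continuous fun p => shellIntegrand f lam η α β r p := by
    simp only [shellIntegrand_eq]
    refine hf.continuous.div ((continuous_advPole lam η α γ r).sub
      (continuous_retPole lam η β γ r)) fun p h => ?_
    have h2 := congrArg Complex.im h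
    rw [Complex.sub_im, advPole_im, retPole_im, Complex.zero_im] at h2
    linarith
  obtain ⟨N0, hN0⟩ := (isCompact_box (n + 1)).exists_bound_of_continuousOn cS.continuousOn
  obtain ⟨iS, eS⟩ := deltaIntegral_eq_shellInt hn cS.measurable hN0 γ
  have eL : (fun p => ladderIntegrand f lam η α β r p) = fun p =>
      (lam : ℂ) ^ 2 * (f p * (1 / (advDen lam η α r p * retDen lam η β r p))) := by
    funext p
    rw [ladderIntegrand, ← advDen, ← retDen]
    ring
  have iL := integrableOn_cell cg
  refine ⟨by rw [eL]; exact iL.const_mul _, iS, ?_⟩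
  -- linearization of the denominators
  have S1 : ‖(∫ p in cell (n + 1), f p * (1 / (advDen lam η α r p * retDen lam η β r p))) -
      ∫ p in cell (n + 1), linIntegrand f lam η α β r p (disp p)‖ ≤
      C1 * (c' ^ 3)⁻¹ * (Kd * ∫ a, W a) := by
    obtain ⟨iW, bW⟩ := hdisp W hWm hW0 hw2
    rw [← integral_sub iL (integrableOn_cell cG)]
    refine (norm_integral_le_of_norm_le (iW.const_mul (C1 * (c' ^ 3)⁻¹)) ?_).trans ?_
    · refine (ae_restrict_iff' (measurableSet_cell _)).2 (Eventually.of_forall fun p hp => ?_)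
      have h1 := norm_inv_mul_sub_le hc' (hx0 (disp p)) (hy0 (disp p)) (lA' p)
        ((lA (disp p) p).trans (norm_neg _).ge) (lB' p) ((lB (disp p) p).trans (norm_neg _).ge)
        (advDen_sub_le (η := η) hc hH hd ht hlam hlam1 hr α β p)
        (retDen_sub_le (η := η) hc hH hd ht hlam hlam1 hr α β p)
      -- The signs of the two linearized denominators cancel in the product.
      rw [neg_mul_neg] at h1
      rw [linIntegrand, ← mul_sub, norm_mul]
      refine (mul_le_mul (hfb p (cell_subset_box _ hp)) h1 (norm_nonneg _) hM).trans ?_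
      have h2 := mul_inv_add_inv_le hℓ (hx (disp p)) (hy (disp p))
      have h3 : 0 ≤ M * (3 * c ^ 2) * (c' ^ 3)⁻¹ * W (disp p) := by
        have := hW0 (disp p)
        positivity
      have h4 := mul_le_mul_of_nonneg_left h2 h3
      refine (le_of_eq ?_).trans (h4.trans (le_of_eq ?_))
      · simp only [hWdef, hxdef, hydef]; ring
      · rw [hC1]; ring
    · rw [integral_const_mul]
      gcongr
  -- replacement of the cell integral by the shell integral
  have S2 : ‖(∫ p in cell (n + 1), linIntegrand f lam η α β r p (disp p)) -
      -2 * Real.pi * Complex.I * deltaIntegral (fun p => shellIntegrand f lam η α β r p) γ‖ ≤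
      Ks * (C2 * (c' ^ 3)⁻¹ * ∫ a, W a) := by
    -- Since γ is the midpoint of α and β, moving the shell to γ costs no more than the weight
    -- already met in the linearization.
    have hγa : ∀ a, |a - γ| ≤ x a + y a := fun a => by
      have e : a - γ = ((a - α) + (a - β)) / 2 := by rw [hγ]; ring
      rw [e, abs_div, abs_two]
      have h1 := abs_add_le (a - α) (a - β)
      have h2 := abs_nonneg (a - α)
      have h3 := abs_nonneg (a - β)
      simp only [hxdef, hydef]
      linarith
    have hNW : ∀ a, C2 * ((c' ^ 3)⁻¹ * (x a * y a)⁻¹) * |a - γ| ^ (3 / 8 : ℝ) ≤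
        C2 * (c' ^ 3)⁻¹ * W a := fun a => by
      have h1 := hx0 a
      have h2 := hy0 a
      have h3 : |a - γ| ^ (3 / 8 : ℝ) ≤ (x a + y a) ^ (3 / 8 : ℝ) := by
        gcongr
        exact hγa a
      calc _ = C2 * (c' ^ 3)⁻¹ * (|a - γ| ^ (3 / 8 : ℝ) * (x a * y a)⁻¹) := by ring
        _ ≤ _ := by
          simp only [hWdef]
          gcongr
    have iN : Integrable fun a => C2 * ((c' ^ 3)⁻¹ * (x a * y a)⁻¹) * |a - γ| ^ (3 / 8 : ℝ) := by
      refine (hw2.const_mul (C2 * (c' ^ 3)⁻¹)).mono' (by fun_prop)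
        (Eventually.of_forall fun a => ?_)
      have h1 := hx0 a
      have h2 := hy0 a
      rw [Real.norm_of_nonneg (by positivity)]
      exact hNW a
    have h := hsh (linIntegrand f lam η α β r) (fun a => C2 * ((c' ^ 3)⁻¹ * (x a * y a)⁻¹)) γ
      cF.measurable ((hw1.const_mul _).const_mul _) iN
      (fun a p hp => by
        have h1 := hx0 a
        have h2 := hy0 a
        refine (norm_linIntegrand_le hc' hc'1 h1 h2 (lA a p) (lB a p) hM (hfb p hp)).trans ?_
        have : M ≤ C2 := le_mul_of_one_le_right hM (by linarith)
        gcongr)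
      (fun a p hp q hq => norm_linIntegrand_sub_le hc' hc'1 hℓ (hx a) (hy a) (lA a p) (lA a q)
        (lB a p) (lB a q) hM (norm_nonneg _) (hfb q hq) (hfl p hp q hq)
        (advPole_sub_le hgg hc hr α γ a p q) (retPole_sub_le hgg hc hr β γ a p q) hc0.le)
    simp only [integral_linIntegrand him] at h
    rw [shellInt_const_mul, ← eS] at h
    refine h.trans (mul_le_mul_of_nonneg_left ?_ hKs)
    rw [← integral_const_mul]
    exact integral_mono iN (hw2.const_mul _) hNW
  rw [eL, integral_const_mul]
  have e1 : ∀ u v s : ℂ, (lam : ℂ) ^ 2 * u - -2 * (Real.pi : ℂ) * Complex.I * (lam : ℂ) ^ 2 * v =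
      (lam : ℂ) ^ 2 * ((u - s) + (s - -2 * Real.pi * Complex.I * v)) := fun u v s => by ring
  rw [e1 _ _ (∫ p in cell (n + 1), linIntegrand f lam η α β r p (disp p)), norm_mul, norm_pow,
    Complex.norm_real, Real.norm_of_nonneg hlam.le]
  -- The prefactor λ² of the integrand turns the divergent weight integral into a positive power of
  -- ℓ.
  have hℓp : ℓ ^ (3 / 8 : ℝ) = ℓ * ℓ ^ (-(5 / 8) : ℝ) := by
    nth_rewrite 2 [← Real.rpow_one ℓ]
    rw [← Real.rpow_add hℓ]
    norm_num
  have hc3 : (c' ^ 3)⁻¹ = (2 * c + 2) ^ 3 * (ρ ^ 3)⁻¹ := by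
    rw [hc'def, div_pow, inv_div, div_eq_mul_inv]
  calc _ ≤ lam ^ 2 * (C1 * (c' ^ 3)⁻¹ * (Kd * ∫ a, W a) + Ks * (C2 * (c' ^ 3)⁻¹ * ∫ a, W a)) := by
        gcongr
        exact (norm_add_le _ _).trans (add_le_add S1 S2)
    _ = ℓ * (C1 * Kd + Ks * C2) * (c' ^ 3)⁻¹ * ∫ a, W a := by ring
    _ ≤ ℓ * (C1 * Kd + Ks * C2) * (c' ^ 3)⁻¹ * (Kw * ℓ ^ (-(5 / 8) : ℝ)) := by
        gcongr
    _ = _ := by rw [hc3, hℓp]; ring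

end

end Ladder

/-! ### Choice of scales and conclusion. -/

theorem lemma5 (d : ℕ) (hd : 3 ≤ d) (κ : ℝ) (hκ0 : 0 < κ) (hκ : κ < 1 / 16)
    (f : Ladder.Mom d → ℂ) (hf : ContDiff ℝ 1 f) (hper : Ladder.IsPeriodic f) :
    (∀ a : ℝ, Tendsto (fun ε : ℝ => Ladder.ThetaReg d ε a) (𝓝[>] (0 : ℝ))
      (𝓝 (Ladder.Theta d a))) ∧
    ∃ C : ℝ, ∃ lam₀ : ℝ, 0 < lam₀ ∧
      ∀ lam : ℝ, 0 < lam → lam < lam₀ →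
      ∀ η : ℝ, lam ^ (2 + 4 * κ) ≤ η → η ≤ lam ^ (2 + κ) →
      ∀ r : Ladder.Mom d, ‖r‖ ≤ lam ^ (2 + κ / 4) →
      ∀ α β : ℝ,
        IntegrableOn (fun p => Ladder.ladderIntegrand f lam η α β r p) (Ladder.cell d) volume ∧
        Integrable (Ladder.shellDensity (fun p => Ladder.shellIntegrand f lam η α β r p))
          (Ladder.shellMeasure d ((α + β) / 2)) ∧
        ‖(∫ p in Ladder.cell d, Ladder.ladderIntegrand f lam η α β r p) -
            (-2 * (Real.pi : ℂ) * Complex.I * (lam : ℂ) ^ 2 *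
              Ladder.deltaIntegral (fun p => Ladder.shellIntegrand f lam η α β r p)
                ((α + β) / 2))‖
          ≤ C * (lam ^ (1 / 2 - 8 * κ) * |Real.log lam|) := by
  obtain ⟨n, rfl⟩ : ∃ n, d = n + 1 := ⟨d - 1, by omega⟩
  have hn : 2 ≤ n := by omega
  refine ⟨Ladder.tendsto_ThetaReg hn, ?_⟩
  obtain ⟨C, hC, h⟩ := Ladder.norm_ladder_sub_le hn hf
  -- The threshold 1/e guarantees λ ≤ 1 and |log λ| ≥ 1, so the logarithm may be inserted at the end
  -- for free.
  refine ⟨C, Real.exp (-1), Real.exp_pos _, fun lam hlam hlt η hη _ r hr α β => ?_⟩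
  have hlam1 : lam ≤ 1 := hlt.le.trans (Real.exp_le_one_iff.2 (by norm_num))
  have hlog : 1 ≤ |Real.log lam| := by
    have h1 : Real.log lam < -1 := (Real.log_lt_iff_lt_exp hlam).2 hlt
    rw [abs_of_neg (by linarith)]
    linarith
  have hρη : lam ^ 2 * lam ^ (4 * κ) ≤ η := by
    rwa [← Real.rpow_two, ← Real.rpow_add hlam]
  have hr2 : ‖r‖ ≤ lam ^ 2 := by
    rw [← Real.rpow_two]
    exact hr.trans (Real.rpow_le_rpow_of_exponent_ge hlam hlam1 (by linarith))
  -- The choice ρ = λ^(4κ) turns λ²ρ into the assumed lower bound for η.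
  obtain ⟨h1, h2, h3⟩ := h lam (lam ^ (4 * κ)) η hlam hlam1 (Real.rpow_pos_of_pos hlam _)
    (Real.rpow_le_one hlam.le hlam1 (by linarith)) hρη r hr2 α β
  refine ⟨h1, h2, h3.trans (mul_le_mul_of_nonneg_left ?_ hC)⟩
  have e : ((lam ^ (4 * κ)) ^ 3)⁻¹ * (lam ^ 2) ^ (3 / 8 : ℝ) = lam ^ (3 / 4 - 12 * κ) := by
    rw [← Real.rpow_natCast, ← Real.rpow_mul hlam.le, ← Real.rpow_neg hlam.le, ← Real.rpow_two,
      ← Real.rpow_mul hlam.le, ← Real.rpow_add hlam]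
    congr 1
    push_cast
    ring
  rw [e]
  refine le_trans ?_ (le_mul_of_one_le_right (Real.rpow_nonneg hlam.le _) hlog)
  -- The comparison 1/2 - 8κ ≤ 3/4 - 12κ amounts to κ ≤ 1/16.
  exact Real.rpow_le_rpow_of_exponent_ge hlam hlam1 (by linarith)
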